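/- Let $G$ be a finite group, $k$ a field of characteristic $p$ with $p$ dividing $|G|$, and $S$ a Sylow $p$-subgroup of $G$. **Notation.** A $kG$-module $M$ (not necessarily finitely generated) is *Sylow-trivial* if its restriction to $S$ is isomorphic to $k\oplus(\text{projective } kS\text{-module})$. Let $T_k(G,S)$ be the abelian group, under $\otimes_k$, of Sylow-trivial $kG$-modules, where $M$ and $N$ are identified if $M\oplus P\cong N\oplus Q$ for some projective $kG$-modules $P,Q$. Let $\mathscr O_p^*(G)$ be the category with objects $G/P$, for $P$ a non-trivial $p$-subgroup of $G$, and morphisms all $G$-maps. A $1$-cocycle on $\mathscr O_p^*(G)$ is a function $\phi$ from morphisms to $k^\times$ with $\phi(g\circ f)=\phi(g)\phi(f)$; a coboundary is a cocycle of the form $(f\colon X\to Y)\mapsto c(Y)/c(X)$; and $H^1(\mathscr O_p^*(G);k^\times)$ is the group of cocycles modulo coboundaries. Given a cocycle $\phi$, let $C_*(|\mathcal S_p(G)|;k_\phi)$ be the following bounded complex of finitely generated $kG$-modules. In degree $n$ it is the $k$-vector space with basis the chains $\sigma=(P_0<\dots<P_n)$ of non-trivial $p$-subgroups of $G$. For $gPg^{-1}\le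 Q$ put $c_g(P,Q)=\phi\big(G/P\to G/Q,\ xP\mapsto xg^{-1}Q\big)^{-1}$. Then $g\in G$ acts by $g\cdot\sigma=c_g(P_0,gP_0g^{-1})\,(gP_0g^{-1}<\dots<gP_ng^{-1})$, and the differential is $\partial\sigma=\sum_{i=0}^n(-1)^i\, c_1(P_0,(d_i\sigma)_0)\; d_i\sigma$ for $n\geq 1$, where $d_i\sigma$ omits $P_i$ and $(d_i\sigma)_0$ is the smallest group of $d_i\sigma$. Finally, $D^b(kG)/K^b(kG)$ is the Verdier quotient of the bounded derived category of finitely generated $kG$-modules by the perfect complexes (those isomorphic to bounded complexes of finitely generated projective modules). **Theorem.** There is an isomorphism of abelian groups $$\Phi\colon T_k(G,S)\xrightarrow{\ \sim\ }H^1(\mathscr O_p^*(G);k^\times)$$ with the following properties. 1. For every Sylow-trivial $M$, the Tate cohomology group $\hat H^0(P;M)=M^P/(\sum_{x\in P}x)M$ is one-dimensional over $k$ for every non-trivial $p$-subgroup $P$. The contravariant functor $G/P\mapsto\hat H^0(P;M)$ on $\mathscr O_p^*(G)$, in which $f\colon G/P\to G/Q$ with $f(eP)=gQ$ induces $f^*\colon\hat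 H^0(Q;M)\to\hat H^0(P;M)$, $[m]\mapsto[gm]$, sends all morphisms to isomorphisms. For every choice of generators $b_P$ of the lines $\hat H^0(P;M)$, the function $\phi$ defined by $f^*(b_Q)=\phi(f)\,b_P$ is a $1$-cocycle, and its class is $\Phi([M])$. 2. For every $1$-cocycle $\phi$, the complex $C_*(|\mathcal S_p(G)|;k_\phi)$ is isomorphic in $D^b(kG)/K^b(kG)$ to some finitely generated $kG$-module placed in degree $0$. A finitely generated $kG$-module $M$, placed in degree $0$, is isomorphic to $C_*(|\mathcal S_p(G)|;k_\phi)$ in $D^b(kG)/K^b(kG)$ if and only if $M$ is Sylow-trivial and $[M]=\Phi^{-1}([\phi])$. -/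

import Mathlib

open CategoryTheory CategoryTheory.Limits MonoidalCategory Opposite

universe u v w

namespace SylowTriv

noncomputable section

section Orbit

/-- The set of non-trivial `p`-subgroups of `G`; as a subtype of `Subgroup G` it is ordered by
inclusion. -/
abbrev PSub (p : ℕ) (G : Type u) [Group G] : Type u :=
  {P : Subgroup G // IsPGroup p P ∧ P ≠ ⊥}

variable {p : ℕ} {G : Type u} [Group G]

/-- Conjugation `P ↦ gPg⁻¹` on non-trivial `p`-subgroups. -/
def conjSub (g : G) (P : PSub p G) : PSub p G :=
  ⟨P.1.map (MulAut.conj g).toMonoidHom, P.2.1.map _, by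
    rw [Ne, (P.1.map_eq_bot_iff_of_injective (MulAut.conj g).injective)]; exact P.2.2⟩

lemma mem_conjSub_iff (g : G) (P : PSub p G) (x : G) : x ∈ (conjSub g P).1 ↔ g⁻¹ * x * g ∈ P.1 := by
  constructor
  · rintro ⟨y, hy, rfl⟩
    simpa [mul_assoc] using hy
  · intro h
    exact ⟨_, h, by simp [mul_assoc]⟩

lemma conjSub_one (P : PSub p G) : conjSub 1 P = P := by
  apply Subtype.ext; ext x; simp [mem_conjSub_iff]

lemma conjSub_mul (g h : G) (P : PSub p G) : conjSub (g * h) P = conjSub g (conjSub h P) := by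
  apply Subtype.ext; ext x; simp [mem_conjSub_iff, mul_assoc]

lemma conjSub_strictMono (g : G) : StrictMono (conjSub (p := p) g) := by
  have h : ∀ P Q : PSub p G, conjSub g P ≤ conjSub g Q ↔ P ≤ Q := fun P Q =>
    Subgroup.map_le_map_iff_of_injective (MulAut.conj g).injective
  intro P Q hPQ
  rw [lt_iff_le_not_ge] at hPQ ⊢
  rwa [h, h]

/-- Objects of the orbit category of `G` on non-trivial `p`-subgroups: the object with underlying
subgroup `P` stands for the transitive `G`-set `G/P`. -/
structure OrbitCat (p : ℕ) (G : Type u) [Group G] : Type u where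
  /-- the subgroup `P` -/
  sub : PSub p G

/-- Morphisms of the orbit category are all `G`-maps `G/P → G/Q`. -/
instance : Category.{u} (OrbitCat p G) where
  Hom X Y := (G ⧸ X.sub.1) →[G] (G ⧸ Y.sub.1)
  id X := MulActionHom.id G
  comp f g := MulActionHom.comp g f

/-- The `G`-map underlying a morphism of the orbit category. -/
def OrbitCat.toMap {X Y : OrbitCat p G} (f : X ⟶ Y) : (G ⧸ X.sub.1) →[G] (G ⧸ Y.sub.1) := f

lemma OrbitCat.toMap_mk {X Y : OrbitCat p G} (f : X ⟶ Y) (g : G) :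
    OrbitCat.toMap f (g : G ⧸ X.sub.1) = g • OrbitCat.toMap f ((1 : G) : G ⧸ X.sub.1) := by
  rw [← map_smul]; simp

lemma OrbitCat.toMap_comp {X Y Z : OrbitCat p G} (f : X ⟶ Y) (g : Y ⟶ Z) (x : G ⧸ X.sub.1) :
    OrbitCat.toMap (f ≫ g) x = OrbitCat.toMap g (OrbitCat.toMap f x) := rfl

lemma OrbitCat.hom_ext {X Y : OrbitCat p G} {f f' : X ⟶ Y}
    (h : OrbitCat.toMap f ((1 : G) : G ⧸ X.sub.1) = OrbitCat.toMap f' ((1 : G) : G ⧸ X.sub.1)) :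
    f = f' := by
  have : OrbitCat.toMap f = OrbitCat.toMap f' := by
    apply MulActionHom.ext
    intro x
    induction x using QuotientGroup.induction_on with
    | H x => rw [OrbitCat.toMap_mk, OrbitCat.toMap_mk f', h]
  exact this

/-- If `gPg⁻¹ ≤ Q` (a morphism `g : P → Q` of the transport category), the associated morphism
`G/P → G/Q` of the orbit category is `xP ↦ xg⁻¹Q`. -/
def orbitMap (g : G) (P Q : PSub p G) (h : conjSub g P ≤ Q) : OrbitCat.mk P ⟶ OrbitCat.mk Q :=
  show (G ⧸ P.1) →[G] (G ⧸ Q.1) from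
  { toFun := Quotient.lift (fun x : G => ((x * g⁻¹ : G) : G ⧸ Q.1)) (by
      intro a b hab
      have hab' : a⁻¹ * b ∈ P.1 := QuotientGroup.leftRel_apply.1 hab
      refine QuotientGroup.eq.2 (h ?_)
      rw [mem_conjSub_iff]
      simpa [mul_assoc] using hab')
    map_smul' := by
      intro m x
      induction x using QuotientGroup.induction_on with
      | H x => exact congrArg (fun y : G => (y : G ⧸ Q.1)) (mul_assoc m x g⁻¹) }

lemma toMap_orbitMap (g : G) (P Q : PSub p G) (h : conjSub g P ≤ Q) (x : G) :
    OrbitCat.toMap (orbitMap g P Q h) (x : G ⧸ P.1) = ((x * g⁻¹ : G) : G ⧸ Q.1) := rfl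

lemma orbitMap_one (P : PSub p G) (h : conjSub 1 P ≤ P) :
    orbitMap 1 P P h = 𝟙 (OrbitCat.mk P) := by
  apply OrbitCat.hom_ext
  rw [toMap_orbitMap]
  simp only [inv_one, mul_one]
  rfl

lemma orbitMap_comp (g g' : G) (P Q R : PSub p G) (h : conjSub g P ≤ Q) (h' : conjSub g' Q ≤ R)
    (h'' : conjSub (g' * g) P ≤ R) :
    orbitMap g P Q h ≫ orbitMap g' Q R h' = orbitMap (g' * g) P R h'' := by
  apply OrbitCat.hom_ext
  rw [toMap_orbitMap]
  rw [OrbitCat.toMap_comp, toMap_orbitMap]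
  refine (toMap_orbitMap g' Q R h' _).trans ?_
  simp

end Orbit

section Cohomology

/-! ### First cohomology of a category with constant coefficients -/

variable (C : Type u) [Category.{v} C] (A : Type w) [CommGroup A]

/-- `0`-cochains of the nerve of `C`: functions on objects. -/
abbrev Cochain0 : Type _ := C → A
/-- `1`-cochains of the nerve of `C`: functions on morphisms. -/
abbrev Cochain1 : Type _ := ∀ X Y : C, (X ⟶ Y) → A
/-- `2`-cochains of the nerve of `C`: functions on composable pairs of morphisms. -/
abbrev Cochain2 : Type _ := ∀ X Y Z : C, (X ⟶ Y) → (Y ⟶ Z) → A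

/-- The coboundary `C⁰ → C¹` (in multiplicative notation). -/
def coboundary0 : Cochain0 C A →* Cochain1 C A where
  toFun c := fun X Y _ => c Y / c X
  map_one' := by ext; simp
  map_mul' a b := by ext; simp [mul_div_mul_comm]

/-- The coboundary `C¹ → C²` (in multiplicative notation). -/
def coboundary1 : Cochain1 C A →* Cochain2 C A where
  toFun φ := fun X Y Z f g => φ Y Z g / φ X Z (f ≫ g) * φ X Y f
  map_one' := by ext; simp
  map_mul' a b := by
    ext X Y Z f g
    simp only [Pi.mul_apply, mul_div_mul_comm]
    exact mul_mul_mul_comm _ _ _ _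

/-- `1`-cocycles. -/
abbrev Z1 : Subgroup (Cochain1 C A) := (coboundary1 C A).ker
/-- `1`-coboundaries. -/
abbrev B1 : Subgroup (Cochain1 C A) := (coboundary0 C A).range

/-- `H¹(C; A) = Z¹/B¹`, the first cohomology of the nerve of `C` with constant coefficients `A`. -/
abbrev H1 : Type _ := Z1 C A ⧸ (B1 C A).subgroupOf (Z1 C A)

variable {C A}

lemma Z1.map_comp (φ : Z1 C A) {X Y Z : C} (f : X ⟶ Y) (g : Y ⟶ Z) :
    φ.1 X Z (f ≫ g) = φ.1 X Y f * φ.1 Y Z g := by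
  have h : coboundary1 C A φ.1 = 1 := φ.2
  have h' : φ.1 Y Z g / φ.1 X Z (f ≫ g) * φ.1 X Y f = 1 :=
    congrFun (congrFun (congrFun (congrFun (congrFun h X) Y) Z) f) g
  rw [div_mul_eq_mul_div, div_eq_one] at h'
  rw [← h', mul_comm]

lemma Z1.map_id (φ : Z1 C A) (X : C) : φ.1 X X (𝟙 X) = 1 := by
  have h := Z1.map_comp φ (𝟙 X) (𝟙 X)
  rw [Category.comp_id] at h
  exact left_eq_mul.1 h

end Cohomology

section Tate

lemma sum_eq_sum_quotient {Q N : Type*} [Group Q] [AddCommMonoid N] [Fintype Q]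
    (R : Subgroup Q) [Fintype R] [Fintype (Q ⧸ R)] (F : Q → N) :
    ∑ x : Q, F x = ∑ q : Q ⧸ R, ∑ r : R, F (q.out * r) := by
  rw [← Fintype.sum_prod_type (fun y : (Q ⧸ R) × R => F (y.1.out * y.2))]
  symm
  refine Fintype.sum_bijective (fun y : (Q ⧸ R) × R => y.1.out * y.2.1) ⟨?_, ?_⟩ _ _
    (fun _ => rfl)
  · rintro ⟨q, r⟩ ⟨q', r'⟩ h
    have h1 : q = q' := by
      have := congrArg (fun x : Q => (x : Q ⧸ R)) h
      simpa using this
    subst h1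
    have h2 : r = r' := Subtype.ext (mul_left_cancel h)
    rw [h2]
  · intro x
    refine ⟨⟨(x : Q ⧸ R), ⟨(x : Q ⧸ R).out⁻¹ * x, ?_⟩⟩, by simp⟩
    rw [← QuotientGroup.eq]
    simp

variable {p : ℕ} {k G : Type u} [Field k] [Group G]

/-- The invariants `M^P`. -/
abbrev invariantsOf (M : Rep.{u} k G) (P : Subgroup G) : Submodule k M.V :=
  Representation.invariants (M.ρ.comp P.subtype)

lemma mem_invariantsOf {M : Rep.{u} k G} {P : Subgroup G} {m : M.V} :
    m ∈ invariantsOf M P ↔ ∀ x ∈ P, M.ρ x m = m := by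
  simp [Representation.mem_invariants]

lemma conj_of_toMap {X Y : OrbitCat p G} (f : X ⟶ Y) {g : G}
    (hg : OrbitCat.toMap f ((1 : G) : G ⧸ X.sub.1) = (g : G ⧸ Y.sub.1)) :
    ∀ x ∈ X.sub.1, g⁻¹ * x * g ∈ Y.sub.1 := by
  intro x hx
  have h1 : ((x : G) : G ⧸ X.sub.1) = ((1 : G) : G ⧸ X.sub.1) := by
    rw [QuotientGroup.eq]; simpa using hx
  have h2 := OrbitCat.toMap_mk f x
  rw [h1, hg] at h2
  have h3 : (g : G ⧸ Y.sub.1) = ((x * g : G) : G ⧸ Y.sub.1) := h2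
  rw [QuotientGroup.eq] at h3
  simpa [mul_assoc] using h3

lemma rho_mem_invariantsOf (M : Rep.{u} k G) {P Q : Subgroup G} {g : G}
    (h : ∀ x ∈ P, g⁻¹ * x * g ∈ Q) {m : M.V} (hm : m ∈ invariantsOf M Q) : M.ρ g m ∈ invariantsOf M P := by
  rw [mem_invariantsOf] at hm ⊢
  intro x hx
  have := hm _ (h x hx)
  conv_rhs => rw [← this]
  simp [← Module.End.mul_apply, ← map_mul, mul_assoc]

variable [Finite G]

/-- `m ↦ ∑_{x ∈ P} x m`. -/
def normMap (M : Rep.{u} k G) (P : Subgroup G) : M.V →ₗ[k] M.V :=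
  letI := Fintype.ofFinite P
  ∑ x : P, M.ρ x

/-- The zeroth Tate cohomology `Ĥ⁰(P; M) = M^P / (∑_{x ∈ P} x) M`. -/
abbrev Tate0 (M : Rep.{u} k G) (P : Subgroup G) : Type u :=
  invariantsOf M P ⧸ (LinearMap.range (normMap M P)).submoduleOf (invariantsOf M P)

/-- If `g⁻¹Pg ≤ Q` then `g • (∑_{x ∈ Q} x m)` is in the image of `∑_{x ∈ P} x`. -/
lemma normMap_mem (M : Rep.{u} k G) (P Q : Subgroup G) (g : G)
    (h : ∀ x ∈ P, g⁻¹ * x * g ∈ Q) (m : M.V) :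
    M.ρ g (normMap M Q m) ∈ LinearMap.range (normMap M P) := by
  classical
  let _ := Fintype.ofFinite P
  let _ := Fintype.ofFinite Q
  let R : Subgroup Q := (P.map (MulAut.conj g⁻¹).toMonoidHom).subgroupOf Q
  let _ := Fintype.ofFinite R
  let _ := Fintype.ofFinite (Q ⧸ R)
  let e : R ≃ P :=
    { toFun := fun r => ⟨g * r.1.1 * g⁻¹, by
        obtain ⟨y, hy, hy'⟩ := (Subgroup.mem_subgroupOf.1 r.2)
        rw [← hy']; simpa [mul_assoc] using hy⟩
      invFun := fun x => ⟨⟨g⁻¹ * x.1 * g, h _ x.2⟩, Subgroup.mem_subgroupOf.2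
        ⟨x.1, x.2, by simp⟩⟩
      left_inv := fun r => by ext; simp [mul_assoc]
      right_inv := fun r => by ext; simp [mul_assoc] }
  obtain ⟨s, key⟩ : ∃ s, normMap M Q m = ∑ r : R, M.ρ r.1.1 s := by
    refine ⟨∑ q : Q ⧸ R, M.ρ (q.out⁻¹ : Q).1 m, ?_⟩
    have h1 : normMap M Q m = ∑ x : Q, M.ρ x.1⁻¹ m := by
      simp only [normMap, LinearMap.sum_apply]
      exact (Fintype.sum_equiv (Equiv.inv Q) _ _ (fun x => by simp)).symm
    rw [h1, sum_eq_sum_quotient R (fun x : Q => M.ρ x.1⁻¹ m), Finset.sum_comm]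
    refine Fintype.sum_equiv (Equiv.inv R) _ _ (fun r => ?_)
    rw [map_sum]
    refine Finset.sum_congr rfl (fun q _ => ?_)
    simp [← Module.End.mul_apply, ← map_mul]
  refine ⟨M.ρ g s, ?_⟩
  rw [key, map_sum]
  simp only [normMap, LinearMap.sum_apply]
  symm
  refine Fintype.sum_equiv e _ _ (fun r => ?_)
  simp only [e, Equiv.coe_fn_mk, ← Module.End.mul_apply, ← map_mul]
  simp

/-- The map `Ĥ⁰(Q; M) → Ĥ⁰(P; M)`, `[m] ↦ [g m]`, for `g⁻¹Pg ≤ Q`. -/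
def tateMul (M : Rep.{u} k G) {P Q : Subgroup G} (g : G) (h : ∀ x ∈ P, g⁻¹ * x * g ∈ Q) :
    Tate0 M Q →ₗ[k] Tate0 M P :=
  Submodule.mapQ _ _ ((M.ρ g).restrict (fun _ hm => rho_mem_invariantsOf M h hm)) (by
    rintro ⟨m, hm⟩ ⟨n, hn⟩
    change normMap M Q n = m at hn
    subst hn
    exact normMap_mem M P Q g h n)

lemma tateMul_mk (M : Rep.{u} k G) {P Q : Subgroup G} (g : G) (h : ∀ x ∈ P, g⁻¹ * x * g ∈ Q)
    (m : invariantsOf M Q) : tateMul M g h (Submodule.Quotient.mk m) =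
      Submodule.Quotient.mk ⟨M.ρ g m.1, rho_mem_invariantsOf M h m.2⟩ := rfl

/-- The map on `Ĥ⁰` induced by a `G`-map `f : G/P → G/Q`: it is `[m] ↦ [g m]` for any `g` with
`f(eP) = gQ`, see `tateMap_eq`. -/
def tateMap (M : Rep.{u} k G) {X Y : OrbitCat p G} (f : X ⟶ Y) :
    Tate0 M Y.sub.1 →ₗ[k] Tate0 M X.sub.1 :=
  tateMul M (OrbitCat.toMap f ((1 : G) : G ⧸ X.sub.1)).out
    (conj_of_toMap f (QuotientGroup.out_eq' _).symm)

lemma tateMap_eq (M : Rep.{u} k G) {X Y : OrbitCat p G} (f : X ⟶ Y) (g : G)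
    (hg : OrbitCat.toMap f ((1 : G) : G ⧸ X.sub.1) = (g : G ⧸ Y.sub.1)) :
    tateMap M f = tateMul M g (conj_of_toMap f hg) := by
  refine LinearMap.ext (fun z => ?_)
  obtain ⟨m, rfl⟩ := Submodule.Quotient.mk_surjective _ z
  rw [tateMap, tateMul_mk, tateMul_mk]
  congr 2
  have h1 : g⁻¹ * (OrbitCat.toMap f ((1 : G) : G ⧸ X.sub.1)).out ∈ Y.sub.1 := by
    rw [← QuotientGroup.eq, ← hg]; simp
  have h2 := mem_invariantsOf.1 m.2 _ h1
  conv_rhs => rw [← h2]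
  simp [← Module.End.mul_apply, ← map_mul]

lemma tateMap_id (M : Rep.{u} k G) (X : OrbitCat p G) : tateMap M (𝟙 X) = LinearMap.id := by
  rw [tateMap_eq M (𝟙 X) 1 rfl]
  refine LinearMap.ext (fun z => ?_)
  obtain ⟨m, rfl⟩ := Submodule.Quotient.mk_surjective _ z
  rw [tateMul_mk]
  simp

lemma tateMap_comp (M : Rep.{u} k G) {X Y Z : OrbitCat p G} (f : X ⟶ Y) (g : Y ⟶ Z) :
    tateMap M (f ≫ g) = tateMap M f ∘ₗ tateMap M g := by
  obtain ⟨a, ha⟩ := QuotientGroup.mk_surjective (OrbitCat.toMap f ((1 : G) : G ⧸ X.sub.1))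
  obtain ⟨b, hb⟩ := QuotientGroup.mk_surjective (OrbitCat.toMap g ((1 : G) : G ⧸ Y.sub.1))
  have hc : OrbitCat.toMap (f ≫ g) ((1 : G) : G ⧸ X.sub.1) = ((a * b : G) : G ⧸ Z.sub.1) := by
    rw [OrbitCat.toMap_comp, ← ha, OrbitCat.toMap_mk, ← hb]; rfl
  rw [tateMap_eq M _ _ hc, tateMap_eq M _ _ ha.symm, tateMap_eq M _ _ hb.symm]
  refine LinearMap.ext (fun z => ?_)
  obtain ⟨m, rfl⟩ := Submodule.Quotient.mk_surjective _ z
  rw [LinearMap.comp_apply, tateMul_mk, tateMul_mk, tateMul_mk]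
  simp

/-- The functor `G/P ↦ Ĥ⁰(P; M)` on the orbit category; a `G`-map `G/P → G/Q`, `eP ↦ gQ`,
induces multiplication by `g`, from `Ĥ⁰(Q; M)` to `Ĥ⁰(P; M)`. -/
def tateFunctor (p : ℕ) (M : Rep.{u} k G) : (OrbitCat p G)ᵒᵖ ⥤ ModuleCat.{u} k where
  obj X := ModuleCat.of k (Tate0 M X.unop.sub.1)
  map f := ModuleCat.ofHom (tateMap M f.unop)
  map_id X := by rw [unop_id, tateMap_id]; rfl
  map_comp f g := by rw [unop_comp, tateMap_comp]; rfl

end Tate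

section Steinberg

variable {p : ℕ} {k G : Type u} [Field k] [Group G]

/-- The non-degenerate `n`-simplices `P₀ < ⋯ < Pₙ` of the nerve of the poset of non-trivial
`p`-subgroups. -/
abbrev Chain (p : ℕ) (G : Type u) [Group G] (n : ℕ) : Type u :=
  {s : Fin (n + 1) → PSub p G // StrictMono s}

/-- The conjugation action on chains. -/
def Chain.conj {n : ℕ} (g : G) (s : Chain p G n) : Chain p G n :=
  ⟨fun i => SylowTriv.conjSub g (s.1 i), (conjSub_strictMono g).comp s.2⟩

lemma Chain.le_conj {n : ℕ} (g : G) (s : Chain p G n) :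
    SylowTriv.conjSub g (s.1 0) ≤ (s.conj g).1 0 := le_refl (SylowTriv.conjSub g (s.1 0))

/-- The `i`-th face, which omits `Pᵢ`. -/
def Chain.face {n : ℕ} (i : Fin (n + 2)) (s : Chain p G (n + 1)) : Chain p G n :=
  ⟨fun j => s.1 (i.succAbove j), s.2.comp (Fin.strictMono_succAbove i)⟩

lemma Chain.le_face {n : ℕ} (i : Fin (n + 2)) (s : Chain p G (n + 1)) :
    SylowTriv.conjSub 1 (s.1 0) ≤ (s.face i).1 0 := by
  rw [conjSub_one]; exact s.2.monotone (Fin.zero_le _)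

/-- The coefficient system `k_φ` attached to a `1`-cocycle `φ` on the orbit category. Viewed as a
functor on the transport category it takes the value `k` at each `P`, and it sends `g : P → Q`,
`gPg⁻¹ ≤ Q`, to the inverse of the value of `φ` on `G/P → G/Q`, `xP ↦ xg⁻¹Q`. The inverse is there
since `φ` describes a contravariant functor `G/P ↦ Ĥ⁰(P; M)` to lines and isomorphisms. -/
def coeff (φ : Z1 (OrbitCat p G) kˣ) (g : G) (P Q : PSub p G) (h : SylowTriv.conjSub g P ≤ Q) : kˣ :=
  (φ.1 _ _ (orbitMap g P Q h))⁻¹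

lemma coeff_congr (φ : Z1 (OrbitCat p G) kˣ) {g g' : G} {P P' Q Q' : PSub p G}
    (h : SylowTriv.conjSub g P ≤ Q) (hg : g = g') (hP : P = P') (hQ : Q = Q') :
    coeff φ g P Q h = coeff φ g' P' Q' (by subst hg hP hQ; exact h) := by
  subst hg hP hQ; rfl

lemma coeff_mul (φ : Z1 (OrbitCat p G) kˣ) {g g' : G} {P Q R : PSub p G}
    (h : SylowTriv.conjSub g P ≤ Q) (h' : SylowTriv.conjSub g' Q ≤ R)
    (h'' : SylowTriv.conjSub (g' * g) P ≤ R) :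
    coeff φ g P Q h * coeff φ g' Q R h' = coeff φ (g' * g) P R h'' := by
  rw [coeff, coeff, coeff, ← orbitMap_comp g g' P Q R h h' h'', Z1.map_comp, mul_inv]

lemma coeff_one (φ : Z1 (OrbitCat p G) kˣ) (P : PSub p G) (h : SylowTriv.conjSub 1 P ≤ P) :
    coeff φ 1 P P h = 1 := by
  rw [coeff, orbitMap_one, Z1.map_id, inv_one]

lemma single_congr {α : Type u} {s t : α} {a b : k} (hs : s = t) (hab : a = b) :
    Finsupp.single s a = Finsupp.single t b := by rw [hs, hab]

/-- The representation `Cₙ(|S_p(G)|; k_φ) = ⨁_{P₀ < ⋯ < Pₙ} k_φ(P₀)` of `G`; an element `g` maps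
`k_φ(P₀)` in the summand of a chain to `k_φ(gP₀g⁻¹)` in the summand of the conjugate chain. -/
def steinbergRho (φ : Z1 (OrbitCat p G) kˣ) (n : ℕ) : Representation k G (Chain p G n →₀ k) where
  toFun g := Finsupp.linearCombination k (fun s : Chain p G n =>
    Finsupp.single (s.conj g) (coeff φ g (s.1 0) ((s.conj g).1 0) (s.le_conj g) : k))
  map_one' := by
    refine Finsupp.lhom_ext' (fun s => LinearMap.ext_ring ?_)
    have hs : s.conj 1 = s := Subtype.ext (funext fun i => conjSub_one _)
    simp only [LinearMap.comp_apply, Finsupp.lsingle_apply, Finsupp.linearCombination_single,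
      one_smul, Module.End.one_apply]
    refine single_congr hs ?_
    rw [coeff_congr φ (s.le_conj 1) rfl rfl (congrArg (fun t => t.1 0) hs), coeff_one,
      Units.val_one]
  map_mul' g h := by
    refine Finsupp.lhom_ext' (fun s => LinearMap.ext_ring ?_)
    have hs : s.conj (g * h) = (s.conj h).conj g := Subtype.ext (funext fun i => conjSub_mul _ _ _)
    simp only [LinearMap.comp_apply, Finsupp.lsingle_apply, Finsupp.linearCombination_single,
      one_smul, Module.End.mul_apply, Finsupp.smul_single, smul_eq_mul]
    refine single_congr hs ?_
    rw [coeff_congr φ (s.le_conj (g * h)) rfl rfl (congrArg (fun t => t.1 0) hs),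
      ← coeff_mul φ (s.le_conj h) ((s.conj h).le_conj g), Units.val_mul]

lemma steinbergRho_single (φ : Z1 (OrbitCat p G) kˣ) (n : ℕ) (g : G) (s : Chain p G n) (a : k) :
    steinbergRho φ n g (Finsupp.single s a) =
      Finsupp.single (s.conj g) (a * coeff φ g (s.1 0) ((s.conj g).1 0) (s.le_conj g)) := by
  simp [steinbergRho]

/-- The `kG`-module `Cₙ(|S_p(G)|; k_φ)`. -/
abbrev steinbergObj (φ : Z1 (OrbitCat p G) kˣ) (n : ℕ) : Rep.{u} k G := Rep.of (steinbergRho φ n)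

/-- The linear map induced by the `i`-th face of simplices and the map `k_φ(P₀) → k_φ(Q₀)`, where
`Q₀` is the smallest group in the face. -/
def faceLin (φ : Z1 (OrbitCat p G) kˣ) (n : ℕ) (i : Fin (n + 2)) :
    (Chain p G (n + 1) →₀ k) →ₗ[k] (Chain p G n →₀ k) :=
  Finsupp.linearCombination k (fun s : Chain p G (n + 1) =>
    Finsupp.single (s.face i) (coeff φ 1 (s.1 0) ((s.face i).1 0) (s.le_face i) : k))

lemma faceLin_single (φ : Z1 (OrbitCat p G) kˣ) (n : ℕ) (i : Fin (n + 2)) (s : Chain p G (n + 1))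
    (a : k) : faceLin φ n i (Finsupp.single s a) =
      Finsupp.single (s.face i) (a * coeff φ 1 (s.1 0) ((s.face i).1 0) (s.le_face i)) := by
  simp [faceLin]

/-- The face maps are `kG`-linear. -/
def faceHom (φ : Z1 (OrbitCat p G) kˣ) (n : ℕ) (i : Fin (n + 2)) :
    steinbergObj φ (n + 1) ⟶ steinbergObj φ n :=
  Rep.ofHom ⟨faceLin φ n i, fun g => by
    refine Finsupp.lhom_ext' (fun s => LinearMap.ext_ring ?_)
    simp only [LinearMap.comp_apply, Finsupp.lsingle_apply, faceLin_single, steinbergRho_single,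
      one_mul]
    have hs : (s.conj g).face i = (s.face i).conj g := rfl
    refine single_congr hs ?_
    rw [← Units.val_mul, ← Units.val_mul]
    congr 1
    have e1 : SylowTriv.conjSub (1 * g) (s.1 0) ≤ ((s.face i).conj g).1 0 := by
      rw [one_mul]; exact (conjSub_strictMono g).monotone (by simpa [conjSub_one] using s.le_face i)
    have e2 : SylowTriv.conjSub (g * 1) (s.1 0) ≤ ((s.face i).conj g).1 0 := by
      rw [mul_one]; simpa using e1
    refine (coeff_mul φ _ _ e1).trans (Eq.trans ?_ (coeff_mul φ _ _ e2).symm)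
    exact coeff_congr φ _ (by simp) rfl rfl⟩

lemma face_face {n : ℕ} (s : Chain p G (n + 2)) {i : Fin (n + 3)} {j : Fin (n + 2)}
    (H : i ≤ Fin.castSucc j) :
    (s.face j.succ).face (i.castLT (lt_of_le_of_lt H j.is_lt)) = (s.face i).face j := by
  refine Subtype.ext (funext fun l => ?_)
  simp only [Chain.face]
  have H' : (i : ℕ) ≤ j := H
  refine congrArg s.1 (Fin.ext ?_)
  simp only [Fin.succAbove, Fin.lt_def]
  split_ifs <;> simp_all <;> omega

lemma faceHom_faceHom (φ : Z1 (OrbitCat p G) kˣ) (n : ℕ) {i : Fin (n + 3)} {j : Fin (n + 2)}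
    (H : i ≤ Fin.castSucc j) :
    faceHom φ (n + 1) j.succ ≫ faceHom φ n (i.castLT (lt_of_le_of_lt H j.is_lt)) =
      faceHom φ (n + 1) i ≫ faceHom φ n j := by
  refine Rep.hom_ext (Representation.IntertwiningMap.ext (Finsupp.lhom_ext' fun s =>
    LinearMap.ext_ring ?_))
  change faceLin φ n _ (faceLin φ (n + 1) _ (Finsupp.single s 1)) =
    faceLin φ n _ (faceLin φ (n + 1) _ (Finsupp.single s 1))
  simp only [faceLin_single, one_mul]
  have hs := face_face s H
  have e (t : Chain p G n) (ht : s.1 0 ≤ t.1 0) : SylowTriv.conjSub (1 * 1) (s.1 0) ≤ t.1 0 := by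
    rwa [one_mul, conjSub_one]
  have h1 : s.1 0 ≤ ((s.face i).face j).1 0 := s.2.monotone (Fin.zero_le _)
  refine single_congr hs ?_
  rw [← Units.val_mul, ← Units.val_mul, coeff_mul φ _ _ (e _ h1),
    coeff_mul φ _ _ (e _ (hs ▸ h1)), coeff_congr φ _ rfl rfl (congrArg (fun t => t.1 0) hs)]

/-- The simplicial differential `∑ᵢ (-1)ⁱ dᵢ`. -/
def steinbergD (φ : Z1 (OrbitCat p G) kˣ) (n : ℕ) : steinbergObj φ (n + 1) ⟶ steinbergObj φ n :=
  ∑ i : Fin (n + 2), (-1 : ℤ) ^ (i : ℕ) • faceHom φ n i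

lemma steinbergD_comp (φ : Z1 (OrbitCat p G) kˣ) (n : ℕ) :
    steinbergD φ (n + 1) ≫ steinbergD φ n = 0 := by
  dsimp only [steinbergD]
  simp only [Preadditive.comp_sum, Preadditive.sum_comp, ← Finset.sum_product']
  let T := Fin (n + 2) × Fin (n + 3)
  let S : Finset T := {ij : T | (ij.2 : ℕ) ≤ (ij.1 : ℕ)}
  rw [Finset.univ_product_univ, ← Finset.sum_add_sum_compl S, ← eq_neg_iff_add_eq_zero,
    ← Finset.sum_neg_distrib]
  let ψ : ∀ ij : T, ij ∈ S → T := fun ij hij =>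
    (Fin.castLT ij.2 (lt_of_le_of_lt (Finset.mem_filter.mp hij).right (Fin.is_lt ij.1)), ij.1.succ)
  apply Finset.sum_bij ψ
  · intro ij hij
    simp_rw [S, ψ, Finset.compl_filter, Finset.mem_filter_univ, Fin.val_succ,
      Fin.val_castLT] at hij ⊢
    lia
  · rintro ⟨i, j⟩ hij ⟨i', j'⟩ hij' h
    rw [Prod.mk_inj]
    exact ⟨by simpa [ψ] using! congr_arg Prod.snd h,
      by simpa [ψ, Fin.castSucc_castLT] using! congr_arg Fin.castSucc (congr_arg Prod.fst h)⟩
  · rintro ⟨i', j'⟩ hij'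
    simp_rw [S, Finset.compl_filter, Finset.mem_filter_univ, not_le] at hij'
    refine ⟨(j'.pred <| ?_, Fin.castSucc i'), ?_, ?_⟩
    · rintro rfl
      simp only [Fin.val_zero, not_lt_zero] at hij'
    · simpa [S] using! Nat.le_sub_one_of_lt hij'
    · simp only [ψ, Fin.castLT_castSucc, Fin.succ_pred]
  · rintro ⟨i, j⟩ hij
    dsimp
    simp only [Preadditive.zsmul_comp, Preadditive.comp_zsmul, smul_smul, ← neg_smul]
    congr 1
    · simp only [ψ, Fin.val_succ, pow_add, pow_one, mul_neg, neg_neg, mul_one]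
      apply mul_comm
    · rw [faceHom_faceHom]
      simpa [S] using! hij

/-- The unaugmented twisted Steinberg complex `C_*(|S_p(G)|; k_φ)`: the normalized chains
of the nerve of the poset of non-trivial `p`-subgroups, with coefficients in `k_φ`. -/
def steinberg (φ : Z1 (OrbitCat p G) kˣ) : ChainComplex (Rep.{u} k G) ℕ :=
  ChainComplex.of (steinbergObj φ) (steinbergD φ) (steinbergD_comp φ)

end Steinberg

section Stable

variable {k G : Type u} [Field k] [Group G]

/-- Two `kG`-modules are identified if they become isomorphic after adding projective summands. -/
def StableIso (M N : Rep.{u} k G) : Prop :=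
  ∃ P Q : Rep.{u} k G, Projective P ∧ Projective Q ∧ Nonempty (M ⊞ P ≅ N ⊞ Q)

/-- A `kG`-module is Sylow-trivial if its restriction to the Sylow `p`-subgroup `S` is isomorphic to
the direct sum of the trivial module `k` and a projective `kS`-module. -/
def IsSylowTrivial {p : ℕ} (S : Sylow p G) (M : Rep.{u} k G) : Prop :=
  ∃ P : Rep.{u} k (S : Subgroup G), Projective P ∧
    Nonempty (Rep.res (S : Subgroup G).subtype M ≅ Rep.trivial k (S : Subgroup G) k ⊞ P)

variable [Finite G]

/-- The trace `∑_g g θ g⁻¹` of a `k`-linear endomorphism. -/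
def traceEnd (M : Rep.{u} k G) (θ : M.V →ₗ[k] M.V) : M.V →ₗ[k] M.V :=
  letI := Fintype.ofFinite G
  ∑ g : G, M.ρ g ∘ₗ θ ∘ₗ M.ρ g⁻¹

lemma traceEnd_apply [Fintype G] (M : Rep.{u} k G) (θ : M.V →ₗ[k] M.V) (m : M.V) :
    traceEnd M θ m = ∑ g : G, M.ρ g (θ (M.ρ g⁻¹ m)) := by
  rw [traceEnd, Subsingleton.elim (Fintype.ofFinite G) ‹_›]
  simp

lemma projective_of_trace (M : Rep.{u} k G) (θ : M.V →ₗ[k] M.V) (h : ∀ m, traceEnd M θ m = m) :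
    Projective M where
  factors {E X} f e he := by
    let _ := Fintype.ofFinite G
    rw [Rep.epi_iff_surjective] at he
    obtain ⟨s, hs⟩ := LinearMap.exists_rightInverse_of_surjective e.hom.toLinearMap
      (LinearMap.range_eq_top.2 he)
    have hs' : ∀ x, e.hom (s x) = x := fun x => LinearMap.congr_fun hs x
    refine ⟨Rep.ofHom ⟨∑ g : G, E.ρ g ∘ₗ s ∘ₗ f.hom.toLinearMap ∘ₗ θ ∘ₗ M.ρ g⁻¹, fun a => ?_⟩, ?_⟩
    · refine LinearMap.ext fun m => ?_
      simp only [LinearMap.comp_apply, LinearMap.sum_apply, map_sum]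
      symm
      refine Fintype.sum_equiv (Equiv.mulLeft a) _ _ (fun g => ?_)
      simp [← Module.End.mul_apply, ← map_mul]
    · refine Rep.hom_ext (Representation.IntertwiningMap.ext (LinearMap.ext fun m => ?_))
      change e.hom ((∑ g : G, E.ρ g ∘ₗ s ∘ₗ f.hom.toLinearMap ∘ₗ θ ∘ₗ M.ρ g⁻¹) m) = f.hom m
      simp only [LinearMap.comp_apply, LinearMap.sum_apply, map_sum]
      conv_rhs => rw [← h m, traceEnd_apply, map_sum]
      refine Finset.sum_congr rfl (fun g _ => ?_)
      rw [Rep.hom_comm_apply, hs', Rep.hom_comm_apply]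
      rfl

/-- The induced representation on functions `G → M`. -/
def funRep (M : Rep.{u} k G) : Representation k G (G → M.V) where
  toFun g := LinearMap.pi (fun x => M.ρ g ∘ₗ LinearMap.proj (g⁻¹ * x))
  map_one' := by ext; simp
  map_mul' a b := by ext; simp [mul_assoc]

lemma exists_trace (M : Rep.{u} k G) [Projective M] :
    ∃ θ : M.V →ₗ[k] M.V, ∀ m, traceEnd M θ m = m := by
  classical
  let _ := Fintype.ofFinite G
  let e : Rep.of (funRep M) ⟶ M := Rep.ofHom ⟨∑ x : G, LinearMap.proj x, fun g => by
    refine LinearMap.ext fun f => ?_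
    simp only [LinearMap.comp_apply, LinearMap.sum_apply, map_sum, LinearMap.proj_apply]
    exact Fintype.sum_equiv (Equiv.mulLeft g⁻¹) _ _ (fun x => by simp [funRep])⟩
  have e_apply : ∀ f : G → M.V, e.hom f = ∑ x : G, f x := fun f => by
    change (∑ x : G, LinearMap.proj x : (G → M.V) →ₗ[k] M.V) f = _
    simp
  have he : Epi e := by
    rw [Rep.epi_iff_surjective]
    intro m
    exact ⟨Pi.single 1 m, (e_apply _).trans (by simp)⟩
  let s := Projective.factorThru (𝟙 M) e
  have hs : ∀ m, e.hom (s.hom m) = m := fun m => by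
    have : s ≫ e = 𝟙 M := Projective.factorThru_comp _ _
    exact (Rep.comp_apply s e m).symm.trans (by rw [this]; rfl)
  refine ⟨(LinearMap.proj (1 : G) : (G → M.V) →ₗ[k] M.V) ∘ₗ s.hom.toLinearMap, fun m => ?_⟩
  rw [traceEnd_apply]
  refine Eq.trans ?_ (hs m)
  rw [e_apply]
  refine Finset.sum_congr rfl (fun g _ => ?_)
  have h1 : s.hom (M.ρ g⁻¹ m) = funRep M g⁻¹ (s.hom m) := Rep.hom_comm_apply s g⁻¹ m
  change M.ρ g ((s.hom (M.ρ g⁻¹ m) : G → M.V) 1) = _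
  rw [h1]
  simp [funRep, ← Module.End.mul_apply, ← map_mul]

/-- The data of an idempotent splitting off a trivial summand with projective complement. -/
structure NearUnit (M : Rep.{u} k G) (w : M.V) (ε : M.V →ₗ[k] k) (θ : M.V →ₗ[k] M.V) : Prop where
  w_inv : ∀ g, M.ρ g w = w
  ε_inv : ∀ g m, ε (M.ρ g m) = ε m
  ε_w : ε w = 1
  tr : ∀ m, traceEnd M θ m = m - ε m • w

lemma NearUnit.exists_iso {M : Rep.{u} k G} {w : M.V} {ε : M.V →ₗ[k] k} {θ : M.V →ₗ[k] M.V}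
    (h : NearUnit M w ε θ) :
    ∃ P : Rep.{u} k G, Projective P ∧ Nonempty (M ≅ Rep.trivial k G k ⊞ P) := by
  let _ := Fintype.ofFinite G
  have hW : ∀ g, LinearMap.ker ε ≤ (LinearMap.ker ε).comap (M.ρ g) := fun g m hm => by
    simpa [h.ε_inv] using hm
  let P : Rep.{u} k G := M.subrepresentation (LinearMap.ker ε) hW
  let i : P ⟶ M := M.subtype (LinearMap.ker ε) hW
  have hr0 : ∀ m, m - ε m • w ∈ LinearMap.ker ε := fun m => by simp [h.ε_w]
  let r0 : M.V →ₗ[k] LinearMap.ker ε :=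
    (LinearMap.id - ε.smulRight w).codRestrict (LinearMap.ker ε) hr0
  let r : M ⟶ P := Rep.ofHom ⟨r0, fun g => by
    refine LinearMap.ext fun m => Subtype.ext ?_
    change M.ρ g m - ε (M.ρ g m) • w = M.ρ g (m - ε m • w)
    simp [h.ε_inv, h.w_inv]⟩
  let q : M ⟶ Rep.trivial k G k := Rep.ofHom ⟨ε, fun g => by
    refine LinearMap.ext fun m => ?_
    simp [h.ε_inv]⟩
  let j : Rep.trivial k G k ⟶ M := Rep.ofHom ⟨LinearMap.toSpanSingleton k M.V w, fun g => by
    refine LinearMap.ext fun m => ?_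
    simp [h.w_inv]⟩
  have h1 : q ≫ j + r ≫ i = 𝟙 M := by
    refine Rep.hom_ext (Representation.IntertwiningMap.ext (LinearMap.ext fun m => ?_))
    change ε m • w + (m - ε m • w) = m
    abel
  have h2 : j ≫ q = 𝟙 _ := by
    refine Rep.hom_ext (Representation.IntertwiningMap.ext (LinearMap.ext fun (m : k) => ?_))
    change ε (m • w) = m
    simp [h.ε_w]
  have h3 : i ≫ r = 𝟙 _ := by
    refine Rep.hom_ext (Representation.IntertwiningMap.ext (LinearMap.ext fun m => Subtype.ext ?_))
    change m.1 - ε m.1 • w = m.1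
    have : ε m.1 = 0 := m.2
    simp [this]
  have h4 : i ≫ q = 0 := by
    refine Rep.hom_ext (Representation.IntertwiningMap.ext (LinearMap.ext fun m => ?_))
    exact m.2
  have h5 : j ≫ r = 0 := by
    refine Rep.hom_ext (Representation.IntertwiningMap.ext (LinearMap.ext fun (m : k) =>
      Subtype.ext ?_))
    change m • w - ε (m • w) • w = 0
    simp [h.ε_w]
  refine ⟨P, projective_of_trace P (r0 ∘ₗ θ ∘ₗ (LinearMap.ker ε).subtype) (fun m => ?_),
    ⟨{ hom := biprod.lift q r
       inv := biprod.desc j i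
       hom_inv_id := by rw [biprod.lift_desc, h1]
       inv_hom_id := by
        apply biprod.hom_ext' <;> apply biprod.hom_ext <;> simp [h2, h3, h4, h5] }⟩⟩
  rw [traceEnd_apply]
  have h6 : ∀ g, P.ρ g (r0 (θ ((P.ρ g⁻¹ m).1))) = r0 (M.ρ g (θ (M.ρ g⁻¹ m.1))) := fun g => by
    refine Subtype.ext ?_
    change M.ρ g (θ (M.ρ g⁻¹ m.1) - ε (θ (M.ρ g⁻¹ m.1)) • w) =
      M.ρ g (θ (M.ρ g⁻¹ m.1)) - ε (M.ρ g (θ (M.ρ g⁻¹ m.1))) • w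
    simp [h.ε_inv, h.w_inv]
  refine (Finset.sum_congr rfl (fun g _ => h6 g)).trans ?_
  rw [← map_sum, ← traceEnd_apply, h.tr]
  refine Subtype.ext ?_
  have h7 : ε m.1 = 0 := m.2
  change (m.1 - ε m.1 • w) - ε (m.1 - ε m.1 • w) • w = m.1
  simp [h7]

lemma exists_nearUnit {M P : Rep.{u} k G} [Projective P] (e : M ≅ Rep.trivial k G k ⊞ P) :
    ∃ w ε θ, NearUnit M w ε θ := by
  let _ := Fintype.ofFinite G
  obtain ⟨θ, hθ⟩ := exists_trace P
  let q : M ⟶ Rep.trivial k G k := e.hom ≫ biprod.fst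
  let r : M ⟶ P := e.hom ≫ biprod.snd
  let j : Rep.trivial k G k ⟶ M := biprod.inl ≫ e.inv
  let i : P ⟶ M := biprod.inr ≫ e.inv
  have h1 : q ≫ j + r ≫ i = 𝟙 M := by
    have : e.hom ≫ (biprod.fst ≫ biprod.inl + biprod.snd ≫ biprod.inr) ≫ e.inv = 𝟙 M := by
      rw [biprod.total, Category.id_comp, e.hom_inv_id]
    simpa only [q, j, r, i, Category.assoc, Preadditive.comp_add, Preadditive.add_comp] using this
  have h2 : j ≫ q = 𝟙 _ := by simp [j, q]
  refine ⟨j.hom (1 : k), q.hom.toLinearMap, i.hom.toLinearMap ∘ₗ θ ∘ₗ r.hom.toLinearMap, ?_, ?_,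
    ?_, ?_⟩
  · intro g
    rw [← Rep.hom_comm_apply]
    rfl
  · intro g m
    exact Rep.hom_comm_apply q g m
  · exact (Rep.comp_apply j q (1 : k)).symm.trans (by rw [h2]; rfl)
  · intro m
    have h3 : m = j.hom (q.hom m) + i.hom (r.hom m) := by
      have : (q ≫ j + r ≫ i).hom m = m := by rw [h1]; rfl
      exact this.symm
    have h4 : j.hom (q.hom m) = (q.hom m : k) • j.hom (1 : k) := by
      rw [← map_smul]; congr 1; simp
    rw [traceEnd_apply, eq_sub_iff_add_eq]
    conv_rhs => rw [h3, add_comm]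
    congr 1
    · conv_rhs => rw [← hθ (r.hom m), traceEnd_apply, map_sum]
      refine Finset.sum_congr rfl (fun g _ => ?_)
      rw [Rep.hom_comm_apply, ← Rep.hom_comm_apply r]
      rfl
    · exact h4.symm

open scoped TensorProduct

lemma trace_tensor_left (M N : Rep.{u} k G) (θ : M.V →ₗ[k] M.V) (f : N.V →ₗ[k] N.V)
    (hf : ∀ g n, f (N.ρ g n) = N.ρ g (f n)) (m : M.V) (n : N.V) :
    traceEnd (M ⊗ N) (TensorProduct.map θ f) (m ⊗ₜ[k] n : M.V ⊗[k] N.V) =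
      (traceEnd M θ m ⊗ₜ[k] f n : M.V ⊗[k] N.V) := by
  let _ := Fintype.ofFinite G
  rw [traceEnd_apply, traceEnd_apply, TensorProduct.sum_tmul]
  refine Finset.sum_congr rfl (fun g _ => ?_)
  change (M.ρ.tprod N.ρ) g (TensorProduct.map θ f ((M.ρ.tprod N.ρ) g⁻¹ (m ⊗ₜ[k] n))) = _
  simp only [Representation.tprod_apply, TensorProduct.map_tmul, hf]
  congr 1
  exact Representation.self_inv_apply _ _ _

lemma trace_tensor_right (M N : Rep.{u} k G) (f : M.V →ₗ[k] M.V) (θ : N.V →ₗ[k] N.V)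
    (hf : ∀ g n, f (M.ρ g n) = M.ρ g (f n)) (m : M.V) (n : N.V) :
    traceEnd (M ⊗ N) (TensorProduct.map f θ) (m ⊗ₜ[k] n : M.V ⊗[k] N.V) =
      (f m ⊗ₜ[k] traceEnd N θ n : M.V ⊗[k] N.V) := by
  let _ := Fintype.ofFinite G
  rw [traceEnd_apply, traceEnd_apply, TensorProduct.tmul_sum]
  refine Finset.sum_congr rfl (fun g _ => ?_)
  change (M.ρ.tprod N.ρ) g (TensorProduct.map f θ ((M.ρ.tprod N.ρ) g⁻¹ (m ⊗ₜ[k] n))) = _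
  simp only [Representation.tprod_apply, TensorProduct.map_tmul, hf]
  congr 1
  exact Representation.self_inv_apply _ _ _

instance projective_tensor_left (P N : Rep.{u} k G) [Projective P] : Projective (P ⊗ N) := by
  obtain ⟨θ, hθ⟩ := exists_trace P
  refine projective_of_trace (P ⊗ N) (TensorProduct.map θ LinearMap.id) (fun m => ?_)
  have : traceEnd (P ⊗ N) (TensorProduct.map θ LinearMap.id) = LinearMap.id :=
    TensorProduct.ext' (fun a b => by
      rw [trace_tensor_left P N θ LinearMap.id (fun _ _ => rfl), hθ]; rfl)
  exact LinearMap.congr_fun this m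

lemma NearUnit.tensor {M N : Rep.{u} k G} {w : M.V} {ε : M.V →ₗ[k] k} {θ : M.V →ₗ[k] M.V}
    (h : NearUnit M w ε θ) {w' : N.V} {ε' : N.V →ₗ[k] k} {θ' : N.V →ₗ[k] N.V}
    (h' : NearUnit N w' ε' θ') :
    NearUnit (M ⊗ N) (w ⊗ₜ[k] w' : M.V ⊗[k] N.V) (LinearMap.mul' k k ∘ₗ TensorProduct.map ε ε')
      (TensorProduct.map θ LinearMap.id + TensorProduct.map (ε.smulRight w) θ') where
  w_inv g := by
    change (M.ρ.tprod N.ρ) g (w ⊗ₜ[k] w') = _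
    simp [h.w_inv, h'.w_inv]
  ε_inv g m := by
    have : (LinearMap.mul' k k ∘ₗ TensorProduct.map ε ε') ∘ₗ (M.ρ.tprod N.ρ) g =
        LinearMap.mul' k k ∘ₗ TensorProduct.map ε ε' :=
      TensorProduct.ext' (fun a b => by simp [h.ε_inv, h'.ε_inv])
    exact LinearMap.congr_fun this m
  ε_w := by simp [h.ε_w, h'.ε_w]
  tr m := by
    let _ := Fintype.ofFinite G
    have hadd : ∀ a b, traceEnd (M ⊗ N) (a + b) = traceEnd (M ⊗ N) a + traceEnd (M ⊗ N) b := fun a b => by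
      refine LinearMap.ext fun m => ?_
      rw [LinearMap.add_apply, traceEnd_apply, traceEnd_apply, traceEnd_apply, ← Finset.sum_add_distrib]
      exact Finset.sum_congr rfl (fun g _ => by simp only [LinearMap.add_apply, map_add])
    have : traceEnd (M ⊗ N) (TensorProduct.map θ LinearMap.id + TensorProduct.map (ε.smulRight w) θ')
        = LinearMap.id - (LinearMap.mul' k k ∘ₗ TensorProduct.map ε ε').smulRight
          (w ⊗ₜ[k] w' : M.V ⊗[k] N.V) := by
      refine TensorProduct.ext' (fun a b => ?_)
      rw [hadd, LinearMap.add_apply, trace_tensor_left M N θ LinearMap.id (fun _ _ => rfl),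
        trace_tensor_right M N (ε.smulRight w) θ' (fun g n => by simp [h.ε_inv, h.w_inv]),
        h.tr, h'.tr]
      simp only [LinearMap.id_apply, LinearMap.smulRight_apply, LinearMap.sub_apply,
        LinearMap.comp_apply, TensorProduct.map_tmul, LinearMap.mul'_apply,
        TensorProduct.sub_tmul, TensorProduct.tmul_sub, TensorProduct.smul_tmul',
        TensorProduct.tmul_smul, smul_smul]
      rw [mul_comm (ε' b)]
      abel
    exact LinearMap.congr_fun this m

/-- The dual `kG`-module. -/
abbrev dualRep (M : Rep.{u} k G) : Rep.{u} k G := Rep.of M.ρ.dual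

lemma NearUnit.dual {M : Rep.{u} k G} {w : M.V} {ε : M.V →ₗ[k] k} {θ : M.V →ₗ[k] M.V}
    (h : NearUnit M w ε θ) :
    NearUnit (dualRep M) ε (Module.Dual.eval k M.V w) (Module.Dual.transpose (R := k) θ) where
  w_inv g := LinearMap.ext fun m => by simp [Module.Dual.transpose_apply, h.ε_inv]
  ε_inv g f := by
    change (M.ρ.dual g f) w = f w
    simp [Module.Dual.transpose_apply, h.w_inv]
  ε_w := h.ε_w
  tr f := by
    let _ := Fintype.ofFinite G
    refine LinearMap.ext fun m => ?_
    have h1 := congrArg f (h.tr m)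
    rw [traceEnd_apply, map_sum] at h1
    rw [traceEnd_apply]
    change (∑ g : G, M.ρ.dual g (Module.Dual.transpose (R := k) θ (M.ρ.dual g⁻¹ f)) :
      Module.Dual k M.V) m = f m - f w * ε m
    rw [LinearMap.sum_apply]
    simp only [map_sub, map_smul, smul_eq_mul] at h1
    rw [mul_comm, ← h1]
    refine Finset.sum_congr rfl (fun g _ => ?_)
    simp [Module.Dual.transpose_apply]

end Stable

section Group

open scoped ZeroObject

variable {p : ℕ} {k G : Type u} [Field k] [Group G]

lemma StableIso.refl (M : Rep.{u} k G) : StableIso M M :=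
  ⟨0, 0, inferInstance, inferInstance, ⟨Iso.refl _⟩⟩

lemma StableIso.symm {M N : Rep.{u} k G} : StableIso M N → StableIso N M := by
  rintro ⟨P, Q, hP, hQ, ⟨e⟩⟩
  exact ⟨Q, P, hQ, hP, ⟨e.symm⟩⟩

lemma StableIso.of_iso {M N : Rep.{u} k G} (e : M ≅ N) : StableIso M N :=
  ⟨0, 0, inferInstance, inferInstance, ⟨biprod.mapIso e (Iso.refl _)⟩⟩

/-- Reordering of summands. -/
def biprodSwap (A B C : Rep.{u} k G) : (A ⊞ B) ⊞ C ≅ (A ⊞ C) ⊞ B where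
  hom := biprod.lift (biprod.lift (biprod.fst ≫ biprod.fst) biprod.snd) (biprod.fst ≫ biprod.snd)
  inv := biprod.lift (biprod.lift (biprod.fst ≫ biprod.fst) biprod.snd) (biprod.fst ≫ biprod.snd)
  hom_inv_id := by
    apply biprod.hom_ext
    · apply biprod.hom_ext <;> simp
    · simp
  inv_hom_id := by
    apply biprod.hom_ext
    · apply biprod.hom_ext <;> simp
    · simp

lemma StableIso.trans {M N L : Rep.{u} k G} :
    StableIso M N → StableIso N L → StableIso M L := by
  rintro ⟨P, Q, hP, hQ, ⟨e⟩⟩ ⟨P', Q', hP', hQ', ⟨e'⟩⟩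
  exact ⟨P ⊞ P', Q' ⊞ Q, inferInstance, inferInstance,
    ⟨(biprod.associator M P P').symm ≪≫ biprod.mapIso e (Iso.refl P') ≪≫ biprodSwap N Q P' ≪≫
      biprod.mapIso e' (Iso.refl Q) ≪≫ biprod.associator L Q' Q⟩⟩

lemma stableIso_of_iso_biprod {M N P : Rep.{u} k G} [Projective P] (e : M ≅ N ⊞ P) :
    StableIso M N :=
  ⟨P, P ⊞ P, inferInstance, inferInstance,
    ⟨biprod.mapIso e (Iso.refl P) ≪≫ biprod.associator N P P⟩⟩

lemma isSylowTrivial_unit {S : Sylow p G} : IsSylowTrivial S (𝟙_ (Rep.{u} k G)) :=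
  ⟨0, inferInstance, ⟨show Rep.trivial k (S : Subgroup G) k ≅ _ from
    { hom := biprod.inl
      inv := biprod.fst
      inv_hom_id := by
        apply biprod.hom_ext'
        · simp
        · exact (isZero_zero _).eq_of_src _ _ }⟩⟩

variable [Finite G]

lemma StableIso.tensor_right {M M' : Rep.{u} k G} (h : StableIso M M') (N : Rep.{u} k G) :
    StableIso (M ⊗ N) (M' ⊗ N) := by
  obtain ⟨P, Q, hP, hQ, ⟨e⟩⟩ := h
  have : PreservesBinaryBiproducts (tensorRight N) := preservesBinaryBiproducts_of_preservesBiproducts _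
  exact ⟨P ⊗ N, Q ⊗ N, inferInstance, inferInstance,
    ⟨((tensorRight N).mapBiprod M P).symm ≪≫ (tensorRight N).mapIso e ≪≫
      (tensorRight N).mapBiprod M' Q⟩⟩

lemma StableIso.tensor {M M' N N' : Rep.{u} k G} (h : StableIso M M') (h' : StableIso N N') :
    StableIso (M ⊗ N) (M' ⊗ N') :=
  (h.tensor_right N).trans (((StableIso.of_iso (β_ M' N)).trans (h'.tensor_right M')).trans
    (StableIso.of_iso (β_ N' M')))

variable {S : Sylow p G}

lemma IsSylowTrivial.exists_nearUnit {M : Rep.{u} k G} (h : IsSylowTrivial S M) :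
    ∃ w ε θ, NearUnit (Rep.res (S : Subgroup G).subtype M) w ε θ := by
  obtain ⟨P, hP, ⟨e⟩⟩ := h
  exact SylowTriv.exists_nearUnit e

lemma IsSylowTrivial.tensor {M N : Rep.{u} k G} (hM : IsSylowTrivial S M)
    (hN : IsSylowTrivial S N) : IsSylowTrivial S (M ⊗ N) := by
  obtain ⟨w, ε, θ, h⟩ := hM.exists_nearUnit
  obtain ⟨w', ε', θ', h'⟩ := hN.exists_nearUnit
  exact (h.tensor h').exists_iso

lemma IsSylowTrivial.dual {M : Rep.{u} k G} (hM : IsSylowTrivial S M) :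
    IsSylowTrivial S (dualRep M) := by
  obtain ⟨w, ε, θ, h⟩ := hM.exists_nearUnit
  exact h.dual.exists_iso

lemma trace_rho (M : Rep.{u} k G) (θ : M.V →ₗ[k] M.V) (g : G) (m : M.V) :
    traceEnd M θ (M.ρ g m) = M.ρ g (traceEnd M θ m) := by
  let _ := Fintype.ofFinite G
  rw [traceEnd_apply, traceEnd_apply, map_sum]
  symm
  refine Fintype.sum_equiv (Equiv.mulLeft g) _ _ (fun a => ?_)
  simp only [Equiv.coe_mulLeft, mul_inv_rev, map_mul, Module.End.mul_apply]
  rw [Representation.inv_self_apply]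

lemma exists_iso_of_sylow [Fact p.Prime] [CharP k p] (X : Rep.{u} k G) {w : X.V}
    {ε : X.V →ₗ[k] k} {θ : X.V →ₗ[k] X.V} (hε : ∀ g m, ε (X.ρ g m) = ε m)
    (h : NearUnit (Rep.res (S : Subgroup G).subtype X) w ε θ) :
    ∃ P : Rep.{u} k G, Projective P ∧ Nonempty (X ≅ Rep.trivial k G k ⊞ P) := by
  classical
  let _ := Fintype.ofFinite G
  let _ := Fintype.ofFinite (S : Subgroup G)
  let _ := Fintype.ofFinite (G ⧸ (S : Subgroup G))
  let n : k := ((S : Subgroup G).index : k)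
  have hn : n ≠ 0 := by
    intro h0
    exact S.not_dvd_index ((CharP.cast_eq_zero_iff k p _).1 h0)
  have hn' : (Fintype.card (G ⧸ (S : Subgroup G)) : k) = n := by
    simp only [n, Subgroup.index, Nat.card_eq_fintype_card]
  let W : X.V := ∑ q : G ⧸ (S : Subgroup G), X.ρ q.out w
  have htr : ∀ m, traceEnd X θ m = n • m - ε m • W := fun m => by
    rw [traceEnd_apply, sum_eq_sum_quotient (S : Subgroup G)]
    have h1 : ∀ q : G ⧸ (S : Subgroup G), ∑ r : (S : Subgroup G),
        X.ρ (q.out * r) (θ (X.ρ (q.out * r)⁻¹ m)) = m - ε m • X.ρ q.out w := fun q => by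
      have h2 := h.tr (X.ρ q.out⁻¹ m)
      rw [traceEnd_apply] at h2
      have h3 := congrArg (X.ρ q.out) h2
      rw [map_sum, map_sub, map_smul, hε, Representation.self_inv_apply] at h3
      rw [← h3]
      refine Finset.sum_congr rfl (fun r _ => ?_)
      rw [mul_inv_rev, map_mul, map_mul]
      rfl
    rw [Finset.sum_congr rfl (fun q _ => h1 q), Finset.sum_sub_distrib, ← Finset.smul_sum,
      Finset.sum_const, Finset.card_univ, ← hn', Nat.cast_smul_eq_nsmul]
  have hW : ε W = n := by
    simp only [W, map_sum, hε]
    rw [Finset.sum_congr rfl (fun q _ => h.ε_w), Finset.sum_const, Finset.card_univ, ← hn']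
    simp
  have hWinv : ∀ g, X.ρ g W = W := fun g => by
    have h1 := trace_rho X θ g w
    rw [htr, htr, hε, map_sub, map_smul, map_smul, h.ε_w, one_smul, one_smul] at h1
    exact (sub_right_injective h1).symm
  refine NearUnit.exists_iso (w := n⁻¹ • W) (ε := ε) (θ := n⁻¹ • θ) ⟨fun g => ?_, hε, ?_, ?_⟩
  · rw [map_smul, hWinv]
  · rw [map_smul, hW, smul_eq_mul, inv_mul_cancel₀ hn]
  · intro m
    have h1 : traceEnd X (n⁻¹ • θ) m = n⁻¹ • traceEnd X θ m := by
      rw [traceEnd_apply, traceEnd_apply, Finset.smul_sum]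
      refine Finset.sum_congr rfl (fun g _ => ?_)
      rw [LinearMap.smul_apply, map_smul]
    rw [h1, htr, smul_sub, smul_smul, inv_mul_cancel₀ hn, one_smul, smul_smul, smul_smul,
      mul_comm]

open scoped TensorProduct in
lemma IsSylowTrivial.dual_tensor [Fact p.Prime] [CharP k p] {M : Rep.{u} k G}
    (hM : IsSylowTrivial S M) : StableIso (dualRep M ⊗ M) (𝟙_ (Rep.{u} k G)) := by
  obtain ⟨w, ε, θ, h⟩ := hM.exists_nearUnit
  have h' := h.dual.tensor h
  let X : Rep.{u} k G := dualRep M ⊗ M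
  let t : X.V := (ε ⊗ₜ[k] w : Module.Dual k M.V ⊗[k] M.V)
  let ev : X.V →ₗ[k] k := contractLeft k M.V
  have hev : ∀ g x, ev (X.ρ g x) = ev x := fun g x => by
    have : contractLeft k M.V ∘ₗ (M.ρ.dual.tprod M.ρ) g = contractLeft k M.V :=
      TensorProduct.ext' (fun a b => by simp [Module.Dual.transpose_apply])
    exact LinearMap.congr_fun this x
  have hevt : ev t = 1 := h.ε_w
  let δ : X.V →ₗ[k] X.V := LinearMap.id - ev.smulRight t
  obtain ⟨P, hP, ⟨e⟩⟩ := exists_iso_of_sylow (S := S) X (w := t) (ε := ev) (θ := δ ∘ₗ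
    (TensorProduct.map (Module.Dual.transpose (R := k) θ) LinearMap.id +
      TensorProduct.map ((Module.Dual.eval k M.V w).smulRight ε) θ)) hev
    { w_inv := h'.w_inv
      ε_inv := fun g x => hev g x
      ε_w := hevt
      tr := fun x => by
        let _ := Fintype.ofFinite (S : Subgroup G)
        have h1 := congrArg δ (h'.tr x)
        rw [traceEnd_apply] at h1 ⊢
        rw [map_sum] at h1
        have hδt : δ t = 0 := by simp [δ, hevt]
        have h2 : ∀ (a : G) (y : X.V), X.ρ a t = t → δ (X.ρ a y) = X.ρ a (δ y) := fun a y ha => by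
          simp only [δ, LinearMap.sub_apply, LinearMap.id_apply, LinearMap.smulRight_apply, hev,
            map_sub, map_smul, ha]
        refine (Finset.sum_congr rfl (fun a _ => ?_)).trans (h1.trans ?_)
        · exact (h2 a _ (h'.w_inv a)).symm
        · have h3 : ∀ c : k, δ (x - c • t) = x - ev x • t := fun c => by
            rw [map_sub, map_smul, hδt, smul_zero, sub_zero]; rfl
          exact h3 _ }
  exact stableIso_of_iso_biprod e

variable (k S)

/-- The equivalence relation on Sylow-trivial modules. -/
def sylowTrivialSetoid : Setoid {M : Rep.{u} k G // IsSylowTrivial S M} where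
  r M N := StableIso M.1 N.1
  iseqv := ⟨fun M => StableIso.refl M.1, fun h => h.symm, fun h h' => h.trans h'⟩

/-- The group `T_k(G,S)` of Sylow-trivial modules, up to projective summands. -/
def SylowTrivialGroup : Type (u + 1) := Quotient (sylowTrivialSetoid k S)

variable {k S}

/-- The class of a Sylow-trivial module. -/
def SylowTrivialGroup.mk (M : Rep.{u} k G) (hM : IsSylowTrivial S M) : SylowTrivialGroup k S :=
  Quotient.mk (sylowTrivialSetoid k S) ⟨M, hM⟩

lemma StableIso.dual [Fact p.Prime] [CharP k p] {M N : Rep.{u} k G} (hM : IsSylowTrivial S M)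
    (hN : IsSylowTrivial S N) (h : StableIso M N) : StableIso (dualRep M) (dualRep N) := by
  have h1 : StableIso (dualRep M ⊗ N) (𝟙_ _) :=
    ((StableIso.refl (dualRep M)).tensor h.symm).trans hM.dual_tensor
  have h2 : StableIso (N ⊗ dualRep N) (𝟙_ _) := (StableIso.of_iso (β_ _ _)).trans hN.dual_tensor
  exact (StableIso.of_iso (ρ_ (dualRep M)).symm).trans
    (((StableIso.refl (dualRep M)).tensor h2.symm).trans
      ((StableIso.of_iso (α_ (dualRep M) N (dualRep N)).symm).trans
        ((h1.tensor_right (dualRep N)).trans (StableIso.of_iso (λ_ (dualRep N))))))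

/-- The group structure is given by the tensor product over `k`, and inverses by duals. -/
instance [Fact p.Prime] [CharP k p] : CommGroup (SylowTrivialGroup k S) where
  mul := Quotient.map₂ (fun M N => ⟨M.1 ⊗ N.1, M.2.tensor N.2⟩)
    (fun _ _ h _ _ h' => StableIso.tensor h h')
  one := SylowTrivialGroup.mk (𝟙_ (Rep.{u} k G)) isSylowTrivial_unit
  inv := Quotient.map (fun M => ⟨dualRep M.1, M.2.dual⟩)
    (fun M N h => StableIso.dual M.2 N.2 h)
  mul_assoc a b c := Quotient.inductionOn₃ a b c (fun M N L =>
    Quotient.sound (StableIso.of_iso (α_ M.1 N.1 L.1)))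
  one_mul a := Quotient.inductionOn a (fun M => Quotient.sound (StableIso.of_iso (λ_ M.1)))
  mul_one a := Quotient.inductionOn a (fun M => Quotient.sound (StableIso.of_iso (ρ_ M.1)))
  mul_comm a b := Quotient.inductionOn₂ a b (fun M N =>
    Quotient.sound (StableIso.of_iso (β_ M.1 N.1)))
  inv_mul_cancel a := Quotient.inductionOn a (fun M => Quotient.sound M.2.dual_tensor)

end Group

section Derived

variable {p : ℕ} {k G : Type u} [Field k] [Group G]

instance : HasDerivedCategory.{u + 1} (Rep.{u} k G) := HasDerivedCategory.standard _

/-- Bounded complexes of finitely generated `kG`-modules (as `G` is finite, these are the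
`kG`-modules of finite dimension over `k`). -/
structure IsBoundedFG (K : CochainComplex (Rep.{u} k G) ℤ) : Prop where
  bounded : ∃ a b : ℤ, K.IsStrictlyGE a ∧ K.IsStrictlyLE b
  finite : ∀ i, Module.Finite k (K.X i).V

variable (k G)

/-- The bounded derived category `D^b(kG)` of finitely generated `kG`-modules, as the full
subcategory of the derived category of `kG`-modules on the objects which are isomorphic to
bounded complexes of finitely generated modules. -/
def isDb : ObjectProperty (DerivedCategory (Rep.{u} k G)) :=
  fun X => ∃ K : CochainComplex (Rep.{u} k G) ℤ,
    IsBoundedFG K ∧ Nonempty (X ≅ DerivedCategory.Q.obj K)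

/-- The perfect complexes `K^b(kG)`: the objects of the derived category isomorphic to bounded
complexes of finitely generated projective modules. -/
def isPerfect : ObjectProperty (DerivedCategory (Rep.{u} k G)) :=
  fun X => ∃ K : CochainComplex (Rep.{u} k G) ℤ,
    IsBoundedFG K ∧ (∀ i, Projective (K.X i)) ∧ Nonempty (X ≅ DerivedCategory.Q.obj K)

/-- The morphisms of `D^b(kG)` with a perfect cone. -/
def perfectCone : MorphismProperty (isDb k G).FullSubcategory :=
  (isPerfect k G).trW.inverseImage (isDb k G).ι

/-- The Verdier quotient `D^b(kG)/K^b(kG)`: the localization of `D^b(kG)` at the morphisms with a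
perfect cone. -/
abbrev SingularityCat : Type (u + 1) := (perfectCone k G).Localization

variable {k G}

/-- A bounded complex of finitely generated modules, as an object of `D^b(kG)/K^b(kG)`. -/
def toSing (K : CochainComplex (Rep.{u} k G) ℤ) (hK : IsBoundedFG K) : SingularityCat k G :=
  (perfectCone k G).Q.obj ⟨DerivedCategory.Q.obj K, K, hK, ⟨Iso.refl _⟩⟩

lemma finite_of_isZero {M : Rep.{u} k G} (h : IsZero M) : Module.Finite k M.V := by
  have := (Rep.isZero_iff k G M).1 h
  infer_instance

lemma finite_of_iso {M N : Rep.{u} k G} (e : M ≅ N) [Module.Finite k N.V] :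
    Module.Finite k M.V :=
  Module.Finite.equiv (Representation.equivOfIso e).toLinearEquiv.symm

lemma isBoundedFG_single (M : Rep.{u} k G) [Module.Finite k M.V] :
    IsBoundedFG ((CochainComplex.singleFunctor (Rep.{u} k G) 0).obj M) where
  bounded := ⟨0, 0, inferInstance, inferInstance⟩
  finite i := by
    by_cases hi : i = 0
    · subst hi
      exact finite_of_iso (HomologicalComplex.singleObjXSelf (ComplexShape.up ℤ) 0 M)
    · exact finite_of_isZero (HomologicalComplex.isZero_single_obj_X (ComplexShape.up ℤ) 0 M i hi)

/-- The complex `C_*(|S_p(G)|; k_φ)`, with cohomological grading: `Cₙ` is placed in degree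
`-n`. -/
def steinbergCochain (φ : Z1 (OrbitCat p G) kˣ) : CochainComplex (Rep.{u} k G) ℤ :=
  (steinberg φ).extend ComplexShape.embeddingDownNat

variable [Finite G]

lemma isEmpty_chain {n : ℕ} (hn : Nat.card (PSub p G) < n + 1) : IsEmpty (Chain p G n) := by
  refine ⟨fun s => ?_⟩
  have h := Nat.card_le_card_of_injective s.1 s.2.injective
  rw [Nat.card_fin] at h
  omega

lemma isBoundedFG_steinberg (φ : Z1 (OrbitCat p G) kˣ) : IsBoundedFG (steinbergCochain φ) where
  bounded := by
    refine ⟨-(Nat.card (PSub p G) : ℤ), 0, ?_, ?_⟩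
    · rw [CochainComplex.isStrictlyGE_iff]
      intro i hi
      obtain ⟨n, rfl⟩ : ∃ n : ℕ, i = -(n : ℤ) := ⟨i.natAbs, by omega⟩
      refine IsZero.of_iso ?_ ((steinberg φ).extendXIso ComplexShape.embeddingDownNat
        (i := n) rfl)
      have := isEmpty_chain (p := p) (G := G) (n := n) (by omega)
      exact (Rep.isZero_iff k G _).2 (inferInstanceAs (Subsingleton (Chain p G n →₀ k)))
    · rw [CochainComplex.isStrictlyLE_iff]
      intro i hi
      refine (steinberg φ).isZero_extend_X _ _ (fun n h => ?_)
      have : -(n : ℤ) = i := h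
      omega
  finite i := by
    by_cases hi : ∃ n : ℕ, -(n : ℤ) = i
    · obtain ⟨n, hn⟩ := hi
      have : Module.Finite k ((steinberg φ).X n).V :=
        inferInstanceAs (Module.Finite k (Chain p G n →₀ k))
      exact finite_of_iso ((steinberg φ).extendXIso ComplexShape.embeddingDownNat hn)
    · exact finite_of_isZero ((steinberg φ).isZero_extend_X _ _ (fun n h => hi ⟨n, h⟩))

/-- A finitely generated `kG`-module as an object of `D^b(kG)/K^b(kG)`, in degree zero. -/
def moduleSing (M : Rep.{u} k G) [Module.Finite k M.V] : SingularityCat k G :=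
  toSing _ (isBoundedFG_single M)

/-- The twisted Steinberg complex as an object of `D^b(kG)/K^b(kG)`. -/
def steinbergSing (φ : Z1 (OrbitCat p G) kˣ) : SingularityCat k G :=
  toSing _ (isBoundedFG_steinberg φ)

/-- `φ` is the cocycle obtained from the functor `G/P ↦ Ĥ⁰(P; M)` by means of the trivializations
`b P : k ≃ Ĥ⁰(P; M)`: on `f : G/P → G/Q` it is the scalar `φ f` by which the induced map
`Ĥ⁰(Q; M) → Ĥ⁰(P; M)` acts on the chosen generators. -/
def IsTateCocycle (M : Rep.{u} k G)
    (b : ∀ X : OrbitCat p G, k ≃ₗ[k] (tateFunctor p M).obj (op X))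
    (φ : Z1 (OrbitCat p G) kˣ) : Prop :=
  ∀ (X Y : OrbitCat p G) (f : X ⟶ Y),
    ((tateFunctor p M).map f.op).hom (b Y 1) = (φ.1 X Y f : k) • b X 1

end Derived

end

end SylowTriv

open SylowTriv

/-! On `S`, a Sylow-trivial module `M` carries a fixed vector `w`, an invariant functional `ε` with
`ε w = 1`, and a linear endomorphism `θ` whose trace over `S` is `m ↦ m - ε m • w` (`NearUnit`). The
functional `ε` kills norms from non-trivial subgroups of `S`, whose orders vanish in `k`, while the
trace formula makes `m - ε m • w` a norm. Hence every `Ĥ⁰(P; M)` is a line spanned by a translate of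
`w`, and all orbit category morphisms act invertibly (`NearUnit.tate_generator`). Changing
generators changes the resulting cocycle by a coboundary, and tensor products multiply cocycles,
which gives a homomorphism to `H¹`.

Injectivity. If the class of `M` is trivial, elements normalizing `S` fix `w` modulo norms. The
average of `ε` over the cosets `G/S` is `G`-invariant, and its value at `w` is `1`: only the
`S`-fixed cosets matter modulo `p`, and these come from the normalizer of `S`. As the index of `S`
is invertible, a trace argument then splits off the trivial `kG`-module with projective complement
(`stableIso_unit_of_normalizer`).

Surjectivity and the second property. Every bounded complex of finitely generated modules in degrees
`≤ 0` becomes a module in the Verdier quotient, since its lowest term can be made projective and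
discarded (`exists_moduleSing_iso`). It remains to recognize a module `M` isomorphic there to the
twisted complex of `φ`. Two facts are used.

(a) The vertex `S` gives a map from `k` to the restriction to `S` of the complex whose cone has
finite projective dimension (`trW_baseMap`). The simplices with non-trivial stabilizer in `S` form a
subcomplex contractible to that vertex, by Quillen's contraction `P ≤ PQ ≥ Q` and an acyclic carrier
argument; the remaining simplices are permuted freely up to scalars.

(b) In the quotient of the derived category by objects of finite projective dimension, the morphisms
between modules are the module morphisms modulo those factoring through projectives
(`exists_map_eq`, `factorsThroughProjective_sub`), because `kG` is self-injective.

By (b) the vertices `P` give maps `k[G/P] ⟶ M`, that is, `P`-fixed elements of `M`. The edges of the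
complex say that these transform by `φ` up to norms (`exists_edge`), and (a) says that the element
at `S` splits off the trivial module over `S`. So `M` is Sylow-trivial of class `φ`. Conversely,
stably isomorphic finitely generated modules agree in the Verdier quotient. -/

namespace SylowTriv

noncomputable section

/-! ### Objects of finite projective dimension in a derived category. -/

section FiniteProjectiveDimension

open DerivedCategory Pretriangulated

universe u₁ v₁ w₁ u₂ v₂

variable (C : Type u₁) [Category.{v₁} C] [Abelian C] [HasDerivedCategory.{w₁} C]

/-- The objects of the derived category with no morphisms to objects of `C` placed in a
sufficiently large cohomological shift. -/
def finProjDim : ObjectProperty (DerivedCategory C) :=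
  fun X => ∃ n₀ : ℤ, ∀ n ≥ n₀, ∀ (A : C) (f : X ⟶ ((singleFunctor C 0).obj A)⟦n⟧), f = 0

instance : (finProjDim C).IsClosedUnderIsomorphisms where
  of_iso := by
    rintro X Y e ⟨n₀, h⟩
    refine ⟨n₀, fun n hn A f => ?_⟩
    rw [← cancel_epi e.hom, comp_zero]
    exact h n hn A _

/-- A shift by `a` moves the bound `n₀` by `a`; in a triangle, a morphism out of the middle term
that vanishes on the first term factors through the third. -/
instance : (finProjDim C).IsTriangulated where
  exists_zero := ⟨_, isZero_zero _, 0, fun _ _ _ _ => (isZero_zero _).eq_of_src _ _⟩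
  isStableUnderShiftBy a :=
    { le_shift := by
        rintro X ⟨n₀, h⟩
        refine ⟨n₀ + a, fun n hn A f => ?_⟩
        obtain ⟨g, rfl⟩ : ∃ g : X ⟶ ((singleFunctor C 0).obj A)⟦n - a⟧,
            f = g⟦a⟧' ≫ (shiftFunctorAdd' _ (n - a) a n (by omega)).inv.app _ := by
          obtain ⟨g, hg⟩ := (shiftFunctor (DerivedCategory C) a).map_surjective
            (f ≫ (shiftFunctorAdd' _ (n - a) a n (by omega)).hom.app _)
          exact ⟨g, by rw [hg, Category.assoc, Iso.hom_inv_id_app]; exact (Category.comp_id _).symm⟩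
        rw [h (n - a) (by omega) A g, Functor.map_zero, zero_comp] }
  toIsTriangulatedClosed₂ := .mk' (by
    rintro T hT ⟨n₁, h₁⟩ ⟨n₃, h₃⟩
    refine ⟨max n₁ n₃, fun n hn A f => ?_⟩
    obtain ⟨g, rfl⟩ := Triangle.yoneda_exact₂ T hT f
      (h₁ n (le_trans (le_max_left _ _) hn) A _)
    rw [h₃ n (le_trans (le_max_right _ _) hn) A g, comp_zero])

variable {C}

/-- A bounded complex of projective objects has finite projective dimension. -/
lemma finProjDim_of_projective (K : CochainComplex C ℤ) {a b : ℤ} [K.IsStrictlyGE a]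
    [K.IsStrictlyLE b] (hK : ∀ i, Projective (K.X i)) : finProjDim C (Q.obj K) := by
  have : K.IsKProjective := CochainComplex.isKProjective_of_projective K b
  -- The target sits in degree `-n < a`, where `K` vanishes, so there is no non-zero chain map;
  -- K-projectivity reduces derived morphisms to chain maps up to homotopy.
  refine ⟨1 - a, fun n hn A f => ?_⟩
  let L : CochainComplex C ℤ := (CochainComplex.singleFunctor C 0).obj A
  let e : ((singleFunctor C 0).obj A)⟦n⟧ ≅ Q.obj (L⟦n⟧) :=
    ((shiftFunctor _ n).mapIso ((singleFunctorIsoCompQ C 0).app A)) ≪≫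
      ((Q.commShiftIso n).app L).symm
  obtain ⟨g, hg⟩ := (CochainComplex.IsKProjective.Qh_map_bijective K
    ((HomotopyCategory.quotient C _).obj (L⟦n⟧))).2
      ((quotientCompQhIso C).hom.app K ≫ f ≫ e.hom ≫ (quotientCompQhIso C).inv.app _)
  obtain ⟨g, rfl⟩ := (HomotopyCategory.quotient C _).map_surjective g
  have hg0 : g = 0 := by
    ext i
    by_cases hi : i + n = 0
    · exact (K.isZero_of_isStrictlyGE a i (by omega)).eq_of_src _ _
    · exact (HomologicalComplex.isZero_single_obj_X (ComplexShape.up ℤ) 0 A (i + n) hi).eq_of_tgt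
        _ _
  subst hg0
  rw [Functor.map_zero, Functor.map_zero] at hg
  have h1 := hg.symm
  rw [← cancel_epi ((quotientCompQhIso C).hom.app K), ← cancel_mono e.hom,
    ← cancel_mono ((quotientCompQhIso C).inv.app _)]
  simpa using h1

end FiniteProjectiveDimension

/-! ### Modules in the Verdier quotient: morphisms modulo projectives. -/

/-- A morphism factors through a projective object. -/
def FactorsThroughProjective {C : Type*} [Category* C] {A B : C} (f : A ⟶ B) : Prop :=
  ∃ (P : C) (_ : Projective P) (a : A ⟶ P) (b : P ⟶ B), a ≫ b = f

section FullyFaithful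

open DerivedCategory Pretriangulated

universe u₁ v₁ w₁ u₂ v₂

variable {C : Type u₁} [Category.{v₁} C] [Abelian C] [HasDerivedCategory.{w₁} C]
  [EnoughProjectives C]

variable (hinj : ∀ P : C, Projective P → Injective P) (N : ObjectProperty (DerivedCategory C))
  [N.IsTriangulated] (hNP : ∀ P : C, Projective P → N ((singleFunctor C 0).obj P))

include hinj hNP in
/-- Iterated syzygies of `B`, with the comparison morphism to `B`. -/
lemma exists_syzygy (B : C) (n : ℕ) : ∃ (B' : C)
    (σ : (singleFunctor C 0).obj B ⟶ ((singleFunctor C 0).obj B')⟦(n : ℤ)⟧), N.trW σ ∧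
      (∀ (A : C) (g : (singleFunctor C 0).obj A ⟶ ((singleFunctor C 0).obj B')⟦(n : ℤ)⟧),
        ∃ h : A ⟶ B, g = (singleFunctor C 0).map h ≫ σ) ∧
      (∀ (A : C) (h : A ⟶ B), (singleFunctor C 0).map h ≫ σ = 0 →
        FactorsThroughProjective h) := by
  have := hasExt_of_hasDerivedCategory C
  -- In terms of `Ext` groups the induction on `n` can use the long exact sequences of `0 → ΩB' → P
  -- → B' → 0`.
  suffices H : ∃ (B' : C) (σ : Abelian.Ext.{w₁} B B' n), N.trW σ.hom ∧
      (∀ (A : C) (g : Abelian.Ext.{w₁} A B' n),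
        ∃ h : A ⟶ B, g = (Abelian.Ext.mk₀ h).comp σ (zero_add n)) ∧
      (∀ (A : C) (h : A ⟶ B), (Abelian.Ext.mk₀ h).comp σ (zero_add n) = 0 →
        FactorsThroughProjective h) by
    have key : ∀ (B' : C) (σ : Abelian.Ext.{w₁} B B' n) (A : C) (h : A ⟶ B),
        ((Abelian.Ext.mk₀ h).comp σ (zero_add n)).hom =
          (singleFunctor C 0).map h ≫ σ.hom := fun B' σ A h => by
      rw [Abelian.Ext.comp_hom, Abelian.Ext.mk₀_hom, ShiftedHom.mk₀_comp]
    obtain ⟨B', σ, h1, h2, h3⟩ := H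
    refine ⟨B', σ.hom, h1, fun A g => ?_, fun A h hh => ?_⟩
    · obtain ⟨g', rfl⟩ := Abelian.Ext.homEquiv.surjective g
      obtain ⟨h, rfl⟩ := h2 A g'
      exact ⟨h, key _ _ _ _⟩
    · refine h3 A h (Abelian.Ext.ext ?_)
      rw [key, hh, Abelian.Ext.zero_hom]
  induction n with
  | zero =>
    refine ⟨B, Abelian.Ext.mk₀ (𝟙 B), ?_, fun A g => ?_, fun A h hh => ?_⟩
    · rw [Abelian.Ext.mk₀_hom]
      have : IsIso (ShiftedHom.mk₀ ((0 : ℕ) : ℤ) rfl ((singleFunctor C 0).map (𝟙 B))) := by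
        rw [ShiftedHom.mk₀]; infer_instance
      exact N.trW_of_isIso _
    · obtain ⟨h, rfl⟩ := (Abelian.Ext.mk₀_bijective _ _).2 g
      exact ⟨h, (Abelian.Ext.comp_mk₀_id _).symm⟩
    · have h0 : h = 0 := by
        rw [Abelian.Ext.comp_mk₀_id] at hh
        exact (Abelian.Ext.mk₀_eq_zero_iff h).1 hh
      subst h0
      exact ⟨Projective.over A, inferInstance, 0, 0, by simp⟩
  | succ n ih =>
    obtain ⟨B', σ, hσ, hsurj, hker⟩ := ih
    let S : ShortComplex C := ShortComplex.mk (kernel.ι (Projective.π B')) (Projective.π B')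
      (kernel.condition _)
    have hS : S.ShortExact := { exact := ShortComplex.exact_kernel _ }
    have hI : Injective S.X₂ := hinj (Projective.over B') inferInstance
    refine ⟨S.X₁, σ.comp hS.extClass rfl, ?_, fun A g => ?_, fun A h hh => ?_⟩
    · rw [Abelian.Ext.comp_hom, ShortComplex.ShortExact.extClass_hom]
      -- The new comparison map is the old one followed by the extension class `B' → ΩB'[1]`, whose
      -- fibre is the projective middle term, an object of `N`.
      refine N.trW.comp_mem _ _ hσ (N.trW.comp_mem _ _ (ObjectProperty.trW.shift ?_ _)
        (N.trW_of_isIso _))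
      exact ObjectProperty.trW.mk' N (rot_of_distTriang _ hS.singleTriangle_distinguished)
        (hNP _ (inferInstanceAs (Projective (Projective.over B'))))
    -- Classes in degree `n + 1` lift along the connecting map because the projective middle term is
    -- injective, so its positive `Ext` vanishes.
    · obtain ⟨y, rfl⟩ := Abelian.Ext.covariant_sequence_exact₁ A hS g
        (Abelian.Ext.eq_zero_of_injective _) rfl
      obtain ⟨h, rfl⟩ := hsurj A y
      exact ⟨h, Abelian.Ext.comp_assoc _ _ _ _ _ (by omega)⟩
    · rw [← Abelian.Ext.comp_assoc _ _ _ (zero_add n) rfl (by omega)] at hh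
      obtain ⟨y, hy⟩ := Abelian.Ext.covariant_sequence_exact₃ A hS _ rfl hh
      -- The class `y` lies in `Ext^n` with values in the projective middle term. It vanishes for `n
      -- > 0`; for `n = 0` it is an ordinary morphism, and this is where the factorization through a
      -- projective comes from.
      cases n with
      | zero =>
        -- The projection to `B'` lifts through `σ` to a map `t` into `B`, so `h - y ≫ t` is killed
        -- by `σ`, and both pieces of `h` factor through projectives.
        obtain ⟨t, ht⟩ := hsurj S.X₂ (Abelian.Ext.mk₀ S.g)
        obtain ⟨y, rfl⟩ := (Abelian.Ext.mk₀_bijective _ _).2 y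
        have hd : (Abelian.Ext.mk₀ (h - y ≫ t)).comp σ (zero_add 0) = 0 := by
          rw [sub_eq_add_neg, Abelian.Ext.mk₀_add, Abelian.Ext.mk₀_neg, Abelian.Ext.add_comp,
            Abelian.Ext.neg_comp, ← hy, ← Abelian.Ext.mk₀_comp_mk₀,
            Abelian.Ext.comp_assoc _ _ _ _ (zero_add 0) (by omega), ← ht, add_neg_cancel]
        obtain ⟨P, hP, a, b, hab⟩ := hker A _ hd
        have : Projective S.X₂ := inferInstanceAs (Projective (Projective.over B'))
        exact ⟨P ⊞ S.X₂, inferInstance,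
          biprod.lift a y, biprod.desc b t, by rw [biprod.lift_desc, hab, sub_add_cancel]⟩
      | succ m =>
        refine hker A h ?_
        rw [← hy, Abelian.Ext.eq_zero_of_injective y, Abelian.Ext.zero_comp]

variable {N} (hN : N ≤ finProjDim C) {D : Type u₂} [Category.{v₂} D]
  (L : DerivedCategory C ⥤ D) [L.IsLocalization N.trW]

include hN hinj hNP in
-- The fibre of `s` has finite projective dimension, so for large `n` it has no non-zero morphism to
-- the `n`-fold shifted syzygy. Hence `σ` extends along `s`: the syzygy maps are cofinal among the
-- denominators.
lemma exists_syzygy_factor {B : C} {Y : DerivedCategory C} (s : (singleFunctor C 0).obj B ⟶ Y)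
    (hs : N.trW s) : ∃ (B' : C) (n : ℕ)
    (σ : (singleFunctor C 0).obj B ⟶ ((singleFunctor C 0).obj B')⟦(n : ℤ)⟧)
    (r : Y ⟶ ((singleFunctor C 0).obj B')⟦(n : ℤ)⟧), s ≫ r = σ ∧ N.trW σ ∧
      (∀ (A : C) (g : (singleFunctor C 0).obj A ⟶ ((singleFunctor C 0).obj B')⟦(n : ℤ)⟧),
        ∃ h : A ⟶ B, g = (singleFunctor C 0).map h ≫ σ) ∧
      (∀ (A : C) (h : A ⟶ B), (singleFunctor C 0).map h ≫ σ = 0 →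
        FactorsThroughProjective h) := by
  obtain ⟨Z, f, g, hT, hZ⟩ := (N.trW_iff' s).1 hs
  obtain ⟨n₀, hn₀⟩ := hN _ hZ
  obtain ⟨B', σ, h1, h2, h3⟩ := exists_syzygy hinj N hNP B n₀.toNat
  obtain ⟨r, hr⟩ := Triangle.yoneda_exact₂ _ hT σ (hn₀ _ (Int.self_le_toNat n₀) _ _)
  exact ⟨B', _, σ, r, hr.symm, h1, h2, h3⟩

include hN hinj hNP in
-- Any fraction can be rewritten with a syzygy map `σ` as denominator, and every numerator into the
-- shifted syzygy is a module morphism followed by `σ`.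
theorem exists_map_eq {A B : C}
    (α : L.obj ((singleFunctor C 0).obj A) ⟶ L.obj ((singleFunctor C 0).obj B)) :
    ∃ f : A ⟶ B, α = L.map ((singleFunctor C 0).map f) := by
  obtain ⟨φ, rfl⟩ := Localization.exists_leftFraction L N.trW α
  obtain ⟨B', n, σ, r, h0, h1, h2, -⟩ := exists_syzygy_factor hinj hNP hN φ.s φ.hs
  obtain ⟨h, hh⟩ := h2 A (φ.f ≫ r)
  refine ⟨h, ?_⟩
  have : IsIso (L.map σ) := Localization.inverts L N.trW σ h1
  rw [← cancel_mono (L.map σ), ← Functor.map_comp, ← hh, ← h0, Functor.map_comp,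
    MorphismProperty.LeftFraction.map_comp_map_s_assoc, Functor.map_comp]

include hN hinj hNP in
-- Equality in the localization is detected by some denominator, hence by a syzygy map, and a module
-- morphism killed by a syzygy map factors through a projective.
theorem factorsThroughProjective_sub {A B : C} {f g : A ⟶ B}
    (h : L.map ((singleFunctor C 0).map f) = L.map ((singleFunctor C 0).map g)) :
    FactorsThroughProjective (f - g) := by
  obtain ⟨Y, s, hs, hfg⟩ := (MorphismProperty.map_eq_iff_postcomp L N.trW _ _).1 h
  obtain ⟨B', n, σ, r, h0, h1, -, h3⟩ := exists_syzygy_factor hinj hNP hN s hs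
  refine h3 A _ ?_
  rw [Functor.map_sub, Preadditive.sub_comp, ← h0, reassoc_of% hfg, sub_self]

end FullyFaithful

/-! ### Splitting morphisms that are invertible modulo projectives. -/

section Factoring

universe u₁ v₁

variable {C : Type u₁} [Category.{v₁} C]

lemma FactorsThroughProjective.of_projective {A P B : C} [Projective P] (a : A ⟶ P) (b : P ⟶ B) :
    FactorsThroughProjective (a ≫ b) := ⟨P, inferInstance, a, b, rfl⟩

lemma FactorsThroughProjective.comp_left {A B D : C} {g : A ⟶ B} (hg : FactorsThroughProjective g)
    (f : D ⟶ A) : FactorsThroughProjective (f ≫ g) := by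
  obtain ⟨P, hP, a, b, rfl⟩ := hg
  exact ⟨P, hP, f ≫ a, b, Category.assoc _ _ _⟩

lemma FactorsThroughProjective.comp_right {A B D : C} {g : A ⟶ B}
    (hg : FactorsThroughProjective g) (f : B ⟶ D) : FactorsThroughProjective (g ≫ f) := by
  obtain ⟨P, hP, a, b, rfl⟩ := hg
  exact ⟨P, hP, a, b ≫ f, (Category.assoc _ _ _).symm⟩

variable [Abelian C]

lemma FactorsThroughProjective.add {A B : C} {f g : A ⟶ B} (hf : FactorsThroughProjective f)
    (hg : FactorsThroughProjective g) : FactorsThroughProjective (f + g) := by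
  obtain ⟨P, hP, a, b, rfl⟩ := hf
  obtain ⟨P', hP', a', b', rfl⟩ := hg
  exact ⟨P ⊞ P', inferInstance, biprod.lift a a', biprod.desc b b', biprod.lift_desc⟩

/-- A morphism which is invertible up to morphisms factoring through projectives is split after
adding a projective object, with projective complement. -/
lemma exists_iso_biprod {M N I : C} [Projective I] (h : M ⟶ N) (h' : N ⟶ M) (i : M ⟶ I)
    (b : I ⟶ M) (hb : h ≫ h' + i ≫ b = 𝟙 M) (hN : FactorsThroughProjective (𝟙 N - h' ≫ h)) :
    ∃ K : C, Projective K ∧ Nonempty (N ⊞ I ≅ M ⊞ K) := by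
  let s : M ⟶ N ⊞ I := biprod.lift h i
  let r : N ⊞ I ⟶ M := biprod.desc h' b
  have hsr : s ≫ r = 𝟙 M := by rw [biprod.lift_desc, hb]
  let j : kernel r ⟶ N ⊞ I := kernel.ι r
  have hjr : j ≫ r = 0 := kernel.condition r
  let q : N ⊞ I ⟶ kernel r := kernel.lift r (𝟙 _ - r ≫ s) (by
    rw [Preadditive.sub_comp, Category.id_comp, Category.assoc, hsr, Category.comp_id, sub_self])
  have hq : q ≫ j = 𝟙 _ - r ≫ s := kernel.lift_ι _ _ _
  have hjq : j ≫ q = 𝟙 _ := by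
    rw [← cancel_mono j, Category.assoc, hq, Preadditive.comp_sub, reassoc_of% hjr, zero_comp,
      sub_zero, Category.comp_id, Category.id_comp]
  have hsq : s ≫ q = 0 := by
    rw [← cancel_mono j, Category.assoc, hq, Preadditive.comp_sub, reassoc_of% hsr, zero_comp,
      Category.comp_id, sub_self]
  -- The block from `N` to `N` of this idempotent is `1 - h' ≫ h`, and every other block starts or
  -- ends at `I`. Its image `kernel r` is then a retract of a projective.
  have hfac : FactorsThroughProjective (𝟙 (N ⊞ I) - r ≫ s) := by
    have e : 𝟙 (N ⊞ I) - r ≫ s = biprod.fst ≫ (𝟙 N - h' ≫ h) ≫ biprod.inl +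
        ((biprod.fst ≫ (-h') ≫ i) ≫ biprod.inr +
          biprod.snd ≫ (biprod.inr - b ≫ s)) := by
      apply biprod.hom_ext' <;> apply biprod.hom_ext <;> simp [r, s]
    rw [e]
    exact ((hN.comp_right _).comp_left _).add
      ((FactorsThroughProjective.of_projective _ _).add
        (FactorsThroughProjective.of_projective _ _))
  obtain ⟨P, hP, a, c, hac⟩ := hfac
  have hK : Projective (kernel r) := by
    refine Retract.projective (Y := P) ⟨j ≫ a, c ≫ q, ?_⟩
    rw [Category.assoc, reassoc_of% hac, Preadditive.sub_comp, Preadditive.comp_sub,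
      Category.id_comp, hjq, Category.assoc, reassoc_of% hjr, zero_comp, sub_zero]
  exact ⟨kernel r, hK, ⟨
    { hom := biprod.lift r q
      inv := biprod.desc s j
      hom_inv_id := by rw [biprod.lift_desc, hq, add_sub_cancel]
      inv_hom_id := by
        apply biprod.hom_ext' <;> apply biprod.hom_ext <;> simp [hsr, hsq, hjr, hjq] }⟩⟩

/-- The cokernel of a morphism is preserved by pushouts. -/
def cokernelPushoutInlIso {A K B : C} (f : A ⟶ K) (g : A ⟶ B) :
    cokernel (pushout.inl f g) ≅ cokernel g where
  hom := cokernel.desc _ (pushout.desc 0 (cokernel.π g)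
    (by rw [comp_zero, cokernel.condition])) (pushout.inl_desc _ _ _)
  inv := cokernel.desc _ (pushout.inr f g ≫ cokernel.π _) (by
    rw [← Category.assoc, ← pushout.condition, Category.assoc, cokernel.condition, comp_zero])
  hom_inv_id := by
    rw [← cancel_epi (cokernel.π _)]
    apply pushout.hom_ext
    · rw [cokernel.π_desc_assoc, pushout.inl_desc_assoc, zero_comp, Category.comp_id,
        cokernel.condition]
    · rw [cokernel.π_desc_assoc, pushout.inr_desc_assoc, cokernel.π_desc, Category.comp_id]
  inv_hom_id := by
    rw [← cancel_epi (cokernel.π _), cokernel.π_desc_assoc, Category.assoc, cokernel.π_desc,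
      pushout.inr_desc, Category.comp_id]

end Factoring

/-! ### Acyclic complexes and pushouts in the derived category. -/

section Disc

universe u₁ v₁ w₁

open DerivedCategory

variable {C : Type u₁} [Category.{v₁} C] [Abelian C] [HasDerivedCategory.{w₁} C]

/-- The zero endomorphism of an acyclic complex is a quasi-isomorphism, so zero becomes invertible.
-/
lemma isZero_Q_of_acyclic {K : CochainComplex C ℤ} (hK : K.Acyclic) : IsZero (Q.obj K) := by
  have : QuasiIso (0 : K ⟶ K) := ⟨fun i => by
    rw [quasiIsoAt_iff_exactAt _ _ (hK i)]; exact hK i⟩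
  have h : IsIso (Q.map (0 : K ⟶ K)) := inferInstance
  rw [Functor.map_zero] at h
  exact (isIsoZero_iff_source_target_isZero _ _).1 h |>.1

omit [HasDerivedCategory C] in
lemma acyclic_double_id (A : C) {a b : ℤ} (h : (ComplexShape.up ℤ).Rel a b) :
    (HomologicalComplex.double (𝟙 A) (c := ComplexShape.up ℤ) h).Acyclic := by
  intro i
  have h' : a + 1 = b := h
  have hab : a ≠ b := by omega
  have hd : IsIso ((HomologicalComplex.double (𝟙 A) (c := ComplexShape.up ℤ) h).d a b) := by
    rw [HomologicalComplex.double_d _ _ hab]; infer_instance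
  by_cases hi : i = a
  · subst hi
    rw [HomologicalComplex.exactAt_iff' _ (i - 1) i b (by simp) (by simp [h'])]
    refine (ShortComplex.exact_iff_mono _
      (HomologicalComplex.double_d_eq_zero₀ (𝟙 A) h _ _ (by omega))).2 ?_
    change Mono ((HomologicalComplex.double (𝟙 A) (c := ComplexShape.up ℤ) h).d i b)
    infer_instance
  · by_cases hi' : i = b
    · subst hi'
      rw [HomologicalComplex.exactAt_iff' _ a i (i + 1) (by simp [← h']) (by simp)]
      refine (ShortComplex.exact_iff_epi _
        (HomologicalComplex.double_d_eq_zero₀ (𝟙 A) h _ _ hi)).2 ?_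
      change Epi ((HomologicalComplex.double (𝟙 A) (c := ComplexShape.up ℤ) h).d a i)
      infer_instance
    · exact ShortComplex.exact_of_isZero_X₂ _ (HomologicalComplex.isZero_double_X (𝟙 A) h _ hi hi')

/-- The pushout inclusion is a monomorphism with the same cokernel as `g`, and that cokernel is the
cone of a map between zero objects. -/
lemma isIso_Q_map_inl_pushout {A K B : CochainComplex C ℤ} (f : A ⟶ K) (g : A ⟶ B) [Mono g]
    (hA : IsZero (Q.obj A)) (hB : IsZero (Q.obj B)) : IsIso (Q.map (pushout.inl f g)) := by
  let S : ShortComplex (CochainComplex C ℤ) :=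
    ShortComplex.mk (pushout.inl f g) (cokernel.π (pushout.inl f g)) (cokernel.condition _)
  let S' : ShortComplex (CochainComplex C ℤ) :=
    ShortComplex.mk g (cokernel.π g) (cokernel.condition _)
  have hS' : S'.ShortExact := { exact := ShortComplex.exact_cokernel _ }
  have hS : S.ShortExact := { exact := ShortComplex.exact_cokernel _ }
  have h1 := (Pretriangulated.Triangle.isZero₃_iff_isIso₁ _
    (triangleOfSES_distinguished hS')).2 (by
      exact ⟨0, hA.eq_of_src _ _, hB.eq_of_src _ _⟩)
  exact (Pretriangulated.Triangle.isZero₃_iff_isIso₁ _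
    (triangleOfSES_distinguished hS)).1 (h1.of_iso (Q.mapIso (cokernelPushoutInlIso f g)))

end Disc

/-! ### Contractibility of the simplices with non-trivial stabilizer. -/

section Acyclic

variable {p : ℕ} {k G : Type u} [Field k] [Group G]

/-- The linear map underlying the differential of the twisted Steinberg complex. -/
def diffLin (φ : Z1 (OrbitCat p G) kˣ) (n : ℕ) : (Chain p G (n + 1) →₀ k) →ₗ[k] (Chain p G n →₀ k) :=
  ∑ i : Fin (n + 2), (-1 : k) ^ (i : ℕ) • faceLin φ n i

lemma diffLin_single (φ : Z1 (OrbitCat p G) kˣ) (n : ℕ) (s : Chain p G (n + 1)) (a : k) :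
    diffLin φ n (Finsupp.single s a) = ∑ i : Fin (n + 2), (-1 : k) ^ (i : ℕ) •
      Finsupp.single (s.face i) (a * coeff φ 1 (s.1 0) ((s.face i).1 0) (s.le_face i)) := by
  simp only [diffLin, LinearMap.sum_apply, LinearMap.smul_apply, faceLin_single]

lemma steinbergD_hom_apply (φ : Z1 (OrbitCat p G) kˣ) (n : ℕ) (x : Chain p G (n + 1) →₀ k) :
    (steinbergD φ n).hom x = diffLin φ n x := by
  have h : ∀ (s : Finset (Fin (n + 2))),
      (∑ i ∈ s, (-1 : ℤ) ^ (i : ℕ) • faceHom φ n i).hom x =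
        (∑ i ∈ s, (-1 : k) ^ (i : ℕ) • faceLin φ n i) x := fun s => by
    induction s using Finset.cons_induction with
    | empty => rfl
    | cons a s ha ih =>
      rw [Finset.sum_cons, Finset.sum_cons, LinearMap.add_apply, ← ih]
      have : ((-1 : ℤ) ^ (a : ℕ) • faceHom φ n a).hom x = ((-1 : k) ^ (a : ℕ) • faceLin φ n a) x := by
        rcases neg_one_pow_eq_or ℤ (a : ℕ) with h | h
        · have h' : (-1 : k) ^ (a : ℕ) = 1 := by exact_mod_cast congrArg (Int.cast : ℤ → k) h
          rw [h, h', one_smul, one_smul]; rfl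
        · have h' : (-1 : k) ^ (a : ℕ) = -1 := by exact_mod_cast congrArg (Int.cast : ℤ → k) h
          rw [h, h', neg_one_smul]
          exact (neg_one_smul k (faceLin φ n a x)).symm
      rw [← this]; rfl
  exact h Finset.univ

lemma diffLin_comp (φ : Z1 (OrbitCat p G) kˣ) (n : ℕ) (x : Chain p G (n + 2) →₀ k) :
    diffLin φ n (diffLin φ (n + 1) x) = 0 := by
  rw [← steinbergD_hom_apply, ← steinbergD_hom_apply, ← Rep.comp_apply, steinbergD_comp]
  rfl

/-- The chain with one element. -/
def Chain.vertex (P : PSub p G) : Chain p G 0 := ⟨fun _ => P, fun i j h => absurd h (by omega)⟩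

lemma Chain.vertex_self (s : Chain p G 0) : Chain.vertex (s.1 0) = s :=
  Subtype.ext (funext fun i => by rw [show i = 0 by omega]; rfl)

/-- The chain with two elements. -/
def Chain.edge {P Q : PSub p G} (h : P < Q) : Chain p G 1 :=
  ⟨![P, Q], by rw [Fin.strictMono_iff_lt_succ]; intro i; fin_cases i; exact h⟩

/-- Adding a new largest element to a chain. -/
def Chain.snoc {n : ℕ} (s : Chain p G n) (m : PSub p G) (h : s.1 (Fin.last n) < m) :
    Chain p G (n + 1) :=
  ⟨Fin.snoc s.1 m, by
    rw [Fin.strictMono_iff_lt_succ]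
    intro i
    induction i using Fin.lastCases with
    | last => rw [Fin.snoc_castSucc, Fin.succ_last, Fin.snoc_last]; exact h
    | cast i =>
      rw [Fin.snoc_castSucc, Fin.succ_castSucc, Fin.snoc_castSucc]
      exact s.2 (Fin.castSucc_lt_succ)⟩

lemma castSucc_succAbove_last {n : ℕ} (i : Fin (n + 1)) :
    i.castSucc.succAbove (Fin.last n) = Fin.last (n + 1) := by
  rw [Fin.succAbove_of_le_castSucc _ _ (Fin.castSucc_le_castSucc_iff.2 (Fin.le_last _)), Fin.succ_last]

lemma Chain.snoc_face_castSucc {n : ℕ} (s : Chain p G (n + 1)) (m : PSub p G)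
    (h : s.1 (Fin.last (n + 1)) < m) (i : Fin (n + 2)) :
    (s.snoc m h).face i.castSucc =
      (s.face i).snoc m (lt_of_le_of_lt (s.2.monotone (Fin.le_last _)) h) := by
  refine Subtype.ext (funext fun j => ?_)
  simp only [Chain.face, Chain.snoc]
  induction j using Fin.lastCases with
  | last => rw [castSucc_succAbove_last, Fin.snoc_last, Fin.snoc_last]
  | cast j => rw [Fin.castSucc_succAbove_castSucc, Fin.snoc_castSucc, Fin.snoc_castSucc]

lemma Chain.snoc_face_last {n : ℕ} (s : Chain p G n) (m : PSub p G)
    (h : s.1 (Fin.last n) < m) : (s.snoc m h).face (Fin.last (n + 1)) = s := by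
  refine Subtype.ext (funext fun j => ?_)
  simp only [Chain.face, Chain.snoc]
  rw [Fin.succAbove_last, Fin.snoc_castSucc]

lemma Chain.snoc_zero {n : ℕ} (s : Chain p G n) (m : PSub p G)
    (h : s.1 (Fin.last n) < m) : (s.snoc m h).1 0 = s.1 0 := by
  simp only [Chain.snoc]
  rw [← Fin.castSucc_zero, Fin.snoc_castSucc]

lemma Chain.face_last_snoc {n : ℕ} (s : Chain p G (n + 1)) :
    (s.face (Fin.last (n + 1))).snoc (s.1 (Fin.last (n + 1)))
      (s.2 (by simp [Fin.succAbove_last, Fin.lt_def])) = s := by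
  refine Subtype.ext (funext fun j => ?_)
  simp only [Chain.face, Chain.snoc]
  induction j using Fin.lastCases with
  | last => rw [Fin.snoc_last]
  | cast j => rw [Fin.snoc_castSucc, Fin.succAbove_last]

/-- The family of sets of simplices `U` is acyclic relative to the vertex `v`, with respect to the
coefficient system of `φ`. -/
structure IsAcyclicAt (φ : Z1 (OrbitCat p G) kˣ) (U : ∀ n, Set (Chain p G n)) (v : PSub p G) :
    Prop where
  zero : ∀ x ∈ Finsupp.supported k k (U 0), ∃ y ∈ Finsupp.supported k k (U 1), ∃ a : k,
    x = diffLin φ 0 y + Finsupp.single (Chain.vertex v) a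
  one : ∀ x ∈ Finsupp.supported k k (U 1), ∀ a : k,
    diffLin φ 0 x = Finsupp.single (Chain.vertex v) a →
      ∃ y ∈ Finsupp.supported k k (U 2), x = diffLin φ 1 y
  succ : ∀ n, ∀ x ∈ Finsupp.supported k k (U (n + 2)), diffLin φ (n + 1) x = 0 →
      ∃ y ∈ Finsupp.supported k k (U (n + 3)), x = diffLin φ (n + 2) y

lemma linearCombination_mem_supported {α β : Type*} {U : Set α} {V : Set β} {f : α → β →₀ k}
    (hf : ∀ a ∈ U, f a ∈ Finsupp.supported k k V) {x : α →₀ k} (hx : x ∈ Finsupp.supported k k U) :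
    Finsupp.linearCombination k f x ∈ Finsupp.supported k k V := by
  rw [Finsupp.linearCombination_apply]
  exact Submodule.sum_mem _ (fun a ha => Submodule.smul_mem _ _ (hf a (hx ha)))

lemma diffLin_mem_supported (φ : Z1 (OrbitCat p G) kˣ) {U : ∀ n, Set (Chain p G n)} {n : ℕ}
    (hU : ∀ s ∈ U (n + 1), ∀ i, s.face i ∈ U n) {x : Chain p G (n + 1) →₀ k}
    (hx : x ∈ Finsupp.supported k k (U (n + 1))) :
    diffLin φ n x ∈ Finsupp.supported k k (U n) := by
  rw [diffLin, LinearMap.sum_apply]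
  refine Submodule.sum_mem _ (fun i _ => Submodule.smul_mem _ _ ?_)
  exact linearCombination_mem_supported
    (fun s hs => Finsupp.single_mem_supported k _ (hU s hs i)) hx

/-- Two linear maps which agree on basis elements in `U` agree on elements supported in `U`. -/
lemma eqOn_supported {α M : Type*} [AddCommGroup M] [Module k M] {U : Set α}
    {f g : (α →₀ k) →ₗ[k] M} (h : ∀ a ∈ U, f (Finsupp.single a 1) = g (Finsupp.single a 1))
    {x : α →₀ k} (hx : x ∈ Finsupp.supported k k U) : f x = g x := by
  rw [Finsupp.supported_eq_span_single] at hx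
  exact LinearMap.eqOn_span (s := (fun i => Finsupp.single i (1 : k)) '' U)
    (by rintro _ ⟨a, ha, rfl⟩; exact h a ha) hx

lemma map_mem_of_supported {α M : Type*} [AddCommGroup M] [Module k M] {U : Set α}
    {f : (α →₀ k) →ₗ[k] M} {N : Submodule k M} (h : ∀ a ∈ U, f (Finsupp.single a 1) ∈ N)
    {x : α →₀ k} (hx : x ∈ Finsupp.supported k k U) : f x ∈ N := by
  rw [Finsupp.supported_eq_span_single] at hx
  exact (Submodule.span_le.2 (by rintro _ ⟨a, ha, rfl⟩; exact h a ha) :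
    Submodule.span k ((fun i => Finsupp.single i (1 : k)) '' U) ≤ N.comap f) hx

/-- A contracting homotopy gives acyclicity. -/
lemma IsAcyclicAt.of_homotopy {φ : Z1 (OrbitCat p G) kˣ} {U : ∀ n, Set (Chain p G n)}
    {v : PSub p G} (h : ∀ n, (Chain p G n →₀ k) →ₗ[k] (Chain p G (n + 1) →₀ k))
    (hU : ∀ n, ∀ x ∈ Finsupp.supported k k (U n), h n x ∈ Finsupp.supported k k (U (n + 1)))
    (hv : h 0 (Finsupp.single (Chain.vertex v) 1) = 0)
    (h0 : ∀ x ∈ Finsupp.supported k k (U 0), ∃ a : k,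
      x = diffLin φ 0 (h 0 x) + Finsupp.single (Chain.vertex v) a)
    (h1 : ∀ n, ∀ x ∈ Finsupp.supported k k (U (n + 1)),
      x = diffLin φ (n + 1) (h (n + 1) x) + h n (diffLin φ n x)) : IsAcyclicAt φ U v where
  zero x hx := by
    obtain ⟨a, ha⟩ := h0 x hx
    exact ⟨h 0 x, hU 0 x hx, a, ha⟩
  one x hx a hxa := by
    refine ⟨h 1 x, hU 1 x hx, ?_⟩
    have h2 := h1 0 x hx
    -- The boundary of `x` need not vanish, but it is a multiple of the vertex `v`, which the
    -- homotopy kills.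
    rwa [hxa, ← mul_one a, ← smul_eq_mul, ← Finsupp.smul_single, map_smul, hv, smul_zero,
      add_zero] at h2
  succ n x hx hxa := by
    refine ⟨h (n + 2) x, hU _ x hx, ?_⟩
    have h2 := h1 _ x hx
    rwa [hxa, map_zero, add_zero] at h2

/-- The simplices with vertices in `W`. -/
def fullOn (W : Set (PSub p G)) (n : ℕ) : Set (Chain p G n) := {s | ∀ i, s.1 i ∈ W}

open scoped Classical in
/-- The cone over the largest element of a set of vertices. -/
def coneLin (m : PSub p G) (n : ℕ) : (Chain p G n →₀ k) →ₗ[k] (Chain p G (n + 1) →₀ k) :=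
  Finsupp.linearCombination k (fun s => if h : s.1 (Fin.last n) < m then
    (-1 : k) ^ (n + 1) • Finsupp.single (s.snoc m h) 1 else 0)

lemma coneLin_of_lt {m : PSub p G} {n : ℕ} {s : Chain p G n} (h : s.1 (Fin.last n) < m) (a : k) :
    coneLin m n (Finsupp.single s a) = (-1 : k) ^ (n + 1) • Finsupp.single (s.snoc m h) a := by
  rw [coneLin, Finsupp.linearCombination_single, dif_pos h, smul_comm, Finsupp.smul_single,
    smul_eq_mul, mul_one]

lemma coneLin_of_eq {m : PSub p G} {n : ℕ} {s : Chain p G n} (h : s.1 (Fin.last n) = m) (a : k) :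
    coneLin m n (Finsupp.single s a) = 0 := by
  rw [coneLin, Finsupp.linearCombination_single, dif_neg (by rw [h]; exact lt_irrefl _), smul_zero]

/-- The homotopy appends the largest element `m` to chains not ending in it. Appending at the top
keeps the smallest group, so the twisting does not interfere; the sign `(-1) ^ (n + 1)` makes the
face omitting `m` return the chain itself. -/
lemma isAcyclicAt_cone (φ : Z1 (OrbitCat p G) kˣ) {W : Set (PSub p G)} {m : PSub p G} (hm : m ∈ W)
    (hW : ∀ P ∈ W, P ≤ m) : IsAcyclicAt φ (fullOn W) m := by
  refine IsAcyclicAt.of_homotopy (coneLin m) (fun n x hx => ?_) 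
    (coneLin_of_eq (s := Chain.vertex m) rfl 1)
    (fun x hx => ?_) (fun n x hx => ?_)
  · refine linearCombination_mem_supported (fun s hs => ?_) hx
    split_ifs with h
    · refine Submodule.smul_mem _ _ (Finsupp.single_mem_supported k _ (fun i => ?_))
      simp only [Chain.snoc]
      induction i using Fin.lastCases with
      | last => rwa [Fin.snoc_last]
      | cast i => rw [Fin.snoc_castSucc]; exact hs i
    · exact Submodule.zero_mem _
  -- For a vertex `P < m` the homotopy gives minus the edge, whose boundary is `P` minus a unit
  -- multiple of `m`; the difference is thus a multiple of the base vertex.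
  · have : ∀ x ∈ Finsupp.supported k k (fullOn W 0), 
        (LinearMap.id - diffLin φ 0 ∘ₗ coneLin m 0 : (Chain p G 0 →₀ k) →ₗ[k] _) x ∈
        LinearMap.range (Finsupp.lsingle (R := k) (M := k) (Chain.vertex m)) := by
      intro x hx
      refine map_mem_of_supported (fun s hs => ?_) hx
      simp only [LinearMap.sub_apply,
        LinearMap.id_apply, LinearMap.comp_apply]
      rcases (hW _ (hs (Fin.last 0))).lt_or_eq with h | h
      · rw [coneLin_of_lt h, map_smul, diffLin_single, Fin.sum_univ_two]
        have e0 : (s.snoc m h).face 0 = Chain.vertex m :=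
          (Chain.vertex_self _).symm.trans (congrArg Chain.vertex (by
            simp only [Chain.face, Chain.snoc]
            exact Fin.snoc_last (α := fun _ => PSub p G) _ _))
        have e1 : (s.snoc m h).face 1 = s := Chain.snoc_face_last s m h
        have c1 := coeff_congr φ ((s.snoc m h).le_face 1) rfl (Chain.snoc_zero s m h)
          (congrArg (fun t => t.1 0) e1)
        rw [coeff_one] at c1
        refine ⟨coeff φ 1 _ _ ((s.snoc m h).le_face 0), ?_⟩
        rw [c1, e1, Finsupp.lsingle_apply]
        refine (single_congr e0.symm rfl).trans ?_
        simp
      · rw [coneLin_of_eq h, map_zero, sub_zero]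
        refine ⟨1, ?_⟩
        rw [← h]
        exact congrArg (fun t => Finsupp.single t (1 : k)) (Chain.vertex_self s)
    obtain ⟨a, ha⟩ := this x hx
    exact ⟨a, by rw [← Finsupp.lsingle_apply (R := k), ha]; simp⟩
  · refine eqOn_supported (f := LinearMap.id) (g := diffLin φ (n + 1) ∘ₗ coneLin m (n + 1) +
      coneLin m n ∘ₗ diffLin φ n) (fun s hs => ?_) hx
    simp only [LinearMap.add_apply, LinearMap.id_apply, LinearMap.comp_apply]
    rcases (hW _ (hs (Fin.last (n + 1)))).lt_or_eq with h | h
    · rw [coneLin_of_lt h, map_smul, diffLin_single, diffLin_single, Fin.sum_univ_castSucc,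
        smul_add, map_sum]
      -- Coning a face and taking the corresponding face of the cone agree up to sign, so these
      -- terms cancel and only the face omitting `m` survives.
      have e : ∀ i : Fin (n + 2), coneLin m n ((-1 : k) ^ (i : ℕ) • Finsupp.single (s.face i)
          (1 * coeff φ 1 (s.1 0) ((s.face i).1 0) (s.le_face i) : k)) =
          -((-1 : k) ^ (n + 1 + 1) • (-1 : k) ^ (i : ℕ) • Finsupp.single
            ((s.snoc m h).face i.castSucc) (1 * coeff φ 1 ((s.snoc m h).1 0)
              (((s.snoc m h).face i.castSucc).1 0) ((s.snoc m h).le_face i.castSucc) : k)) := by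
        intro i
        have h' : (s.face i).1 (Fin.last n) < m :=
          lt_of_le_of_lt (s.2.monotone (Fin.le_last _)) h
        have e' : Finsupp.single ((s.snoc m h).face i.castSucc) (1 * coeff φ 1 ((s.snoc m h).1 0)
              (((s.snoc m h).face i.castSucc).1 0) ((s.snoc m h).le_face i.castSucc) : k) =
            Finsupp.single ((s.face i).snoc m h')
              (1 * coeff φ 1 (s.1 0) ((s.face i).1 0) (s.le_face i) : k) :=
          single_congr (Chain.snoc_face_castSucc s m h i) (congrArg (fun t : kˣ => 1 * (t : k))
            (coeff_congr φ _ rfl (Chain.snoc_zero s m h)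
              ((congrArg (fun t => t.1 0) (Chain.snoc_face_castSucc s m h i)).trans
                (Chain.snoc_zero (s.face i) m h'))))
        rw [e', map_smul, coneLin_of_lt (s := s.face i) h', smul_comm, ← neg_smul,
          pow_succ _ (n + 1), mul_neg_one, neg_neg]
      rw [Finset.sum_congr rfl (fun i _ => e i), Finset.sum_neg_distrib, ← Finset.smul_sum]
      have e1 := Chain.snoc_face_last s m h
      have c1 := coeff_congr φ ((s.snoc m h).le_face (Fin.last _)) rfl (Chain.snoc_zero s m h)
          (congrArg (fun t => t.1 0) e1)
      rw [coeff_one] at c1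
      rw [c1, e1, smul_smul, Fin.val_last, ← pow_add, Even.neg_one_pow ⟨_, rfl⟩]
      simp
    -- If the chain already ends in `m`, all faces but the last also end in `m` and are killed;
    -- coning the last face restores the chain.
    · rw [coneLin_of_eq h, map_zero, zero_add, diffLin_single, Fin.sum_univ_castSucc, map_add,
        map_sum, Finset.sum_eq_zero, zero_add, map_smul]
      · have h' : (s.face (Fin.last (n + 1))).1 (Fin.last n) < m := by
          rw [← h]; exact s.2 (by simp [Fin.succAbove_last, Fin.lt_def])
        have c1 := coeff_congr φ (s.le_face (Fin.last _)) rfl rfl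
          (show (s.face (Fin.last (n + 1))).1 0 = s.1 0 by simp [Chain.face, Fin.succAbove_last])
        rw [coeff_one] at c1
        rw [coneLin_of_lt (s := s.face (Fin.last (n + 1))) h', c1, smul_smul, Fin.val_last,
          ← pow_add, Even.neg_one_pow ⟨_, rfl⟩, one_smul, Units.val_one, mul_one]
        subst h
        rw [Chain.face_last_snoc]
      · intro i _
        rw [map_smul, coneLin_of_eq, smul_zero]
        rw [← h]
        simp [Chain.face]


lemma supported_mono_set {α : Type*} {U V : Set α} (h : U ⊆ V) {x : α →₀ k}
    (hx : x ∈ Finsupp.supported k k U) : x ∈ Finsupp.supported k k V :=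
  Finsupp.supported_mono h hx

/-- Only the face omitting the smallest group carries a coefficient, and it is a unit. Hence
comparable vertices are homologous up to a unit, which permits changes of base vertex. -/
lemma diffLin_edge (φ : Z1 (OrbitCat p G) kˣ) {P Q : PSub p G} (h : P < Q) :
    ∃ c : kˣ, ∀ a : k, diffLin φ 0 (Finsupp.single (Chain.edge h) a) =
      Finsupp.single (Chain.vertex Q) (a * c) - Finsupp.single (Chain.vertex P) a := by
  refine ⟨coeff φ 1 P Q (by rw [conjSub_one]; exact h.le), fun a => ?_⟩
  have e0 : (Chain.edge h).face 0 = Chain.vertex Q := (Chain.vertex_self _).symm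
  have e1 : (Chain.edge h).face 1 = Chain.vertex P := (Chain.vertex_self _).symm
  have h0 : Finsupp.single ((Chain.edge h).face 0) (a * coeff φ 1 ((Chain.edge h).1 0)
      (((Chain.edge h).face 0).1 0) ((Chain.edge h).le_face 0) : k) =
      Finsupp.single (Chain.vertex Q) (a * coeff φ 1 P Q (by rw [conjSub_one]; exact h.le) : k) :=
    single_congr e0 rfl
  have h1 : Finsupp.single ((Chain.edge h).face 1) (a * coeff φ 1 ((Chain.edge h).1 0)
      (((Chain.edge h).face 1).1 0) ((Chain.edge h).le_face 1) : k) =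
      Finsupp.single (Chain.vertex P) a :=
    single_congr e1 (Eq.trans (congrArg (fun t : kˣ => a * (t : k))
      (coeff_one φ P (by rw [conjSub_one]))) (by rw [Units.val_one, mul_one]))
  rw [diffLin_single, Fin.sum_univ_two, h0, h1]
  simp [sub_eq_add_neg]

lemma edge_mem_fullOn {W : Set (PSub p G)} {P Q : PSub p G} (hP : P ∈ W) (hQ : Q ∈ W)
    (h : P < Q) : Chain.edge h ∈ fullOn W 1 := by
  intro i
  fin_cases i
  · exact hP
  · exact hQ

lemma IsAcyclicAt.change_base {φ : Z1 (OrbitCat p G) kˣ} {U : ∀ n, Set (Chain p G n)}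
    {v w : PSub p G} (hv : IsAcyclicAt φ U v) (e : Chain p G 1 →₀ k)
    (he : e ∈ Finsupp.supported k k (U 1)) (c : kˣ)
    (hc : Finsupp.single (Chain.vertex v) 1 =
      diffLin φ 0 e + Finsupp.single (Chain.vertex w) (c : k)) : IsAcyclicAt φ U w where
  zero x hx := by
    obtain ⟨y, hy, a, rfl⟩ := hv.zero x hx
    refine ⟨y + a • e, Submodule.add_mem _ hy (Submodule.smul_mem _ _ he), a * c, ?_⟩
    rw [map_add, map_smul, add_assoc]
    congr 1
    have := congrArg (fun t => a • t) hc
    simpa using this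
  one x hx a hxa := by
    have h1 : diffLin φ 0 (x + (a * (c⁻¹ : kˣ)) • e) =
        Finsupp.single (Chain.vertex v) (a * (c⁻¹ : kˣ) : k) := by
      have h2 : Finsupp.single (Chain.vertex v) (a * (c⁻¹ : kˣ) : k) =
          (a * (c⁻¹ : kˣ) : k) • Finsupp.single (Chain.vertex v) (1 : k) := by simp
      rw [map_add, map_smul, hxa, h2, hc, smul_add, add_comm, Finsupp.smul_single]
      simp
    obtain ⟨y, hy, h2⟩ := hv.one _ (Submodule.add_mem _ hx (Submodule.smul_mem _ _ he)) _ h1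
    -- The corrected chain is a boundary, so its own boundary vanishes. This forces the coefficient
    -- of `e` to be zero, and the correction was empty.
    rw [h2, diffLin_comp] at h1
    have h3 : a * (c⁻¹ : kˣ) = 0 := Finsupp.single_eq_zero.1 h1.symm
    rw [h3, zero_smul, add_zero] at h2
    exact ⟨y, hy, h2⟩
  succ := hv.succ

lemma IsAcyclicAt.of_lt {φ : Z1 (OrbitCat p G) kˣ} {W : Set (PSub p G)} {v w : PSub p G}
    (h : IsAcyclicAt φ (fullOn W) v) (hv : v ∈ W) (hw : w ∈ W) (hvw : v < w) :
    IsAcyclicAt φ (fullOn W) w := by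
  obtain ⟨c, hc⟩ := diffLin_edge φ hvw
  refine h.change_base (-Finsupp.single (Chain.edge hvw) 1) (Submodule.neg_mem _
    (Finsupp.single_mem_supported k _ (edge_mem_fullOn hv hw hvw))) c ?_
  rw [map_neg, hc, one_mul]
  abel

lemma IsAcyclicAt.of_gt {φ : Z1 (OrbitCat p G) kˣ} {W : Set (PSub p G)} {v w : PSub p G}
    (h : IsAcyclicAt φ (fullOn W) v) (hv : v ∈ W) (hw : w ∈ W) (hvw : w < v) :
    IsAcyclicAt φ (fullOn W) w := by
  obtain ⟨c, hc⟩ := diffLin_edge φ hvw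
  refine h.change_base (Finsupp.single (Chain.edge hvw) (c⁻¹ : kˣ))
    (Finsupp.single_mem_supported k _ (edge_mem_fullOn hw hv hvw)) c⁻¹ ?_
  rw [hc]
  simp

/-- A family of subcomplexes, one for each simplex and decreasing along faces, each containing the
simplex and acyclic relative to `v`, shows that the whole complex is acyclic relative to `v`. -/
lemma IsAcyclicAt.of_carrier {φ : Z1 (OrbitCat p G) kˣ} {U : ∀ n, Set (Chain p G n)}
    {v : PSub p G}
    (hface : ∀ n, ∀ s ∈ U (n + 1), ∀ i, s.face i ∈ U n)
    (Γ : ∀ {n : ℕ}, Chain p G n → ∀ m, Set (Chain p G m))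
    (hΓ : ∀ n, ∀ s ∈ U n, IsAcyclicAt φ (Γ s) v) (hmem : ∀ n, ∀ s ∈ U n, s ∈ Γ s n)
    (hΓU : ∀ n, ∀ s ∈ U n, ∀ m, Γ s m ⊆ U m)
    (hΓface : ∀ n, ∀ s ∈ U (n + 1), ∀ i m, Γ (s.face i) m ⊆ Γ s m) : IsAcyclicAt φ U v := by
  classical
  have h0 : ∀ s : Chain p G 0, ∃ y : Chain p G 1 →₀ k, (s = Chain.vertex v → y = 0) ∧
      (s ∈ U 0 → y ∈ Finsupp.supported k k (Γ s 1) ∧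
        ∃ a : k, Finsupp.single s 1 = diffLin φ 0 y + Finsupp.single (Chain.vertex v) a) := by
    intro s
    -- At the base vertex the value `0` is imposed, so that the homotopy kills `v`.
    by_cases hs : s = Chain.vertex v
    · subst hs
      exact ⟨0, fun _ => rfl, fun _ => ⟨Submodule.zero_mem _, 1, by simp⟩⟩
    · by_cases hsU : s ∈ U 0
      · obtain ⟨y, hy, a, ha⟩ := (hΓ 0 s hsU).zero (Finsupp.single s 1)
          (Finsupp.single_mem_supported k _ (hmem 0 s hsU))
        exact ⟨y, fun h => absurd h hs, fun _ => ⟨hy, a, ha⟩⟩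
      · exact ⟨0, fun h => absurd h hs, fun h => absurd h hsU⟩
  choose f0 hf0v hf0 using h0
  let Sec (n : ℕ) : Type u := (Chain p G n →₀ k) →ₗ[k] (Chain p G (n + 1) →₀ k)
  -- This is the invariant of the construction: it keeps `s - h ∂s` inside the carrier of `s`, where
  -- acyclicity supplies the next value of the homotopy.
  let Carried (n : ℕ) (h : Sec n) : Prop :=
    ∀ s ∈ U n, h (Finsupp.single s 1) ∈ Finsupp.supported k k (Γ s (n + 1))
  have hcar : ∀ (n : ℕ) (h : Sec n), Carried n h → ∀ s ∈ U (n + 1),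
      h (diffLin φ n (Finsupp.single s 1)) ∈ Finsupp.supported k k (Γ s (n + 1)) := by
    intro n h hh s hs
    rw [diffLin_single, map_sum]
    refine Submodule.sum_mem _ (fun i _ => ?_)
    rw [map_smul, ← mul_one (1 * _ : k), ← smul_eq_mul (1 * _ : k), ← Finsupp.smul_single, map_smul]
    exact Submodule.smul_mem _ _ (Submodule.smul_mem _ _
      (supported_mono_set (hΓface n s hs i _) (hh _ (hface n s hs i))))
  let Hom0 (h : Sec 0) : Prop := Carried 0 h ∧ h (Finsupp.single (Chain.vertex v) 1) = 0 ∧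
    ∀ x ∈ Finsupp.supported k k (U 0), ∃ a : k,
      x = diffLin φ 0 (h x) + Finsupp.single (Chain.vertex v) a
  let HomS (n : ℕ) (h : Sec n) (h' : Sec (n + 1)) : Prop := Carried (n + 1) h' ∧
    ∀ x ∈ Finsupp.supported k k (U (n + 1)), x = diffLin φ (n + 1) (h' x) + h (diffLin φ n x)
  have ex0 : ∃ h : Sec 0, Hom0 h := by
    refine ⟨Finsupp.linearCombination k f0, fun s hs => ?_, ?_, fun x hx => ?_⟩
    · rw [Finsupp.linearCombination_single, one_smul]
      exact (hf0 s hs).1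
    · rw [Finsupp.linearCombination_single, one_smul]
      exact hf0v _ rfl
    · have : (LinearMap.id - diffLin φ 0 ∘ₗ Finsupp.linearCombination k f0 :
          (Chain p G 0 →₀ k) →ₗ[k] _) x ∈
          LinearMap.range (Finsupp.lsingle (R := k) (M := k) (Chain.vertex v)) := by
        refine map_mem_of_supported (fun s hs => ?_) hx
        obtain ⟨a, ha⟩ := (hf0 s hs).2
        refine ⟨a, ?_⟩
        simp only [LinearMap.sub_apply, LinearMap.id_apply, LinearMap.comp_apply,
          Finsupp.linearCombination_single, one_smul, Finsupp.lsingle_apply]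
        rw [ha]
        abel
      obtain ⟨a, ha⟩ := this
      exact ⟨a, by rw [← Finsupp.lsingle_apply (R := k), ha]; simp⟩
  have exS : ∀ (n : ℕ) (h : Sec n), Carried n h →
      (∀ s ∈ U (n + 1), ∃ y ∈ Finsupp.supported k k (Γ s (n + 2)),
        Finsupp.single s 1 - h (diffLin φ n (Finsupp.single s 1)) = diffLin φ (n + 1) y) →
      ∃ h' : Sec (n + 1), HomS n h h' := by
    intro n h hh hy
    choose! y hy1 hy2 using hy
    refine ⟨Finsupp.linearCombination k y, fun s hs => ?_, fun x hx => ?_⟩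
    · rw [Finsupp.linearCombination_single, one_smul]
      exact hy1 s hs
    · refine eqOn_supported (f := LinearMap.id) (g := diffLin φ (n + 1) ∘ₗ
        Finsupp.linearCombination k y + h ∘ₗ diffLin φ n) (fun s hs => ?_) hx
      simp only [LinearMap.add_apply, LinearMap.id_apply, LinearMap.comp_apply,
        Finsupp.linearCombination_single, one_smul]
      rw [← hy2 s hs, sub_add_cancel]
  have hmem' : ∀ n (h : Sec n), Carried n h → ∀ s ∈ U (n + 1),
      Finsupp.single s 1 - h (diffLin φ n (Finsupp.single s 1)) ∈
        Finsupp.supported k k (Γ s (n + 1)) := fun n h hh s hs =>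
    Submodule.sub_mem _ (Finsupp.single_mem_supported k _ (hmem _ s hs)) (hcar n h hh s hs)
  have ex1 : ∀ h : Sec 0, Hom0 h → ∃ h' : Sec 1, HomS 0 h h' := by
    intro h hh
    -- In degree one the boundary of `s - h ∂s` is a multiple of `v` rather than zero, which is the
    -- situation covered by the field `one`.
    refine exS 0 h hh.1 (fun s hs => ?_)
    obtain ⟨a, ha⟩ := hh.2.2 (diffLin φ 0 (Finsupp.single s 1))
      (diffLin_mem_supported φ (hface 0) (Finsupp.single_mem_supported k _ hs))
    refine (hΓ 1 s hs).one _ (hmem' 0 h hh.1 s hs) a ?_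
    rw [map_sub]
    nth_rewrite 1 [ha]
    abel
  have ex2 : ∀ n (h : Sec n) (h' : Sec (n + 1)), HomS n h h' →
      ∃ h'' : Sec (n + 2), HomS (n + 1) h' h'' := by
    intro n h h' hh
    refine exS (n + 1) h' hh.1 (fun s hs => ?_)
    have ha := hh.2 (diffLin φ (n + 1) (Finsupp.single s 1))
      (diffLin_mem_supported φ (hface _) (Finsupp.single_mem_supported k _ hs))
    refine (hΓ _ s hs).succ _ _ (hmem' _ h' hh.1 s hs) ?_
    rw [diffLin_comp, map_zero, add_zero] at ha
    rw [map_sub, ← ha, sub_self]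
  obtain ⟨g0, hg0⟩ := ex0
  choose! g1 hg1 using ex1
  choose! g2 hg2 using ex2
  -- The recursion runs over pairs, because the homotopy identity that produces the next map
  -- involves the two preceding ones.
  let step : ∀ n, Sec n × Sec (n + 1) → Sec (n + 1) × Sec (n + 2) := fun n q =>
    (q.2, g2 n q.1 q.2)
  let H : ∀ n, Sec n × Sec (n + 1) := fun n => Nat.rec (g0, g1 g0) step n
  have hH : ∀ n, HomS n (H n).1 (H n).2 := fun n => by
    induction n with
    | zero => exact hg1 g0 hg0
    | succ n ih => exact hg2 n _ _ ih
  have hHc : ∀ n, Carried n (H n).1 := fun n => by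
    cases n with
    | zero => exact hg0.1
    | succ n => exact (hH n).1
  refine IsAcyclicAt.of_homotopy (fun n => (H n).1) (fun n x hx => ?_) hg0.2.1 hg0.2.2
    (fun n x hx => (hH n).2 x hx)
  refine map_mem_of_supported (fun s hs => ?_) hx
  exact supported_mono_set (hΓU n s hs _) (hHc n s hs)

/-- The product of a `p`-subgroup and a `p`-subgroup normalizing it. -/
def mulSub [Fact p.Prime] (P Q : PSub p G) (h : Q.1 ≤ Subgroup.normalizer (P.1 : Set G)) : PSub p G :=
  ⟨P.1 ⊔ Q.1, P.2.1.to_sup_of_normal_left' Q.2.1 h,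
    fun h0 => P.2.2 (eq_bot_iff.2 (le_sup_left.trans h0.le))⟩

/-- Quillen's conical contraction: if `Q` normalizes `P`, then `P ≤ PQ ≥ Q` and `PQ` is again a
`p`-group normalized by `Q`. The group `S` is in the family, since it contains `Q` and normalizes
itself, and so may replace `Q` as base vertex. -/
lemma isAcyclicAt_normalized [Fact p.Prime] (φ : Z1 (OrbitCat p G) kˣ) {Q S : PSub p G}
    (hQS : Q ≤ S) :
    IsAcyclicAt φ (fullOn {P : PSub p G | Q.1 ≤ Subgroup.normalizer (P.1 : Set G)}) S := by
  let W : Set (PSub p G) := {P : PSub p G | Q.1 ≤ Subgroup.normalizer (P.1 : Set G)}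
  have hQ : Q ∈ W := Subgroup.le_normalizer
  have hS : S ∈ W := le_trans (show Q.1 ≤ S.1 from hQS) Subgroup.le_normalizer
  suffices H : IsAcyclicAt φ (fullOn W) Q by
    rcases hQS.lt_or_eq with h | h
    · exact H.of_lt hQ hS h
    · exact h ▸ H
  refine IsAcyclicAt.of_carrier (fun n s hs i j => hs _)
    -- The carrier of a chain with top group `P` has largest element `PQ`, so it is a cone; the edge
    -- `Q ≤ PQ` moves its base to `Q`.
    (fun {n} s => fullOn {P | P ∈ W ∧ P.1 ≤ (s.1 (Fin.last n)).1 ⊔ Q.1}) (fun n s hs => ?_)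
    (fun n s hs i => ⟨hs i, le_trans (show (s.1 i).1 ≤ _ from s.2.monotone (Fin.le_last i))
      le_sup_left⟩) (fun n s hs m t ht i => (ht i).1) (fun n s hs i m t ht j => ⟨(ht j).1, ?_⟩)
  · let m := mulSub (s.1 (Fin.last n)) Q (hs _)
    have hQm : Q ≤ m := show Q.1 ≤ _ from le_sup_right
    have hm : m ∈ W := le_trans (show Q.1 ≤ m.1 from hQm) Subgroup.le_normalizer
    have h1 := isAcyclicAt_cone φ (W := {P | P ∈ W ∧ P.1 ≤ (s.1 (Fin.last n)).1 ⊔ Q.1}) (m := m)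
      ⟨hm, le_rfl⟩ (fun P hP => hP.2)
    rcases hQm.lt_or_eq with h | h
    · exact h1.of_gt ⟨hm, le_rfl⟩ ⟨hQ, le_sup_right⟩ h
    · rw [← h] at h1
      exact h1
  · refine (ht j).2.trans (sup_le_sup_right ?_ _)
    exact s.2.monotone (Fin.le_last _)

/-- The simplices whose stabilizer in `S` is non-trivial. -/
def singularSimplices (S : Subgroup G) (n : ℕ) : Set (Chain p G n) :=
  {s | ∃ x ∈ S, x ≠ 1 ∧ s.conj x = s}

/-- The carrier of `s` consists of the chains of groups normalized by the stabilizer of `s` in `S`.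
It contains `s`, is acyclic by `isAcyclicAt_normalized`, and has only singular simplices, since that
stabilizer fixes them. Faces have larger stabilizers and hence smaller carriers. -/
lemma isAcyclicAt_singularSimplices [Fact p.Prime] (φ : Z1 (OrbitCat p G) kˣ) (S : PSub p G) :
    IsAcyclicAt φ (singularSimplices S.1) S := by
  have hconj : ∀ (x : G) (P : PSub p G), SylowTriv.conjSub x P = P ↔ x ∈ Subgroup.normalizer (P.1 : Set G) := by
    intro x P
    rw [Subgroup.mem_normalizer_iff]
    constructor
    · intro h y
      have := mem_conjSub_iff x P (x * y * x⁻¹)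
      rw [h] at this
      rw [this]
      simp [mul_assoc]
    · intro h
      refine Subtype.ext (Subgroup.ext fun y => ?_)
      rw [mem_conjSub_iff, h]
      simp [mul_assoc]
  have hconj' : ∀ {n : ℕ} (x : G) (s : Chain p G n), s.conj x = s ↔
      ∀ i, x ∈ Subgroup.normalizer ((s.1 i).1 : Set G) := by
    intro n x s
    refine ⟨fun h i => (hconj _ _).1 (congrFun (congrArg Subtype.val h) i), fun h =>
      Subtype.ext (funext fun i => (hconj _ _).2 (h i))⟩
  let Nm {n : ℕ} (s : Chain p G n) : Subgroup G :=
    S.1 ⊓ ⨅ i, Subgroup.normalizer ((s.1 i).1 : Set G)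
  have hNm : ∀ {n : ℕ} (s : Chain p G n) (x : G), x ∈ Nm s ↔ x ∈ S.1 ∧ s.conj x = s := by
    intro n s x
    rw [hconj', Subgroup.mem_inf, Subgroup.mem_iInf]
  have hNm1 : ∀ {n : ℕ} (s : Chain p G n), s ∈ singularSimplices S.1 n ↔ Nm s ≠ ⊥ := by
    intro n s
    rw [Subgroup.ne_bot_iff_exists_ne_one]
    constructor
    · rintro ⟨x, hx, hx1, hxs⟩
      exact ⟨⟨x, (hNm s x).2 ⟨hx, hxs⟩⟩, fun h => hx1 (congrArg Subtype.val h)⟩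
    · rintro ⟨⟨x, hx⟩, hx1⟩
      exact ⟨x, ((hNm s x).1 hx).1, fun h => hx1 (Subtype.ext h), ((hNm s x).1 hx).2⟩
  have hNface : ∀ {n : ℕ} (s : Chain p G (n + 1)) (i), Nm s ≤ Nm (s.face i) := by
    intro n s i x hx
    rw [hNm] at hx ⊢
    exact ⟨hx.1, (congrArg (Chain.face i) hx.2 : _)⟩
  refine IsAcyclicAt.of_carrier ?_
    (fun {n} s => fullOn {P | Nm s ≤ Subgroup.normalizer (P.1 : Set G)}) ?_ ?_ ?_ ?_
  · rintro n s ⟨x, hx, hx1, hxs⟩ i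
    exact ⟨x, hx, hx1, congrArg (Chain.face i) hxs⟩
  · intro n s hs
    exact isAcyclicAt_normalized φ (Q := ⟨Nm s, S.2.1.to_le inf_le_left, (hNm1 s).1 hs⟩)
      (show Nm s ≤ S.1 from inf_le_left)
  · intro n s hs i
    exact fun x hx => Subgroup.mem_iInf.1 hx.2 i
  · intro n s hs m t ht
    rw [hNm1] at hs ⊢
    exact ne_bot_of_le_ne_bot hs (le_inf inf_le_left (le_iInf ht))
  · intro n s hs i m t ht j
    exact (hNface s i).trans (ht j)

end Acyclic

/-! ### Element-wise criteria for isomorphisms and cones in the derived category. -/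

section RepComplexes

open DerivedCategory

variable {k G : Type u} [Field k] [Group G]

/-- The morphism from the trivial module given by an invariant element. -/
def trivialHom (M : Rep.{u} k G) (m : M.V) (hm : ∀ g, M.ρ g m = m) : Rep.trivial k G k ⟶ M :=
  Rep.ofHom ⟨LinearMap.toSpanSingleton k M.V m, fun g => LinearMap.ext_ring (by simp [hm])⟩

lemma trivialHom_apply (M : Rep.{u} k G) (m : M.V) (hm : ∀ g, M.ρ g m = m) (c : k) :
    (trivialHom M m hm).hom c = c • m := rfl

lemma rep_exact_iff (S : ShortComplex (Rep.{u} k G)) :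
    S.Exact ↔ ∀ x : S.X₂.V, S.g.hom x = 0 → ∃ y : S.X₁.V, S.f.hom y = x := by
  rw [← ShortComplex.exact_map_iff_of_faithful S (forget₂ (Rep.{u} k G) (ModuleCat.{u} k)),
    ShortComplex.moduleCat_exact_iff]
  rfl

lemma rep_eval_exact {S : ShortComplex (CochainComplex (Rep.{u} k G) ℤ)} (hS : S.Exact) (i : ℤ)
    (x : (S.X₂.X i).V) (hx : (S.g.f i).hom x = 0) : ∃ y : (S.X₁.X i).V, (S.f.f i).hom y = x :=
  (rep_exact_iff _).1 (hS.map (HomologicalComplex.eval _ _ i)) x hx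

lemma rep_eval_surjective {K L : CochainComplex (Rep.{u} k G) ℤ} (f : K ⟶ L) [Epi f] (i : ℤ) :
    Function.Surjective (f.f i).hom :=
  (Rep.epi_iff_surjective _).1 inferInstance

lemma rep_eval_injective {K L : CochainComplex (Rep.{u} k G) ℤ} (f : K ⟶ L) [Mono f] (i : ℤ) :
    Function.Injective (f.f i).hom :=
  (Rep.mono_iff_injective _).1 inferInstance

lemma rep_d_comm {K L : CochainComplex (Rep.{u} k G) ℤ} (f : K ⟶ L) (i j : ℤ) (x : (K.X i).V) :
    (L.d i j).hom ((f.f i).hom x) = (f.f j).hom ((K.d i j).hom x) := by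
  rw [← Rep.comp_apply, ← Rep.comp_apply, f.comm]

lemma rep_d_d (K : CochainComplex (Rep.{u} k G) ℤ) (i j l : ℤ) (x : (K.X i).V) :
    (K.d j l).hom ((K.d i j).hom x) = 0 := by
  rw [← Rep.comp_apply, K.d_comp_d]; rfl

/-- An epimorphism of complexes with acyclic kernel is inverted in the derived category. -/
lemma isIso_Q_map_of_surjective {K L : CochainComplex (Rep.{u} k G) ℤ} (f : K ⟶ L) [Epi f]
    (h : ∀ (i : ℤ) (x : (K.X i).V), (f.f i).hom x = 0 → (K.d i (i + 1)).hom x = 0 →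
      ∃ y : (K.X (i - 1)).V, (f.f (i - 1)).hom y = 0 ∧ (K.d (i - 1) i).hom y = x) :
    IsIso (Q.map f) := by
  let S : ShortComplex (CochainComplex (Rep.{u} k G) ℤ) :=
    ShortComplex.mk (kernel.ι f) f (kernel.condition f)
  have hS : S.ShortExact := { exact := ShortComplex.exact_kernel _ }
  have hE : HomologicalComplex.Acyclic (kernel f) := fun i => by
    rw [HomologicalComplex.exactAt_iff' _ (i - 1) i (i + 1) (by simp) (by simp), rep_exact_iff]
    intro (x : ((kernel f).X i).V) hx
    have hx' : ((kernel f).d i (i + 1)).hom x = 0 := hx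
    obtain ⟨y, hy, hy'⟩ := h i (((kernel.ι f).f i).hom x) (by
      rw [← Rep.comp_apply, ← HomologicalComplex.comp_f, kernel.condition]; rfl) (by
      rw [rep_d_comm, hx', map_zero])
    obtain ⟨z, rfl⟩ := rep_eval_exact hS.exact (i - 1) y hy
    refine ⟨z, rep_eval_injective (kernel.ι f) i ?_⟩
    rw [← hy']
    exact (rep_d_comm (kernel.ι f) (i - 1) i z).symm
  exact (Pretriangulated.Triangle.isZero₁_iff_isIso₂ _
    (triangleOfSES_distinguished hS)).1 (isZero_Q_of_acyclic hE)

/-- The hypothesis `h` says that the kernel of `π` modulo `B` is acyclic. So `K/B → L` is inverted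
in the derived category, and the cone of `u` is `L` up to isomorphism. -/
lemma trW_of_relative_acyclic {B K L : CochainComplex (Rep.{u} k G) ℤ} (u : B ⟶ K) (π : K ⟶ L)
    [Mono u] [Epi π] (huπ : u ≫ π = 0) (N : ObjectProperty (DerivedCategory (Rep.{u} k G)))
    [N.IsTriangulated] [N.IsClosedUnderIsomorphisms] (hL : N (Q.obj L))
    (h : ∀ (i : ℤ) (x : (K.X i).V), (π.f i).hom x = 0 →
      (∃ b : (B.X (i + 1)).V, (K.d i (i + 1)).hom x = (u.f (i + 1)).hom b) →
      ∃ (y : (K.X (i - 1)).V) (b : (B.X i).V), (π.f (i - 1)).hom y = 0 ∧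
        x = (K.d (i - 1) i).hom y + (u.f i).hom b) : N.trW (Q.map u) := by
  let S : ShortComplex (CochainComplex (Rep.{u} k G) ℤ) :=
    ShortComplex.mk u (cokernel.π u) (cokernel.condition u)
  have hS : S.ShortExact := { exact := ShortComplex.exact_cokernel _ }
  let f : cokernel u ⟶ L := cokernel.desc u π huπ
  have hf : cokernel.π u ≫ f = π := cokernel.π_desc _ _ _
  have : Epi f := by
    have : Epi (cokernel.π u ≫ f) := by rw [hf]; infer_instance
    exact epi_of_epi (cokernel.π u) f
  have hf' : ∀ (i : ℤ) (x : (K.X i).V), (f.f i).hom (((cokernel.π u).f i).hom x) =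
      (π.f i).hom x := fun i x => by
    rw [← Rep.comp_apply, ← HomologicalComplex.comp_f, hf]
  have hu : ∀ (i : ℤ) (x : (B.X i).V), ((cokernel.π u).f i).hom ((u.f i).hom x) = 0 :=
    fun i x => by
    rw [← Rep.comp_apply, ← HomologicalComplex.comp_f, cokernel.condition]; rfl
  have hQ : IsIso (Q.map f) := by
    refine isIso_Q_map_of_surjective f (fun i x hx hdx => ?_)
    obtain ⟨x, rfl⟩ := rep_eval_surjective (cokernel.π u) i x
    rw [hf'] at hx
    rw [rep_d_comm] at hdx
    obtain ⟨b, hb⟩ := rep_eval_exact hS.exact (i + 1) _ hdx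
    obtain ⟨y, b', hy, rfl⟩ := h i x hx ⟨b, hb.symm⟩
    refine ⟨((cokernel.π u).f (i - 1)).hom y, (hf' _ _).trans hy, ?_⟩
    rw [map_add, hu, add_zero, rep_d_comm]
  exact ObjectProperty.trW.mk N (triangleOfSES_distinguished hS)
    (N.prop_of_iso (asIso (Q.map f)).symm hL)

end RepComplexes

/-! ### Quotients of complexes of representations. -/

section Quotient

variable {k G : Type u} [Field k] [Group G]

/-- The quotient of a complex of representations by a family of submodules. -/
def quotientComplex (K : CochainComplex (Rep.{u} k G) ℤ) (A : ∀ i, Submodule k (K.X i).V)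
    (hA : ∀ i g, A i ≤ (A i).comap ((K.X i).ρ g))
    (hd : ∀ i j, ∀ x ∈ A i, (K.d i j).hom x ∈ A j) : CochainComplex (Rep.{u} k G) ℤ where
  X i := (K.X i).quotient (A i) (hA i)
  d i j := Rep.ofHom ⟨Submodule.mapQ (A i) (A j) (K.d i j).hom.toLinearMap (hd i j), fun g => by
    refine Submodule.linearMap_qext _ (LinearMap.ext fun x => ?_)
    exact congrArg (Submodule.Quotient.mk (p := A j)) (Rep.hom_comm_apply (K.d i j) g x)⟩
  shape i j hij := by
    refine Rep.hom_ext (Representation.IntertwiningMap.ext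
      (Submodule.linearMap_qext _ (LinearMap.ext fun x => ?_)))
    change Submodule.Quotient.mk ((K.d i j).hom x) = 0
    rw [K.shape i j hij]
    rfl
  d_comp_d' i j l _ _ := by
    refine Rep.hom_ext (Representation.IntertwiningMap.ext
      (Submodule.linearMap_qext _ (LinearMap.ext fun x => ?_)))
    change Submodule.Quotient.mk ((K.d j l).hom ((K.d i j).hom x)) = 0
    rw [rep_d_d]
    rfl

/-- The projection to the quotient of a complex by a family of submodules. -/
def quotientComplexMk (K : CochainComplex (Rep.{u} k G) ℤ) (A : ∀ i, Submodule k (K.X i).V)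
    (hA : ∀ i g, A i ≤ (A i).comap ((K.X i).ρ g))
    (hd : ∀ i j, ∀ x ∈ A i, (K.d i j).hom x ∈ A j) : K ⟶ quotientComplex K A hA hd where
  f i := (K.X i).mkQ (A i) (hA i)

instance (K : CochainComplex (Rep.{u} k G) ℤ) (A : ∀ i, Submodule k (K.X i).V)
    (hA : ∀ i g, A i ≤ (A i).comap ((K.X i).ρ g))
    (hd : ∀ i j, ∀ x ∈ A i, (K.d i j).hom x ∈ A j) : Epi (quotientComplexMk K A hA hd) := by
  have : ∀ i, Epi ((quotientComplexMk K A hA hd).f i) := fun i => by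
    rw [Rep.epi_iff_surjective]
    exact Submodule.mkQ_surjective (A i)
  exact HomologicalComplex.epi_of_epi_f _ this

end Quotient

/-! ### The twisted complex in terms of chains. -/

section ExtendedComplex

variable {p : ℕ} {k G : Type u} [Field k] [Group G]

/-- The terms of `steinbergCochain` as spaces of chains. -/
def cochainEquiv (φ : Z1 (OrbitCat p G) kˣ) {n : ℕ} {i : ℤ} (hi : -(n : ℤ) = i) :
    ((steinbergCochain φ).X i).V ≃ₗ[k] (Chain p G n →₀ k) :=
  (Representation.equivOfIso
    ((steinberg φ).extendXIso ComplexShape.embeddingDownNat hi)).toLinearEquiv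

lemma cochainEquiv_rho (φ : Z1 (OrbitCat p G) kˣ) {n : ℕ} {i : ℤ} (hi : -(n : ℤ) = i) (g : G)
    (x : ((steinbergCochain φ).X i).V) :
    cochainEquiv φ hi (((steinbergCochain φ).X i).ρ g x) =
      steinbergRho φ n g (cochainEquiv φ hi x) :=
  Rep.hom_comm_apply ((steinberg φ).extendXIso ComplexShape.embeddingDownNat hi).hom g x

lemma cochainEquiv_d (φ : Z1 (OrbitCat p G) kˣ) {n : ℕ} {i j : ℤ} (hi : -((n + 1 : ℕ) : ℤ) = i)
    (hj : -(n : ℤ) = j) (x : ((steinbergCochain φ).X i).V) :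
    cochainEquiv φ hj (((steinbergCochain φ).d i j).hom x) =
      diffLin φ n (cochainEquiv φ hi x) := by
  have h := (steinberg φ).extend_d_eq ComplexShape.embeddingDownNat hi hj
  have h2 : (steinberg φ).d (n + 1) n = steinbergD φ n :=
    ChainComplex.of_d (steinbergObj φ) (steinbergD φ) n
  rw [h2] at h
  have h3 : ((steinberg φ).extend ComplexShape.embeddingDownNat).d i j ≫
      ((steinberg φ).extendXIso ComplexShape.embeddingDownNat hj).hom =
      ((steinberg φ).extendXIso ComplexShape.embeddingDownNat hi).hom ≫ steinbergD φ n := by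
    have h4 (Z : Rep.{u} k G) (a : ((steinberg φ).extend ComplexShape.embeddingDownNat).X i ⟶ Z)
        (b : Z ⟶ steinbergObj φ n) (e : ((steinberg φ).extend ComplexShape.embeddingDownNat).X j ≅
          steinbergObj φ n) : (a ≫ b ≫ e.inv) ≫ e.hom = a ≫ b := by simp
    exact (congrArg (· ≫ _) h).trans (h4 _ _ _ _)
  rw [← steinbergD_hom_apply]
  exact (Rep.comp_apply _ _ x).symm.trans
    (congrArg (fun t : ((steinberg φ).extend ComplexShape.embeddingDownNat).X i ⟶
      steinbergObj φ n => t.hom x) h3)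

lemma subsingleton_cochain (φ : Z1 (OrbitCat p G) kˣ) {i : ℤ} (hi : ∀ n : ℕ, -(n : ℤ) ≠ i) :
    Subsingleton ((steinbergCochain φ).X i).V :=
  (Rep.isZero_iff k G _).1 ((steinberg φ).isZero_extend_X ComplexShape.embeddingDownNat i hi)

lemma Chain.conj_mul {n : ℕ} (g h : G) (s : Chain p G n) : s.conj (g * h) = (s.conj h).conj g :=
  Subtype.ext (funext fun _ => conjSub_mul _ _ _)

lemma Chain.conj_one {n : ℕ} (s : Chain p G n) : s.conj 1 = s :=
  Subtype.ext (funext fun _ => conjSub_one _)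

lemma conjSub_of_mem {P : PSub p G} {g : G} (hg : g ∈ P.1) : SylowTriv.conjSub g P = P := by
  refine Subtype.ext (Subgroup.ext fun x => ?_)
  rw [mem_conjSub_iff]
  constructor
  · intro h
    have := P.1.mul_mem (P.1.mul_mem hg h) (P.1.inv_mem hg)
    simpa [mul_assoc] using this
  · exact fun h => P.1.mul_mem (P.1.mul_mem (P.1.inv_mem hg) h) hg

lemma orbitMap_of_mem {P : PSub p G} {g : G} (hg : g ∈ P.1) (h : SylowTriv.conjSub g P ≤ P) :
    orbitMap g P P h = 𝟙 (OrbitCat.mk P) := by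
  apply OrbitCat.hom_ext
  rw [toMap_orbitMap]
  refine QuotientGroup.eq.2 ?_
  simpa using hg

/-- An element of `P` induces the identity of `G/P`, where a cocycle takes the value `1`. Hence `P`
acts trivially on its own line, and the vertex `P` is an invariant element. -/
lemma steinbergRho_vertex (φ : Z1 (OrbitCat p G) kˣ) {P : PSub p G} {g : G} (hg : g ∈ P.1) (a : k) :
    steinbergRho φ 0 g (Finsupp.single (Chain.vertex P) a) =
      Finsupp.single (Chain.vertex P) a := by
  rw [steinbergRho_single]
  have h1 : (Chain.vertex P).conj g = Chain.vertex P :=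
    Subtype.ext (funext fun _ => conjSub_of_mem hg)
  refine single_congr h1 ?_
  have h2 : coeff φ g ((Chain.vertex P).1 0) (((Chain.vertex P).conj g).1 0)
      ((Chain.vertex P).le_conj g) = coeff φ g P P (conjSub_of_mem hg).le :=
    coeff_congr φ _ rfl rfl (conjSub_of_mem hg)
  rw [h2, coeff, orbitMap_of_mem hg, Z1.map_id, inv_one, Units.val_one, mul_one]

end ExtendedComplex

/-! ### Restriction to `S`: the vertex `S` and the free quotient. -/

section RestrictedComplex

open DerivedCategory

variable {p : ℕ} {k G : Type u} [Field k] [Group G] (φ : Z1 (OrbitCat p G) kˣ)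

/-- The restriction of the twisted Steinberg complex to a subgroup. -/
abbrev resCochain (S : Subgroup G) : CochainComplex (Rep.{u} k S) ℤ :=
  ((Rep.resFunctor S.subtype).mapHomologicalComplex _).obj (steinbergCochain φ)

/-- The terms of `resCochain` as spaces of chains. -/
def resCochainEquiv (S : Subgroup G) {n : ℕ} {i : ℤ} (hi : -(n : ℤ) = i) :
    ((resCochain φ S).X i).V ≃ₗ[k] (Chain p G n →₀ k) :=
  cochainEquiv φ hi

lemma resCochainEquiv_rho (S : Subgroup G) {n : ℕ} {i : ℤ} (hi : -(n : ℤ) = i) (g : S)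
    (x : ((resCochain φ S).X i).V) :
    resCochainEquiv φ S hi (((resCochain φ S).X i).ρ g x) =
      steinbergRho φ n g.1 (resCochainEquiv φ S hi x) :=
  cochainEquiv_rho φ hi g.1 x

lemma resCochainEquiv_d (S : Subgroup G) {n : ℕ} {i j : ℤ} (hi : -((n + 1 : ℕ) : ℤ) = i)
    (hj : -(n : ℤ) = j) (x : ((resCochain φ S).X i).V) :
    resCochainEquiv φ S hj (((resCochain φ S).d i j).hom x) =
      diffLin φ n (resCochainEquiv φ S hi x) :=
  cochainEquiv_d φ hi hj x

lemma subsingleton_resCochain (S : Subgroup G) {i : ℤ} (hi : ∀ n : ℕ, -(n : ℤ) ≠ i) :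
    Subsingleton ((resCochain φ S).X i).V :=
  subsingleton_cochain φ hi

/-- The span of the simplices with non-trivial stabilizer. -/
def singularSub (S : Subgroup G) (i : ℤ) : Submodule k ((resCochain φ S).X i).V :=
  ⨅ (n : ℕ) (hi : -(n : ℤ) = i), (Finsupp.supported k k (singularSimplices (p := p) S n)).comap
    (resCochainEquiv φ S hi).toLinearMap

lemma mem_singularSub {S : Subgroup G} {i : ℤ} {x : ((resCochain φ S).X i).V} :
    x ∈ singularSub φ S i ↔ ∀ (n : ℕ) (hi : -(n : ℤ) = i),
      resCochainEquiv φ S hi x ∈ Finsupp.supported k k (singularSimplices (p := p) S n) := by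
  rw [singularSub, Submodule.mem_iInf]
  exact forall_congr' fun n => Submodule.mem_iInf _

lemma mem_singularSub_iff {S : Subgroup G} {i : ℤ} {x : ((resCochain φ S).X i).V} {n : ℕ}
    (hi : -(n : ℤ) = i) : x ∈ singularSub φ S i ↔
      resCochainEquiv φ S hi x ∈ Finsupp.supported k k (singularSimplices (p := p) S n) := by
  rw [mem_singularSub]
  refine ⟨fun h => h n hi, fun h m hm => ?_⟩
  obtain rfl : n = m := by omega
  exact h

lemma singularSimplices_conj {S : Subgroup G} {n : ℕ} {s : Chain p G n}
    (hs : s ∈ singularSimplices S n) {g : G} (hg : g ∈ S) : s.conj g ∈ singularSimplices S n := by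
  obtain ⟨x, hx, hx1, hxs⟩ := hs
  refine ⟨g * x * g⁻¹, S.mul_mem (S.mul_mem hg hx) (S.inv_mem hg), ?_, ?_⟩
  · intro h
    exact hx1 (by simpa using h)
  · rw [← Chain.conj_mul, inv_mul_cancel_right, Chain.conj_mul, hxs]

lemma singularSimplices_face {S : Subgroup G} {n : ℕ} {s : Chain p G (n + 1)}
    (hs : s ∈ singularSimplices S (n + 1)) (i : Fin (n + 2)) : s.face i ∈ singularSimplices S n := by
  obtain ⟨x, hx, hx1, hxs⟩ := hs
  exact ⟨x, hx, hx1, congrArg (Chain.face i) hxs⟩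

lemma singularSub_rho (S : Subgroup G) (i : ℤ) (g : S) :
    singularSub φ S i ≤ (singularSub φ S i).comap (((resCochain φ S).X i).ρ g) := by
  intro x hx
  refine (mem_singularSub φ).2 (fun n hi => ?_)
  have hx' := (mem_singularSub φ).1 hx n hi
  rw [resCochainEquiv_rho]
  refine linearCombination_mem_supported (fun s hs => ?_) hx'
  exact Finsupp.single_mem_supported k _ (singularSimplices_conj hs g.2)

lemma singularSub_d (S : Subgroup G) (i j : ℤ) (x : ((resCochain φ S).X i).V)
    (hx : x ∈ singularSub φ S i) : ((resCochain φ S).d i j).hom x ∈ singularSub φ S j := by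
  refine (mem_singularSub φ).2 (fun n hj => ?_)
  by_cases hij : i + 1 = j
  · have hi : -((n + 1 : ℕ) : ℤ) = i := by omega
    have hx' := (mem_singularSub φ).1 hx (n + 1) hi
    rw [resCochainEquiv_d φ S hi hj]
    exact diffLin_mem_supported φ (fun s hs => singularSimplices_face hs) hx'
  · rw [HomologicalComplex.shape _ i j hij]
    have : (0 : (resCochain φ S).X i ⟶ (resCochain φ S).X j).hom x = 0 := rfl
    rw [this, map_zero]
    exact Submodule.zero_mem _

/-- The quotient of the restricted twisted Steinberg complex by the simplices with non-trivial
stabilizer. -/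
abbrev freeQuotient (S : Subgroup G) : CochainComplex (Rep.{u} k S) ℤ :=
  quotientComplex (resCochain φ S) (singularSub φ S) (singularSub_rho φ S) (singularSub_d φ S)

variable [Finite G]

open scoped Classical in
/-- The projection to the span of a set of basis elements. -/
def projOn {α : Type u} (R : Set α) : (α →₀ k) →ₗ[k] (α →₀ k) :=
  Finsupp.linearCombination k (fun s => if s ∈ R then Finsupp.single s 1 else 0)

open scoped Classical in
lemma projOn_single {α : Type u} (R : Set α) (s : α) (a : k) :
    projOn R (Finsupp.single s a) = if s ∈ R then Finsupp.single s a else 0 := by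
  rw [projOn, Finsupp.linearCombination_single]
  split_ifs <;> simp

omit [Finite G] in
-- Take `R` to be a set of orbit representatives; outside the singular simplices the stabilizers in
-- `S` are trivial, which gives uniqueness.
lemma exists_free_section (S : Subgroup G) (n : ℕ) : ∃ R : Set (Chain p G n),
    ∀ s ∉ singularSimplices S n, ∃! g : S, s.conj g.1 ∈ R := by
  let r : Setoid (Chain p G n) :=
    { r := fun s t => ∃ g ∈ S, s.conj g = t
      iseqv := ⟨fun s => ⟨1, S.one_mem, Chain.conj_one s⟩, by
        rintro s _ ⟨g, hg, rfl⟩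
        exact ⟨g⁻¹, S.inv_mem hg, by rw [← Chain.conj_mul, inv_mul_cancel, Chain.conj_one]⟩, by
        rintro s _ _ ⟨g, hg, rfl⟩ ⟨h, hh, rfl⟩
        exact ⟨h * g, S.mul_mem hh hg, Chain.conj_mul _ _ _⟩⟩ }
  refine ⟨{s | (Quotient.mk r s).out = s}, fun s hs => ?_⟩
  have hmk : ∀ g : S, Quotient.mk r (s.conj g.1) = Quotient.mk r s := fun g =>
    (Quotient.sound (s := r) ⟨g.1, g.2, rfl⟩).symm
  obtain ⟨g, hg, hgs⟩ := (Quotient.exact (Quotient.out_eq (Quotient.mk r s)).symm : _)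
  refine ⟨⟨g, hg⟩, ?_, ?_⟩
  · change (Quotient.mk r (s.conj g)).out = s.conj g
    rw [hmk ⟨g, hg⟩, ← hgs]
  · intro g' hg'
    have h1 : s.conj g'.1 = s.conj g := by
      rw [hgs, ← hmk g']; exact hg'.symm
    by_contra hne
    refine hs ⟨g⁻¹ * g'.1, S.mul_mem (S.inv_mem hg) g'.2, ?_, ?_⟩
    · intro h
      exact hne (Subtype.ext (inv_mul_eq_one.1 h).symm)
    · rw [Chain.conj_mul, h1, ← Chain.conj_mul, inv_mul_cancel, Chain.conj_one]

omit [Finite G] in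
-- On a simplex with trivial stabilizer exactly one conjugate of the projection onto representatives
-- is non-zero, and there it is the identity. The coefficients of the twisting cancel under
-- conjugation.
lemma trace_projOn_sub_mem (S : Subgroup G) [Fintype S] {n : ℕ} {R : Set (Chain p G n)}
    (hR : ∀ s ∉ singularSimplices S n, ∃! g : S, s.conj g.1 ∈ R) (y : Chain p G n →₀ k) :
    ∑ g : S, steinbergRho φ n g.1 (projOn R (steinbergRho φ n g.1⁻¹ y)) - y ∈
      Finsupp.supported k k (singularSimplices (p := p) S n) := by
  classical
  let f : (Chain p G n →₀ k) →ₗ[k] (Chain p G n →₀ k) :=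
    ∑ g : S, steinbergRho φ n g.1 ∘ₗ projOn R ∘ₗ steinbergRho φ n g.1⁻¹ - LinearMap.id
  have hf : ∀ y, f y =
      ∑ g : S, steinbergRho φ n g.1 (projOn R (steinbergRho φ n g.1⁻¹ y)) - y := fun y => by
    simp [f]
  rw [← hf]
  refine map_mem_of_supported (U := Set.univ) (fun s _ => ?_) (by simp)
  rw [hf]
  have h1 : ∀ g : S, steinbergRho φ n g.1 (projOn R (steinbergRho φ n g.1⁻¹
      (Finsupp.single s 1))) = if s.conj g.1⁻¹ ∈ R then Finsupp.single s 1 else 0 := fun g => by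
    have h2 : steinbergRho φ n g.1 (steinbergRho φ n g.1⁻¹ (Finsupp.single s 1)) =
        Finsupp.single s 1 := Representation.self_inv_apply _ _ _
    rw [steinbergRho_single, projOn_single]
    split_ifs
    · rw [← steinbergRho_single, h2]
    · rw [map_zero]
  rw [Finset.sum_congr rfl (fun g _ => h1 g)]
  by_cases hs : s ∈ singularSimplices S n
  · refine Submodule.sub_mem _ (Submodule.sum_mem _ fun g _ => ?_)
      (Finsupp.single_mem_supported k _ hs)
    split_ifs
    · exact Finsupp.single_mem_supported k _ hs
    · exact Submodule.zero_mem _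
  · obtain ⟨g, hg, hg'⟩ := hR s hs
    rw [Finset.sum_eq_single g⁻¹, if_pos, sub_self]
    · exact Submodule.zero_mem _
    · simpa using hg
    · intro b _ hb
      rw [if_neg]
      intro hbR
      have := hg' b⁻¹ (by simpa using hbR)
      exact hb (by rw [← this, inv_inv])
    · intro h
      exact absurd (Finset.mem_univ _) h

/-- The surviving simplices are permuted freely up to scalars: modulo singular simplices, the
projection onto orbit representatives has trace the identity, which is the criterion
`projective_of_trace`. -/
lemma projective_freeQuotient (S : Subgroup G) (i : ℤ) : Projective ((freeQuotient φ S).X i) := by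
  by_cases hi : ∃ n : ℕ, -(n : ℤ) = i
  · obtain ⟨n, hi⟩ := hi
    let _ := Fintype.ofFinite S
    obtain ⟨R, hR⟩ := exists_free_section (p := p) S n
    let e := resCochainEquiv φ S hi
    let θ : ((resCochain φ S).X i).V →ₗ[k] ((resCochain φ S).X i).V :=
      e.symm.toLinearMap ∘ₗ projOn R ∘ₗ e.toLinearMap
    have hθe : ∀ x, e (θ x) = projOn R (e x) := fun x => e.apply_symm_apply _
    have hθ : singularSub φ S i ≤ (singularSub φ S i).comap θ := by
      intro x hx
      refine (mem_singularSub_iff φ hi).2 ?_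
      refine (congrArg (· ∈ Finsupp.supported k k (singularSimplices (p := p) S n)) (hθe x)).mpr ?_
      refine linearCombination_mem_supported (fun s hs => ?_) ((mem_singularSub_iff φ hi).1 hx)
      split_ifs
      · exact Finsupp.single_mem_supported k _ hs
      · exact Submodule.zero_mem _
    refine projective_of_trace ((freeQuotient φ S).X i) (Submodule.mapQ _ _ θ hθ) (fun m => ?_)
    obtain ⟨x, rfl⟩ := Submodule.Quotient.mk_surjective _ m
    have h2 : ∑ g : S, ((resCochain φ S).X i).ρ g
        (θ (((resCochain φ S).X i).ρ g⁻¹ x)) - x ∈ singularSub φ S i := by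
      refine (mem_singularSub_iff φ hi).2 ?_
      have h3 := trace_projOn_sub_mem φ S hR (e x)
      have h4 : e (∑ g : S, ((resCochain φ S).X i).ρ g
        (θ (((resCochain φ S).X i).ρ g⁻¹ x)) - x) =
          ∑ g : S, steinbergRho φ n g.1 (projOn R (steinbergRho φ n g.1⁻¹ (e x))) - e x := by
        rw [map_sub, map_sum]
        congr 1
        refine Finset.sum_congr rfl (fun g _ => ?_)
        exact (resCochainEquiv_rho φ S hi g _).trans (congrArg (steinbergRho φ n g.1)
          ((hθe _).trans (congrArg (projOn R) (resCochainEquiv_rho φ S hi g⁻¹ x))))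
      exact (congrArg (· ∈ Finsupp.supported k k (singularSimplices (p := p) S n)) h4).mpr h3
    have h5 := (Submodule.Quotient.eq (singularSub φ S i)).2 h2
    refine (traceEnd_apply ((freeQuotient φ S).X i) (Submodule.mapQ _ _ θ hθ)
      (Submodule.Quotient.mk x)).trans (Eq.trans ?_ h5)
    exact (map_sum (Submodule.mkQ (singularSub φ S i)) _ _).symm
  · push Not at hi
    have := subsingleton_resCochain φ S hi
    have h : Subsingleton ((freeQuotient φ S).X i).V :=
      (Submodule.mkQ_surjective (singularSub φ S i)).subsingleton
    have : IsZero ((freeQuotient φ S).X i) := (Rep.isZero_iff k S _).2 h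
    exact this.projective

lemma finProjDim_freeQuotient (S : Subgroup G) :
    finProjDim (Rep.{u} k S) (Q.obj (freeQuotient φ S)) := by
  obtain ⟨a, b, ha, hb⟩ := (isBoundedFG_steinberg φ).bounded
  have hz : ∀ i, IsZero ((steinbergCochain φ).X i) → IsZero ((freeQuotient φ S).X i) := by
    intro i hi
    have : Subsingleton ((resCochain φ S).X i).V := (Rep.isZero_iff k G _).1 hi
    exact (Rep.isZero_iff k S _).2 (Submodule.mkQ_surjective (singularSub φ S i)).subsingleton
  have : (freeQuotient φ S).IsStrictlyGE a := (CochainComplex.isStrictlyGE_iff _ _).2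
    (fun i hi => hz i ((steinbergCochain φ).isZero_of_isStrictlyGE a i hi))
  have : (freeQuotient φ S).IsStrictlyLE b := (CochainComplex.isStrictlyLE_iff _ _).2
    (fun i hi => hz i ((steinbergCochain φ).isZero_of_isStrictlyLE b i hi))
  exact finProjDim_of_projective (a := a) (b := b) _ (projective_freeQuotient φ S)

omit [Finite G] in
lemma resCochain_d_zero (S : Subgroup G) (j : ℤ) (hj : 0 < j) (i : ℤ) :
    (resCochain φ S).d i j = 0 := by
  have := subsingleton_resCochain φ S (i := j) (fun n => by omega)
  exact ((Rep.isZero_iff k S _).2 this).eq_of_tgt _ _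

/-- The morphism from the trivial module to the restricted twisted Steinberg complex given by the
vertex `S`. -/
def baseMap (S : PSub p G) :
    (CochainComplex.singleFunctor (Rep.{u} k S.1) 0).obj (Rep.trivial k S.1 k) ⟶
      resCochain φ S.1 :=
  HomologicalComplex.mkHomFromSingle
    (trivialHom ((resCochain φ S.1).X 0) ((resCochainEquiv φ S.1 (n := 0) (i := 0)
      (by simp)).symm (Finsupp.single (Chain.vertex S) 1)) (fun g => by
        refine (resCochainEquiv φ S.1 (n := 0) (i := 0) (by simp)).injective ?_
        rw [resCochainEquiv_rho, LinearEquiv.apply_symm_apply, steinbergRho_vertex φ g.2]))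
    (fun j hj => by
      have hj' : (0 : ℤ) + 1 = j := hj
      rw [resCochain_d_zero φ S.1 j (by omega), comp_zero])

/-- The degree zero term of a complex concentrated in degree zero, as a vector space. -/
def singleEquiv (M : Rep.{u} k G) :
    (((CochainComplex.singleFunctor (Rep.{u} k G) 0).obj M).X 0).V ≃ₗ[k] M.V :=
  (Representation.equivOfIso
    (HomologicalComplex.singleObjXSelf (ComplexShape.up ℤ) 0 M)).toLinearEquiv

omit [Finite G] in
lemma subsingleton_single (M : Rep.{u} k G) {i : ℤ} (hi : i ≠ 0) :
    Subsingleton (((CochainComplex.singleFunctor (Rep.{u} k G) 0).obj M).X i).V :=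
  (Rep.isZero_iff k G _).1
    (HomologicalComplex.isZero_single_obj_X (ComplexShape.up ℤ) 0 M i hi)

omit [Finite G] in
lemma baseMap_apply (S : PSub p G)
    (b : (((CochainComplex.singleFunctor (Rep.{u} k S.1) 0).obj (Rep.trivial k S.1 k)).X 0).V) :
    resCochainEquiv φ S.1 (n := 0) (by simp) (((baseMap φ S).f 0).hom b) =
      Finsupp.single (Chain.vertex S) (singleEquiv _ b : k) := by
  rw [baseMap, HomologicalComplex.mkHomFromSingle_f]
  refine (congrArg (resCochainEquiv φ S.1 (n := 0) (i := 0) (by simp))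
    ((Rep.comp_apply _ _ b).trans (trivialHom_apply _ _ _ (singleEquiv _ b)))).trans ?_
  rw [map_smul, LinearEquiv.apply_symm_apply, Finsupp.smul_single, smul_eq_mul, mul_one]

instance (S : PSub p G) : Mono (baseMap φ S) := by
  have : ∀ i, Mono ((baseMap φ S).f i) := fun i => by
    rw [Rep.mono_iff_injective]
    by_cases hi : i = 0
    · subst hi
      intro b b' h
      have h1 := congrArg (resCochainEquiv φ S.1 (n := 0) (by simp)) h
      refine (singleEquiv (Rep.trivial k S.1 k)).injective ?_
      exact Finsupp.single_injective _
        ((baseMap_apply φ S b).symm.trans (h1.trans (baseMap_apply φ S b')))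
    · have := subsingleton_single (Rep.trivial k S.1 k) hi
      exact Function.injective_of_subsingleton _
  exact HomologicalComplex.mono_of_mono_f _ this

/-- The singular simplices are acyclic relative to the vertex `S`, so the cone of the base map is
the quotient by them, a bounded complex of projectives. -/
theorem trW_baseMap [Fact p.Prime] (S : PSub p G) :
    (finProjDim (Rep.{u} k S.1)).trW (Q.map (baseMap φ S)) := by
  have hac := isAcyclicAt_singularSimplices φ S
  have hmk : ∀ (i : ℤ) (x : ((resCochain φ S.1).X i).V),
      ((quotientComplexMk (resCochain φ S.1) (singularSub φ S.1) (singularSub_rho φ S.1)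
        (singularSub_d φ S.1)).f i).hom x = 0 ↔ x ∈ singularSub φ S.1 i := fun i x =>
    Submodule.Quotient.mk_eq_zero _
  have hvert : Chain.vertex S ∈ singularSimplices S.1 0 := by
    obtain ⟨⟨x, hx⟩, hx1⟩ := Subgroup.ne_bot_iff_exists_ne_one.1 S.2.2
    exact ⟨x, hx, fun h => hx1 (Subtype.ext h), Subtype.ext (funext fun _ => conjSub_of_mem hx)⟩
  refine trW_of_relative_acyclic (baseMap φ S) (quotientComplexMk (resCochain φ S.1)
    (singularSub φ S.1) (singularSub_rho φ S.1) (singularSub_d φ S.1)) ?_ _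
    (finProjDim_freeQuotient φ S.1) (fun i x hx hdx => ?_)
  · ext i : 1
    by_cases hi : i = 0
    · subst hi
      refine Rep.hom_ext (Representation.IntertwiningMap.ext (LinearMap.ext fun b => ?_))
      refine (hmk 0 (((baseMap φ S).f 0).hom b)).2 ?_
      refine (mem_singularSub_iff φ (n := 0) (by simp)).2 ?_
      rw [baseMap_apply]
      exact Finsupp.single_mem_supported k _ hvert
    · exact (HomologicalComplex.isZero_single_obj_X (ComplexShape.up ℤ) 0 _ i hi).eq_of_src _ _
  · rw [hmk] at hx
    simp only [hmk]
    by_cases hi : ∃ n : ℕ, -(n : ℤ) = i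
    · obtain ⟨n, hi⟩ := hi
      have hi' : -((n + 1 : ℕ) : ℤ) = i - 1 := by push_cast; omega
      have hx' := (mem_singularSub_iff φ hi).1 hx
      have lift : ∀ y ∈ Finsupp.supported k k (singularSimplices (p := p) S.1 (n + 1)),
          ∃ z ∈ singularSub φ S.1 (i - 1), resCochainEquiv φ S.1 hi
            (((resCochain φ S.1).d (i - 1) i).hom z) = diffLin φ n y := by
        intro y hy
        refine ⟨(resCochainEquiv φ S.1 hi').symm y, (mem_singularSub_iff φ hi').2 ?_, ?_⟩
        · rwa [LinearEquiv.apply_symm_apply]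
        · rw [resCochainEquiv_d φ S.1 hi' hi, LinearEquiv.apply_symm_apply]
      -- The three cases match the fields of `IsAcyclicAt`: the trivial module meets degree `0` and
      -- receives boundaries from degree `1`, but plays no role further up.
      match n with
      | 0 =>
        obtain rfl : i = 0 := by simpa using hi.symm
        obtain ⟨y, hy, a, ha⟩ := hac.zero _ hx'
        obtain ⟨z, hz, hz'⟩ := lift y hy
        refine ⟨z, (singleEquiv (Rep.trivial k S.1 k)).symm a, hz, ?_⟩
        refine (resCochainEquiv φ S.1 hi).injective ?_
        rw [map_add, hz', baseMap_apply, LinearEquiv.apply_symm_apply]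
        exact ha
      | 1 =>
        obtain ⟨b, hb⟩ := hdx
        obtain rfl : i = -1 := by simpa using hi.symm
        have h1 := congrArg (resCochainEquiv φ S.1 (n := 0) (i := 0) (by simp)) hb
        obtain ⟨y, hy, hxy⟩ := hac.one _ hx' _ ((resCochainEquiv_d φ S.1 hi (by simp) x).symm.trans
          (h1.trans (baseMap_apply φ S b)))
        obtain ⟨z, hz, hz'⟩ := lift y hy
        refine ⟨z, 0, hz, (resCochainEquiv φ S.1 hi).injective ?_⟩
        rw [map_zero, add_zero, hz']
        exact hxy
      | n + 2 =>
        obtain ⟨b, hb⟩ := hdx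
        have := subsingleton_single (Rep.trivial k S.1 k) (i := i + 1) (by push_cast at hi; omega)
        rw [Subsingleton.elim b 0, map_zero] at hb
        have hi1 : -((n + 1 : ℕ) : ℤ) = i + 1 := by push_cast at hi ⊢; omega
        have h1 := congrArg (resCochainEquiv φ S.1 hi1) hb
        rw [resCochainEquiv_d φ S.1 hi hi1, map_zero] at h1
        obtain ⟨y, hy, hxy⟩ := hac.succ _ _ hx' h1
        obtain ⟨z, hz, hz'⟩ := lift y hy
        refine ⟨z, 0, hz, (resCochainEquiv φ S.1 hi).injective ?_⟩
        rw [map_zero, add_zero, hz']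
        exact hxy
    · push Not at hi
      have := subsingleton_resCochain φ S.1 hi
      exact ⟨0, 0, Submodule.zero_mem _, Subsingleton.elim _ _⟩

end RestrictedComplex

/-! ### Traces, self-injectivity and maps factoring through projectives. -/

section RepAlgebra

variable {k G : Type u} [Field k] [Group G] [Finite G]

omit [Finite G] in
lemma sum_rho_rho [Fintype G] (M N : Rep.{u} k G) (θ : M.V →ₗ[k] N.V) (a : G) (m : M.V) :
    ∑ g : G, N.ρ g (θ (M.ρ g⁻¹ (M.ρ a m))) = N.ρ a (∑ g : G, N.ρ g (θ (M.ρ g⁻¹ m))) := by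
  rw [map_sum]
  symm
  refine Fintype.sum_equiv (Equiv.mulLeft a) _ _ (fun g => ?_)
  simp only [Equiv.coe_mulLeft, mul_inv_rev, map_mul, Module.End.mul_apply]
  rw [Representation.inv_self_apply]

/-- The trace of a linear map between representations. -/
def traceHom [Fintype G] (M N : Rep.{u} k G) (θ : M.V →ₗ[k] N.V) : M ⟶ N :=
  Rep.ofHom ⟨∑ g : G, N.ρ g ∘ₗ θ ∘ₗ M.ρ g⁻¹, fun a => LinearMap.ext fun m => by
    simpa only [LinearMap.comp_apply, LinearMap.sum_apply] using sum_rho_rho M N θ a m⟩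

omit [Finite G] in
lemma traceHom_apply [Fintype G] (M N : Rep.{u} k G) (θ : M.V →ₗ[k] N.V) (m : M.V) :
    (traceHom M N θ).hom m = ∑ g : G, N.ρ g (θ (M.ρ g⁻¹ m)) := by
  change (∑ g : G, N.ρ g ∘ₗ θ ∘ₗ M.ρ g⁻¹ : M.V →ₗ[k] N.V) m = _
  simp only [LinearMap.comp_apply, LinearMap.sum_apply]

/-- A linear retraction of the monomorphism, composed with `g` and with an endomorphism `θ` of trace
one, becomes an equivariant extension after taking the trace. -/
lemma injective_of_projective (P : Rep.{u} k G) (hP : Projective P) : Injective P where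
  factors {X Y} g f hf := by
    let _ := Fintype.ofFinite G
    rw [Rep.mono_iff_injective] at hf
    obtain ⟨θ, hθ⟩ := exists_trace P
    obtain ⟨r, hr⟩ := LinearMap.exists_leftInverse_of_injective f.hom.toLinearMap
      (LinearMap.ker_eq_bot.2 hf)
    have hr' : ∀ x, r (f.hom x) = x := fun x => LinearMap.congr_fun hr x
    refine ⟨traceHom Y P (θ ∘ₗ g.hom.toLinearMap ∘ₗ r), ?_⟩
    refine Rep.hom_ext (Representation.IntertwiningMap.ext (LinearMap.ext fun m => ?_))
    refine (traceHom_apply Y P _ (f.hom m)).trans ?_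
    change _ = g.hom m
    conv_rhs => rw [← hθ (g.hom m), traceEnd_apply]
    refine Finset.sum_congr rfl (fun a _ => ?_)
    rw [← Rep.hom_comm_apply f, ← Rep.hom_comm_apply g]
    exact congrArg (fun t => P.ρ a (θ (g.hom t))) (hr' _)

/-- One direction of Higman's criterion: the identity of the intermediate projective is a trace, and
a trace composed with equivariant maps is a trace. -/
lemma FactorsThroughProjective.exists_trace [Fintype G] {M N : Rep.{u} k G} {f : M ⟶ N}
    (hf : FactorsThroughProjective f) :
    ∃ θ : M.V →ₗ[k] N.V, ∀ m, f.hom m = ∑ g : G, N.ρ g (θ (M.ρ g⁻¹ m)) := by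
  obtain ⟨P, hP, a, b, rfl⟩ := hf
  obtain ⟨θ, hθ⟩ := SylowTriv.exists_trace P
  refine ⟨b.hom.toLinearMap ∘ₗ θ ∘ₗ a.hom.toLinearMap, fun m => ?_⟩
  refine (Rep.comp_apply a b m).trans ?_
  rw [← hθ (a.hom m), traceEnd_apply]
  refine (map_sum b.hom _ _).trans (Finset.sum_congr rfl (fun g _ => ?_))
  rw [Rep.hom_comm_apply b, ← Rep.hom_comm_apply a]
  rfl

/-- The value of the trace of a linear map at a `P`-invariant element is a `P`-norm. -/
lemma sum_mem_range_normMap [Fintype G] {M N : Rep.{u} k G} (θ : M.V →ₗ[k] N.V) (P : Subgroup G)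
    {m : M.V} (hm : m ∈ invariantsOf M P) :
    ∑ g : G, N.ρ g (θ (M.ρ g⁻¹ m)) ∈ LinearMap.range (normMap N P) := by
  classical
  let _ := Fintype.ofFinite P
  let _ := Fintype.ofFinite (G ⧸ P)
  refine ⟨∑ q : G ⧸ P, N.ρ q.out⁻¹ (θ (M.ρ q.out m)), ?_⟩
  -- After inverting the summation variable, `θ (g m)` depends only on the coset `gP`, and the sum
  -- over each coset is a norm.
  have h1 : ∑ g : G, N.ρ g (θ (M.ρ g⁻¹ m)) = ∑ g : G, N.ρ g⁻¹ (θ (M.ρ g m)) :=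
    (Fintype.sum_equiv (Equiv.inv G) _ _ (fun g => by simp))
  rw [h1, sum_eq_sum_quotient P, Finset.sum_comm]
  simp only [normMap, LinearMap.sum_apply]
  refine Fintype.sum_equiv (Equiv.inv P) _ _ (fun r => ?_)
  rw [map_sum]
  refine Finset.sum_congr rfl (fun q _ => ?_)
  have h2 : M.ρ (q.out * (r⁻¹ : P).1) m = M.ρ q.out m := by
    rw [map_mul, Module.End.mul_apply, mem_invariantsOf.1 hm _ (r⁻¹).2]
  rw [Equiv.inv_apply, h2, mul_inv_rev, map_mul]
  simp

end RepAlgebra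

/-! ### Permutation modules `k[G/P]` as representing objects for `P`-invariants. -/

section Permutation

variable {k G : Type u} [Field k] [Group G]

/-- The permutation representation on `k[G/P]`. -/
def permRho (k : Type u) [Field k] (P : Subgroup G) : Representation k G ((G ⧸ P) →₀ k) where
  toFun g := Finsupp.lmapDomain k k (fun x => g • x)
  map_one' := by ext; simp
  map_mul' g h := by
    refine Finsupp.lhom_ext' (fun x => LinearMap.ext_ring ?_)
    simp [mul_smul]

lemma permRho_single (P : Subgroup G) (g : G) (x : G ⧸ P) (a : k) :
    permRho k P g (Finsupp.single x a) = Finsupp.single (g • x) a := by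
  simp [permRho]

/-- The permutation module `k[G/P]`. -/
abbrev permRep (k : Type u) [Field k] (P : Subgroup G) : Rep.{u} k G := Rep.of (permRho k P)

/-- The morphism `k[G/P] ⟶ M` given by a `P`-invariant element of `M`. -/
def permHom {P : Subgroup G} (M : Rep.{u} k G) {m : M.V} (hm : m ∈ invariantsOf M P) :
    permRep k P ⟶ M :=
  Rep.ofHom ⟨Finsupp.linearCombination k (Quotient.lift (fun g : G => M.ρ g m) (by
    intro a b hab
    have hab' : a⁻¹ * b ∈ P := QuotientGroup.leftRel_apply.1 hab
    have h := mem_invariantsOf.1 hm _ hab'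
    change M.ρ a m = M.ρ b m
    conv_lhs => rw [← h]
    simp [← Module.End.mul_apply, ← map_mul])), fun g => by
    refine Finsupp.lhom_ext' (fun x => LinearMap.ext_ring ?_)
    induction x using QuotientGroup.induction_on with
    | H x =>
      simp only [LinearMap.comp_apply, Finsupp.lsingle_apply, Finsupp.linearCombination_single,
        one_smul, permRho_single]
      change M.ρ (g * x) m = M.ρ g (M.ρ x m)
      rw [map_mul]; rfl⟩

lemma permHom_single {P : Subgroup G} (M : Rep.{u} k G) {m : M.V} (hm : m ∈ invariantsOf M P)
    (g : G) : (permHom M hm).hom (Finsupp.single (g : G ⧸ P) 1 : (G ⧸ P) →₀ k) = M.ρ g m := by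
  change Finsupp.linearCombination k _ (Finsupp.single (g : G ⧸ P) 1) = _
  rw [Finsupp.linearCombination_single, one_smul]
  rfl

/-- The canonical generator of `k[G/P]`. -/
def permGen (k : Type u) [Field k] (P : Subgroup G) : (permRep k P).V :=
  (Finsupp.single ((1 : G) : G ⧸ P) 1 : (G ⧸ P) →₀ k)

lemma rho_permGen (P : Subgroup G) (g : G) :
    (permRep k P).ρ g (permGen k P) = (Finsupp.single (g : G ⧸ P) 1 : (G ⧸ P) →₀ k) := by
  refine (permRho_single _ _ _ _).trans ?_
  exact congrArg (fun y : G => (Finsupp.single (y : G ⧸ P) 1 : (G ⧸ P) →₀ k)) (mul_one g)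

lemma permGen_mem (P : Subgroup G) : permGen k P ∈ invariantsOf (permRep k P) P := by
  rw [mem_invariantsOf]
  intro x hx
  rw [rho_permGen]
  have : (x : G ⧸ P) = ((1 : G) : G ⧸ P) := by rw [QuotientGroup.eq]; simpa using hx
  rw [this]
  rfl

lemma permHom_permGen {P : Subgroup G} (M : Rep.{u} k G) {m : M.V} (hm : m ∈ invariantsOf M P) :
    (permHom M hm).hom (permGen k P) = m := by
  refine (permHom_single M hm 1).trans ?_
  rw [map_one]; rfl

lemma hom_mem_invariantsOf {P : Subgroup G} {M N : Rep.{u} k G} (f : M ⟶ N) {m : M.V}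
    (hm : m ∈ invariantsOf M P) : f.hom m ∈ invariantsOf N P := by
  rw [mem_invariantsOf] at hm ⊢
  intro x hx
  rw [← Rep.hom_comm_apply, hm x hx]

lemma permRep_hom_ext {P : Subgroup G} {M : Rep.{u} k G} {f g : permRep k P ⟶ M}
    (h : f.hom (permGen k P) = g.hom (permGen k P)) : f = g := by
  refine Rep.hom_ext (Representation.IntertwiningMap.ext (Finsupp.lhom_ext' fun x =>
    LinearMap.ext_ring ?_))
  induction x using QuotientGroup.induction_on with
  | H x =>
    have h1 := Rep.hom_comm_apply f x (permGen k P)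
    have h2 := Rep.hom_comm_apply g x (permGen k P)
    rw [rho_permGen] at h1 h2
    exact h1.trans ((congrArg (M.ρ x) h).trans h2.symm)

end Permutation

/-! ### Invariant elements of complexes as derived morphisms from `k[G/P]`. -/

section SingleMaps

open DerivedCategory

variable {k G : Type u} [Field k] [Group G]

/-- The degree zero term of a complex concentrated in degree zero. -/
def singleX (A : Rep.{u} k G) : ((CochainComplex.singleFunctor (Rep.{u} k G) 0).obj A).X 0 ≅ A :=
  HomologicalComplex.singleObjXSelf (ComplexShape.up ℤ) 0 A

lemma single_map_f {A B : Rep.{u} k G} (f : A ⟶ B) :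
    ((CochainComplex.singleFunctor (Rep.{u} k G) 0).map f).f 0 =
      (singleX A).hom ≫ f ≫ (singleX B).inv :=
  HomologicalComplex.single_map_f_self _ _ _

/-- The morphism from `k[G/P]`, placed in degree zero, to a complex with vanishing terms in
positive degrees given by a `P`-invariant element. -/
def singlePermHom {P : Subgroup G} (K : CochainComplex (Rep.{u} k G) ℤ) [K.IsStrictlyLE 0]
    {x : (K.X 0).V} (hx : x ∈ invariantsOf (K.X 0) P) :
    (CochainComplex.singleFunctor (Rep.{u} k G) 0).obj (permRep k P) ⟶ K :=
  HomologicalComplex.mkHomFromSingle (permHom _ hx) (fun j hj => by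
    have hj' : (0 : ℤ) + 1 = j := hj
    exact (K.isZero_of_isStrictlyLE 0 j (by omega)).eq_of_tgt _ _)

lemma singlePermHom_f {P : Subgroup G} (K : CochainComplex (Rep.{u} k G) ℤ) [K.IsStrictlyLE 0]
    {x : (K.X 0).V} (hx : x ∈ invariantsOf (K.X 0) P) : (singlePermHom K hx).f 0 =
      (singleX (permRep k P)).hom ≫ permHom _ hx :=
  HomologicalComplex.mkHomFromSingle_f _ _

lemma single_map_singlePermHom {P Q : Subgroup G} (K : CochainComplex (Rep.{u} k G) ℤ)
    [K.IsStrictlyLE 0] {x : (K.X 0).V} (hx : x ∈ invariantsOf (K.X 0) Q)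
    (f : permRep k P ⟶ permRep k Q) {y : (K.X 0).V} (hy : y ∈ invariantsOf (K.X 0) P)
    (h : (permHom _ hx).hom (f.hom (permGen k P)) = y) :
    (CochainComplex.singleFunctor (Rep.{u} k G) 0).map f ≫ singlePermHom K hx =
      singlePermHom K hy := by
  refine HomologicalComplex.from_single_hom_ext ?_
  have h1 : f ≫ permHom _ hx = permHom _ hy := by
    refine permRep_hom_ext ?_
    rw [permHom_permGen, ← h]
    rfl
  rw [HomologicalComplex.comp_f, singlePermHom_f, singlePermHom_f, single_map_f, ← h1]
  simp only [Category.assoc, Iso.inv_hom_id_assoc]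
  rfl

/-- Homologous invariant elements define the same morphism in the derived category. -/
lemma Q_map_singlePermHom_eq {P : Subgroup G} (K : CochainComplex (Rep.{u} k G) ℤ)
    [K.IsStrictlyLE 0] {x x' : (K.X 0).V} (hx : x ∈ invariantsOf (K.X 0) P)
    (hx' : x' ∈ invariantsOf (K.X 0) P) (y : (K.X (-1)).V) (hy : y ∈ invariantsOf (K.X (-1)) P)
    (h : x - x' = (K.d (-1) 0).hom y) :
    Q.map (singlePermHom K hx) = Q.map (singlePermHom K hx') := by
  rw [← sub_eq_zero, ← Functor.map_sub]
  let A := permRep k P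
  have hrel : (ComplexShape.up ℤ).Rel (-1) 0 := show (-1 : ℤ) + 1 = 0 by norm_num
  -- The difference of the two morphisms factors through the acyclic complex with identity
  -- differential on `k[G/P]` in degrees `-1` and `0`; the invariant element `y` gives the map out
  -- of its degree `-1` term.
  let i : (CochainComplex.singleFunctor (Rep.{u} k G) 0).obj A ⟶
      HomologicalComplex.double (𝟙 A) hrel :=
    HomologicalComplex.mkHomFromSingle (HomologicalComplex.doubleXIso₁ (𝟙 A) hrel (by decide)).inv
      (fun j hj => by
        have hj' : (0 : ℤ) + 1 = j := hj
        exact (HomologicalComplex.isZero_double_X (𝟙 A) hrel j (by omega) (by omega)).eq_of_tgt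
          _ _)
  have hdy : (K.d (-1) 0).hom y ∈ invariantsOf (K.X 0) P := hom_mem_invariantsOf _ hy
  let r : HomologicalComplex.double (𝟙 A) hrel ⟶ K :=
    HomologicalComplex.mkHomFromDouble hrel (by decide) (permHom _ hy) (permHom _ hdy)
      (by
        rw [Category.id_comp]
        refine permRep_hom_ext ?_
        rw [permHom_permGen]
        exact (Rep.comp_apply _ _ _).trans (congrArg _ (permHom_permGen _ hy)))
      (fun j hj => by
        have hj' : (0 : ℤ) + 1 = j := hj
        exact (K.isZero_of_isStrictlyLE 0 j (by omega)).eq_of_tgt _ _)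
  have hir : singlePermHom K hx - singlePermHom K hx' = i ≫ r := by
    refine HomologicalComplex.from_single_hom_ext ?_
    have h1 : permHom _ hx - permHom _ hx' = permHom _ hdy := by
      refine permRep_hom_ext ?_
      rw [permHom_permGen, ← h]
      refine Eq.trans ?_ (congrArg₂ (· - ·) (permHom_permGen _ hx) (permHom_permGen _ hx'))
      rfl
    have hi : i.f 0 = (singleX A).hom ≫ (HomologicalComplex.doubleXIso₁ (𝟙 A) hrel
        (by decide)).inv := HomologicalComplex.mkHomFromSingle_f _ _
    rw [HomologicalComplex.sub_f_apply, HomologicalComplex.comp_f, singlePermHom_f,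
      singlePermHom_f, hi, HomologicalComplex.mkHomFromDouble_f₁, ← Preadditive.comp_sub, h1,
      Category.assoc, Iso.inv_hom_id_assoc]
  rw [hir, Functor.map_comp, (isZero_Q_of_acyclic (acyclic_double_id A hrel)).eq_of_tgt (Q.map i) 0,
    zero_comp]

end SingleMaps

/-! ### Edges of the complex and the cocycle relation. -/

section Edges

open DerivedCategory

variable {p : ℕ} {k G : Type u} [Field k] [Group G] [Finite G] (φ : Z1 (OrbitCat p G) kˣ)

instance : (steinbergCochain φ).IsStrictlyLE 0 := by
  rw [CochainComplex.isStrictlyLE_iff]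
  intro i hi
  exact (Rep.isZero_iff k G _).2 (subsingleton_cochain φ (fun n => by omega))

/-- The vertex `P` as an element of the twisted Steinberg complex. -/
def vertexElt (P : PSub p G) : ((steinbergCochain φ).X 0).V :=
  (cochainEquiv φ (n := 0) (by simp)).symm (Finsupp.single (Chain.vertex P) 1)

omit [Finite G] in
lemma vertexElt_mem (P : PSub p G) :
    vertexElt φ P ∈ invariantsOf ((steinbergCochain φ).X 0) P.1 := by
  rw [mem_invariantsOf]
  intro x hx
  refine (cochainEquiv φ (n := 0) (i := 0) (by simp)).injective ?_
  rw [cochainEquiv_rho, vertexElt, LinearEquiv.apply_symm_apply, steinbergRho_vertex φ hx]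

omit [Finite G] in
-- With `R` the conjugate of `Y` by `g`, the translate by `g` of the vertex `Y` is a multiple of the
-- vertex `R`, which contains `X`. The edge `X < R` compares it with the vertex `X`, the cocycle
-- relation identifies the scalar as `φ f`, and `X` fixes this edge. If `X = R`, no edge is needed.
lemma exists_edge {X Y : OrbitCat p G} (f : X ⟶ Y) {g : G}
    (hg : OrbitCat.toMap f ((1 : G) : G ⧸ X.sub.1) = (g : G ⧸ Y.sub.1)) :
    ∃ y ∈ invariantsOf ((steinbergCochain φ).X (-1)) X.sub.1,
      ((steinbergCochain φ).X 0).ρ g (vertexElt φ Y.sub) - (φ.1 X Y f : k) • vertexElt φ X.sub =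
        ((steinbergCochain φ).d (-1) 0).hom y := by
  let R : PSub p G := SylowTriv.conjSub g Y.sub
  have hXR : X.sub ≤ R := fun x hx => (mem_conjSub_iff g Y.sub x).2 (conj_of_toMap f hg x hx)
  have h1X : SylowTriv.conjSub 1 X.sub ≤ R := by rwa [conjSub_one]
  have hφ : (coeff φ g Y.sub R le_rfl : k) =
      (φ.1 X Y f : k) * (coeff φ 1 X.sub R h1X : k) := by
    -- Following `f` by the isomorphism `G/Y → G/R` gives the canonical projection `G/X → G/R`.
    have e : f ≫ orbitMap g Y.sub R le_rfl = orbitMap 1 X.sub R h1X := by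
      apply OrbitCat.hom_ext
      rw [OrbitCat.toMap_comp, hg]
      refine (toMap_orbitMap g Y.sub R le_rfl g).trans
        (Eq.trans ?_ (toMap_orbitMap 1 X.sub R h1X 1).symm)
      simp
    rw [← Units.val_mul]
    congr 1
    have e' := Z1.map_comp φ f (orbitMap g Y.sub R le_rfl)
    rw [e] at e'
    rw [coeff, coeff]
    have e'' : φ.1 _ _ (orbitMap 1 X.sub R h1X) =
      φ.1 X Y f * φ.1 _ _ (orbitMap g Y.sub R le_rfl) := e'
    rw [e'', mul_inv, mul_inv_cancel_left]
  have hρ : cochainEquiv φ (n := 0) (i := 0) (by simp)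
      (((steinbergCochain φ).X 0).ρ g (vertexElt φ Y.sub)) =
      Finsupp.single (Chain.vertex R) (coeff φ g Y.sub R le_rfl : k) := by
    rw [cochainEquiv_rho, vertexElt, LinearEquiv.apply_symm_apply, steinbergRho_single]
    exact single_congr rfl (one_mul _)
  rcases hXR.lt_or_eq with h | h
  · have hi : -((0 + 1 : ℕ) : ℤ) = -1 := by simp
    let s : Chain p G 1 := Chain.edge h
    refine ⟨(φ.1 X Y f : k) • (cochainEquiv φ hi).symm (Finsupp.single s 1),
      Submodule.smul_mem _ _ ?_, ?_⟩
    · rw [mem_invariantsOf]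
      intro x hx
      refine (cochainEquiv φ hi).injective ?_
      rw [cochainEquiv_rho, LinearEquiv.apply_symm_apply, steinbergRho_single]
      have hs : s.conj x = s := by
        refine Subtype.ext (funext fun i => ?_)
        fin_cases i
        · exact conjSub_of_mem hx
        · exact conjSub_of_mem (hXR hx)
      refine single_congr hs ?_
      have h2 : coeff φ x (s.1 0) ((s.conj x).1 0) (s.le_conj x) =
          coeff φ x X.sub X.sub (conjSub_of_mem hx).le :=
        coeff_congr φ _ rfl rfl (conjSub_of_mem hx)
      rw [h2, coeff, orbitMap_of_mem hx, Z1.map_id, inv_one, Units.val_one, mul_one]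
    · refine (cochainEquiv φ (n := 0) (i := 0) (by simp)).injective ?_
      have e0 : s.face 0 = Chain.vertex R := (Chain.vertex_self _).symm
      have e1 : s.face 1 = Chain.vertex X.sub := (Chain.vertex_self _).symm
      have h0 : Finsupp.single (s.face 0) (1 * coeff φ 1 (s.1 0) ((s.face 0).1 0) (s.le_face 0) : k)
          = Finsupp.single (Chain.vertex R) (coeff φ 1 X.sub R h1X : k) :=
        single_congr e0 (one_mul _)
      have h1 : Finsupp.single (s.face 1) (1 * coeff φ 1 (s.1 0) ((s.face 1).1 0) (s.le_face 1) : k)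
          = Finsupp.single (Chain.vertex X.sub) 1 :=
        single_congr e1 (Eq.trans (congrArg (fun t : kˣ => 1 * (t : k))
          (coeff_one φ X.sub (by rw [conjSub_one]))) (by rw [Units.val_one, mul_one]))
      rw [cochainEquiv_d φ hi, map_smul, LinearEquiv.apply_symm_apply, map_smul, diffLin_single,
        Fin.sum_univ_two, h0, h1, map_sub, hρ, hφ, map_smul, vertexElt,
        LinearEquiv.apply_symm_apply]
      simp [sub_eq_add_neg]
  · refine ⟨0, Submodule.zero_mem _, ?_⟩
    rw [map_zero, sub_eq_zero]
    refine (cochainEquiv φ (n := 0) (i := 0) (by simp)).injective ?_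
    have h1 : (coeff φ 1 X.sub R h1X : k) = 1 := by
      rw [coeff_congr φ h1X rfl rfl h.symm, coeff_one, Units.val_one]
    rw [hρ, map_smul, vertexElt, LinearEquiv.apply_symm_apply, hφ, h1, ← h]
    simp

end Edges

/-! ### Localizations compatible with restriction to `S`. -/

section StableFunctors

open DerivedCategory

variable {k G : Type u} [Field k] [Group G] (S : Subgroup G)

/-- Restriction to a subgroup on derived categories. -/
abbrev resDerived : DerivedCategory (Rep.{u} k G) ⥤ DerivedCategory (Rep.{u} k S) :=
  (Rep.resFunctor.{u} (k := k) S.subtype).mapDerivedCategory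

/-- Objects of finite projective dimension whose restriction to `S` has finite projective
dimension. -/
abbrev finProjDimRes : ObjectProperty (DerivedCategory (Rep.{u} k G)) :=
  finProjDim (Rep.{u} k G) ⊓ (finProjDim (Rep.{u} k S)).inverseImage (resDerived S)

lemma finProjDimRes_of_projective (K : CochainComplex (Rep.{u} k G) ℤ) {a b : ℤ}
    [K.IsStrictlyGE a] [K.IsStrictlyLE b] (hK : ∀ i, Projective (K.X i)) :
    finProjDimRes S (Q.obj K) := by
  refine ⟨finProjDim_of_projective (a := a) (b := b) K hK, ?_⟩
  let F := Rep.resFunctor.{u} (k := k) S.subtype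
  let K' : CochainComplex (Rep.{u} k S) ℤ := (F.mapHomologicalComplex _).obj K
  have h : finProjDim (Rep.{u} k S) (Q.obj K') := by
    have : K'.IsStrictlyGE a := (CochainComplex.isStrictlyGE_iff _ _).2
      (fun i hi => F.map_isZero (K.isZero_of_isStrictlyGE a i hi))
    have : K'.IsStrictlyLE b := (CochainComplex.isStrictlyLE_iff _ _).2
      (fun i hi => F.map_isZero (K.isZero_of_isStrictlyLE b i hi))
    exact finProjDim_of_projective (a := a) (b := b) K' (fun i => by
      have := hK i
      exact F.projective_obj (K.X i))
  exact (finProjDim (Rep.{u} k S)).prop_of_iso (F.mapDerivedCategoryFactors.app K).symm h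

/-- Restriction keeps projectives projective, so perfect complexes satisfy both conditions; hence
the singularity category maps to `stableLoc S`. -/
lemma isPerfect_le_finProjDimRes : isPerfect k G ≤ finProjDimRes S := by
  rintro X ⟨K, ⟨⟨a, b, ha, hb⟩, -⟩, hK, ⟨e⟩⟩
  exact ObjectProperty.prop_of_iso _ e.symm
    (finProjDimRes_of_projective (a := a) (b := b) S K hK)

variable {S} in
lemma single_mem_finProjDimRes (P : Rep.{u} k G) (hP : Projective P) :
    finProjDimRes S ((singleFunctor (Rep.{u} k G) 0).obj P) :=
  finProjDimRes_of_projective (a := 0) (b := 0) S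
    ((CochainComplex.singleFunctor (Rep.{u} k G) 0).obj P) (fun i => by
      by_cases hi : i = 0
      · subst hi
        exact Projective.of_iso (singleX P).symm hP
      · exact (HomologicalComplex.isZero_single_obj_X (ComplexShape.up ℤ) 0 P i hi).projective)

lemma single_mem_finProjDim (P : Rep.{u} k G) (hP : Projective P) :
    finProjDim (Rep.{u} k G) ((singleFunctor (Rep.{u} k G) 0).obj P) :=
  (single_mem_finProjDimRes (S := ⊤) P hP).1

/-- The localization of the derived category of `kG`-modules in which the morphisms between
modules are the stable ones. -/
abbrev stableLoc : DerivedCategory (Rep.{u} k G) ⥤ (finProjDimRes (k := k) S).trW.Localization :=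
  (finProjDimRes S).trW.Q

variable (k G) in
/-- The localization of the derived category at the objects of finite projective dimension. -/
abbrev fpdLoc : DerivedCategory (Rep.{u} k G) ⥤ (finProjDim (Rep.{u} k G)).trW.Localization :=
  (finProjDim (Rep.{u} k G)).trW.Q

lemma perfectCone_isInvertedBy :
    (perfectCone k G).IsInvertedBy ((isDb k G).ι ⋙ stableLoc S) := fun _ _ _ hf =>
  Localization.inverts (stableLoc S) (finProjDimRes S).trW _
    (ObjectProperty.trW_monotone (isPerfect_le_finProjDimRes S) _ hf)

/-- An isomorphism in the singularity category gives one in the stable localization. -/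
def stableIsoOfSing {K L : CochainComplex (Rep.{u} k G) ℤ} {hK : IsBoundedFG K}
    {hL : IsBoundedFG L} (e : toSing K hK ≅ toSing L hL) :
    (stableLoc S).obj (Q.obj K) ≅ (stableLoc S).obj (Q.obj L) :=
  let fac := Localization.fac ((isDb k G).ι ⋙ stableLoc S) (perfectCone_isInvertedBy S)
    (perfectCone k G).Q
  (fac.app ⟨Q.obj K, K, hK, ⟨Iso.refl _⟩⟩).symm ≪≫
    (Localization.lift ((isDb k G).ι ⋙ stableLoc S) (perfectCone_isInvertedBy S)
      (perfectCone k G).Q).mapIso e ≪≫ fac.app ⟨Q.obj L, L, hL, ⟨Iso.refl _⟩⟩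

/-- The condition on restrictions is built into `finProjDimRes` for this purpose: restriction to `S`
descends to the localizations. -/
lemma isInvertedBy_resDerived :
    (finProjDimRes (k := k) S).trW.IsInvertedBy (resDerived S ⋙ fpdLoc k S) := by
  intro X Y f hf
  refine Localization.inverts (fpdLoc k S) (finProjDim (Rep.{u} k S)).trW _ ?_
  have h1 := ObjectProperty.trW_monotone (show finProjDimRes (k := k) S ≤
    (finProjDim (Rep.{u} k S)).inverseImage (resDerived S) from inf_le_right) f hf
  exact (ObjectProperty.inverseImage_trW_iff _ (resDerived S) f).1 h1

/-- An isomorphism in the stable localization of `G` restricts to the one of `S`. -/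
lemma exists_restricted_iso {A X Y : DerivedCategory (Rep.{u} k G)} (u : A ⟶ X) (v : A ⟶ Y)
    (e : (stableLoc S).obj X ≅ (stableLoc S).obj Y)
    (h : (stableLoc S).map u ≫ e.hom = (stableLoc S).map v) :
    ∃ e' : (fpdLoc k S).obj ((resDerived S).obj X) ≅ (fpdLoc k S).obj ((resDerived S).obj Y),
      (fpdLoc k S).map ((resDerived S).map u) ≫ e'.hom =
        (fpdLoc k S).map ((resDerived S).map v) := by
  let T := Localization.lift (resDerived S ⋙ fpdLoc k S) (isInvertedBy_resDerived S) (stableLoc S)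
  let fac : stableLoc S ⋙ T ≅ resDerived S ⋙ fpdLoc k S :=
    Localization.fac (resDerived S ⋙ fpdLoc k S) (isInvertedBy_resDerived S) (stableLoc S)
  refine ⟨(fac.app X).symm ≪≫ T.mapIso e ≪≫ fac.app Y, ?_⟩
  have h1 := fac.inv.naturality u
  have h2 := fac.hom.naturality v
  have h3 : T.map ((stableLoc S).map u) ≫ T.map e.hom = T.map ((stableLoc S).map v) := by
    rw [← h, Functor.map_comp]
  have h4 : (fpdLoc k S).map ((resDerived S).map u) ≫ fac.inv.app X =
    fac.inv.app A ≫ T.map ((stableLoc S).map u) := h1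
  have h5 : T.map ((stableLoc S).map v) ≫ fac.hom.app Y =
    fac.hom.app A ≫ (fpdLoc k S).map ((resDerived S).map v) := h2
  simp only [Iso.trans_hom, Iso.symm_hom, Iso.app_inv, Iso.app_hom, Functor.mapIso_hom]
  rw [reassoc_of% h4, reassoc_of% h3, h5]
  exact fac.inv_hom_id_app_assoc A _

variable [Finite G]

lemma stableLoc_full {A B : Rep.{u} k G}
    (α : (stableLoc S).obj (Q.obj ((CochainComplex.singleFunctor (Rep.{u} k G) 0).obj A)) ⟶
      (stableLoc S).obj (Q.obj ((CochainComplex.singleFunctor (Rep.{u} k G) 0).obj B))) :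
    ∃ f : A ⟶ B, α = (stableLoc S).map
      (Q.map ((CochainComplex.singleFunctor (Rep.{u} k G) 0).map f)) :=
  exists_map_eq (N := finProjDimRes S) injective_of_projective single_mem_finProjDimRes inf_le_left (stableLoc S) α

lemma stableLoc_faithful {A B : Rep.{u} k G} {f g : A ⟶ B}
    (h : (stableLoc S).map (Q.map ((CochainComplex.singleFunctor (Rep.{u} k G) 0).map f)) =
      (stableLoc S).map (Q.map ((CochainComplex.singleFunctor (Rep.{u} k G) 0).map g))) :
    FactorsThroughProjective (f - g) :=
  factorsThroughProjective_sub (N := finProjDimRes S) injective_of_projective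
    single_mem_finProjDimRes inf_le_left
    (stableLoc S) h

lemma fpdLoc_full {A B : Rep.{u} k G}
    (α : (fpdLoc k G).obj (Q.obj ((CochainComplex.singleFunctor (Rep.{u} k G) 0).obj A)) ⟶
      (fpdLoc k G).obj (Q.obj ((CochainComplex.singleFunctor (Rep.{u} k G) 0).obj B))) :
    ∃ f : A ⟶ B, α = (fpdLoc k G).map
      (Q.map ((CochainComplex.singleFunctor (Rep.{u} k G) 0).map f)) :=
  exists_map_eq injective_of_projective single_mem_finProjDim le_rfl (fpdLoc k G) α

lemma fpdLoc_faithful {A B : Rep.{u} k G} {f g : A ⟶ B}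
    (h : (fpdLoc k G).map (Q.map ((CochainComplex.singleFunctor (Rep.{u} k G) 0).map f)) =
      (fpdLoc k G).map (Q.map ((CochainComplex.singleFunctor (Rep.{u} k G) 0).map g))) :
    FactorsThroughProjective (f - g) :=
  factorsThroughProjective_sub injective_of_projective single_mem_finProjDim le_rfl
    (fpdLoc k G) h

end StableFunctors

/-! ### Modules isomorphic to the twisted complex in the singularity category. -/

section Recognition

open DerivedCategory

variable {p : ℕ} {k G : Type u} [Field k] [Group G] [Finite G]

/-- Maps factoring through projectives are traces. On the trivial module a trace is multiplication
by `|G| = 0`, so `ε w = 1` holds exactly, while the trace expressing `ε ≫ w - 1` provides, up to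
sign, the endomorphism `θ`. -/
lemma nearUnit_of_stable_inverse (hG : (Nat.card G : k) = 0) {M : Rep.{u} k G}
    (w : Rep.trivial k G k ⟶ M) (ε : M ⟶ Rep.trivial k G k)
    (h1 : FactorsThroughProjective (w ≫ ε - 𝟙 _)) (h2 : FactorsThroughProjective (ε ≫ w - 𝟙 _)) :
    ∃ θ, NearUnit M (w.hom (1 : k)) ε.hom.toLinearMap θ := by
  let _ := Fintype.ofFinite G
  obtain ⟨θ₁, hθ₁⟩ := h1.exists_trace
  obtain ⟨θ₂, hθ₂⟩ := h2.exists_trace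
  refine ⟨-θ₂, fun g => ?_, fun g m => Rep.hom_comm_apply ε g m, ?_, fun m => ?_⟩
  · rw [← Rep.hom_comm_apply]
    rfl
  · have h3 := hθ₁ (1 : k)
    have h4 : ∑ g : G, (Rep.trivial k G k).ρ g (θ₁ ((Rep.trivial k G k).ρ g⁻¹ (1 : k))) =
        (0 : k) := by
      have h5 : ∀ g : G, (Rep.trivial k G k).ρ g (θ₁ ((Rep.trivial k G k).ρ g⁻¹ (1 : k))) =
        (θ₁ (1 : k) : k) := fun g => rfl
      rw [Finset.sum_congr rfl (fun g _ => h5 g), Finset.sum_const, Finset.card_univ,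
        ← Nat.card_eq_fintype_card]
      refine (Nat.cast_smul_eq_nsmul k _ _).symm.trans ?_
      rw [hG, zero_smul]
    rw [h4] at h3
    have h6 : (ε.hom (w.hom (1 : k)) : k) - 1 = 0 := h3
    exact sub_eq_zero.1 h6
  · have h3 := hθ₂ m
    have h4 : (ε.hom m : k) • w.hom (1 : k) - m =
        ∑ g : G, M.ρ g (θ₂ (M.ρ g⁻¹ m)) := by
      refine Eq.trans ?_ h3
      have : (ε.hom m : k) • w.hom (1 : k) = w.hom (ε.hom m) := by
        rw [← map_smul]
        exact congrArg w.hom (mul_one _)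
      rw [this]
      rfl
    rw [traceEnd_apply]
    have h5 : ∀ g : G, M.ρ g ((-θ₂) (M.ρ g⁻¹ m)) = -M.ρ g (θ₂ (M.ρ g⁻¹ m)) := fun g => by
      rw [LinearMap.neg_apply, map_neg]
    rw [Finset.sum_congr rfl (fun g _ => h5 g), Finset.sum_neg_distrib, ← h4, neg_sub]
    rfl

/-- The inverse in the localization comes from a module morphism by fullness, and faithfulness makes
it an inverse modulo projectives. -/
lemma exists_nearUnit_of_isIso (hG : (Nat.card G : k) = 0) {M : Rep.{u} k G}
    (w : Rep.trivial k G k ⟶ M) (hw : IsIso ((fpdLoc k G).map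
      (Q.map ((CochainComplex.singleFunctor (Rep.{u} k G) 0).map w)))) :
    ∃ (ε : M ⟶ Rep.trivial k G k) (θ : M.V →ₗ[k] M.V),
      NearUnit M (w.hom (1 : k)) ε.hom.toLinearMap θ := by
  let Ψ := CochainComplex.singleFunctor (Rep.{u} k G) 0 ⋙ Q ⋙ fpdLoc k G
  have hw' : IsIso (Ψ.map w) := hw
  obtain ⟨ε, hε⟩ := fpdLoc_full (inv (Ψ.map w))
  have hε' : inv (Ψ.map w) = Ψ.map ε := hε
  have h1 : Ψ.map (w ≫ ε) = Ψ.map (𝟙 _) := by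
    rw [Ψ.map_comp, ← hε', IsIso.hom_inv_id, Ψ.map_id]
  have h2 : Ψ.map (ε ≫ w) = Ψ.map (𝟙 _) := by
    rw [Ψ.map_comp, ← hε', IsIso.inv_hom_id, Ψ.map_id]
  obtain ⟨θ, hθ⟩ := nearUnit_of_stable_inverse hG w ε (fpdLoc_faithful h1) (fpdLoc_faithful h2)
  exact ⟨ε, θ, hθ⟩

omit [Finite G] in
lemma card_cast_eq_zero [Fact p.Prime] [CharP k p] (P : PSub p G) : (Nat.card P.1 : k) = 0 := by
  rw [CharP.cast_eq_zero_iff k p]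
  rcases P.2.1.card_eq_or_dvd with h | h
  · exact absurd (Subgroup.card_eq_one.1 h) P.2.2
  · exact h

variable (φ : Z1 (OrbitCat p G) kˣ)

/-- The morphism `k[G/P] ⟶ C_*(|S_p(G)|; k_φ)` given by the vertex `P`. -/
abbrev vertexMap (P : PSub p G) :
    (CochainComplex.singleFunctor (Rep.{u} k G) 0).obj (permRep k P.1) ⟶ steinbergCochain φ :=
  singlePermHom (steinbergCochain φ) (vertexElt_mem φ P)

/-- Restriction to a subgroup on cochain complexes. -/
abbrev resComplex (S : Subgroup G) :
    CochainComplex (Rep.{u} k G) ℤ ⥤ CochainComplex (Rep.{u} k S) ℤ :=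
  (Rep.resFunctor.{u} (k := k) S.subtype).mapHomologicalComplex _

/-- Restriction commutes with the inclusion of modules as complexes in degree zero. -/
def resSingle (S : Subgroup G) (M : Rep.{u} k G) :
    (CochainComplex.singleFunctor (Rep.{u} k S) 0).obj ((Rep.resFunctor S.subtype).obj M) ≅
      (resComplex S).obj ((CochainComplex.singleFunctor (Rep.{u} k G) 0).obj M) :=
  (HomologicalComplex.singleMapHomologicalComplex (Rep.resFunctor.{u} (k := k) S.subtype)
    (ComplexShape.up ℤ) 0).symm.app M

omit [Finite G] in
lemma resSingle_naturality (S : Subgroup G) {M N : Rep.{u} k G} (f : M ⟶ N) :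
    (resSingle S M).hom ≫ (resComplex S).map
      ((CochainComplex.singleFunctor (Rep.{u} k G) 0).map f) =
    (CochainComplex.singleFunctor (Rep.{u} k S) 0).map ((Rep.resFunctor S.subtype).map f) ≫
      (resSingle S N).hom :=
  ((HomologicalComplex.singleMapHomologicalComplex (Rep.resFunctor.{u} (k := k) S.subtype)
    (ComplexShape.up ℤ) 0).inv.naturality f).symm

omit [Finite G] in
lemma resSingle_f (S : Subgroup G) (M : Rep.{u} k G) :
    (resSingle S M).hom.f 0 = (singleX ((Rep.resFunctor S.subtype).obj M)).hom ≫
      (Rep.resFunctor S.subtype).map (singleX M).inv :=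
  HomologicalComplex.singleMapHomologicalComplex_inv_app_self
    (Rep.resFunctor.{u} (k := k) S.subtype) (ComplexShape.up ℤ) 0 M

/-- The morphism from the trivial module given by an invariant element. -/
def fixedHom (S : Subgroup G) (M : Rep.{u} k G) {m : M.V} (hm : m ∈ invariantsOf M S) :
    Rep.trivial k S k ⟶ (Rep.resFunctor S.subtype).obj M :=
  trivialHom (Rep.res S.subtype M) m (fun g => mem_invariantsOf.1 hm g.1 g.2)

omit [Finite G] in
lemma fixedHom_one (S : Subgroup G) (M : Rep.{u} k G) {m : M.V} (hm : m ∈ invariantsOf M S) :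
    (fixedHom S M hm).hom (1 : k) = m :=
  (trivialHom_apply _ _ _ 1).trans (one_smul _ _)

omit [Finite G] in
lemma trivial_hom_ext {H : Type u} [Group H] {M : Rep.{u} k H} {f g : Rep.trivial k H k ⟶ M}
    (h : f.hom (1 : k) = g.hom (1 : k)) : f = g :=
  Rep.hom_ext (Representation.IntertwiningMap.ext (LinearMap.ext_ring h))

omit [Finite G] in
lemma fixedHom_comp (S : Subgroup G) {M N : Rep.{u} k G} {m : M.V} (hm : m ∈ invariantsOf M S)
    (f : M ⟶ N) : fixedHom S M hm ≫ (Rep.resFunctor S.subtype).map f =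
      fixedHom S N (hom_mem_invariantsOf f hm) := by
  refine trivial_hom_ext ?_
  rw [fixedHom_one]
  exact (Rep.comp_apply _ _ _).trans (congrArg f.hom (fixedHom_one S M hm))

/-- The morphism from the trivial module to the restriction of `k[G/S]` given by the base point. -/
def resSingleBase (S : Subgroup G) :
    (CochainComplex.singleFunctor (Rep.{u} k S) 0).obj (Rep.trivial k S k) ⟶
      (resComplex S).obj ((CochainComplex.singleFunctor (Rep.{u} k G) 0).obj (permRep k S)) :=
  (CochainComplex.singleFunctor (Rep.{u} k S) 0).map (fixedHom S (permRep k S) (permGen_mem S)) ≫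
    (resSingle S (permRep k S)).hom

omit [Finite G] in
lemma resSingleBase_comp_single (S : Subgroup G) {M : Rep.{u} k G} (m : permRep k S ⟶ M) :
    resSingleBase S ≫ (resComplex S).map
      ((CochainComplex.singleFunctor (Rep.{u} k G) 0).map m) =
    (CochainComplex.singleFunctor (Rep.{u} k S) 0).map
      (fixedHom S M (hom_mem_invariantsOf m (permGen_mem S))) ≫ (resSingle S M).hom := by
  rw [resSingleBase, Category.assoc, resSingle_naturality, ← fixedHom_comp S (permGen_mem S) m,
    Functor.map_comp, Category.assoc]

omit [Finite G] in
lemma singleFunctor_hom_ext {A : Rep.{u} k G} {K : CochainComplex (Rep.{u} k G) ℤ}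
    {f g : (CochainComplex.singleFunctor (Rep.{u} k G) 0).obj A ⟶ K} (h : f.f 0 = g.f 0) :
    f = g :=
  HomologicalComplex.from_single_hom_ext h

omit [Finite G] in
lemma comp_comp_comp_eq {C : Type*} [Category C] {A B X Y Z : C} (a : A ⟶ B) (b : B ⟶ X)
    (c : X ⟶ Y) (d : Y ⟶ Z) (z : X ⟶ Z) (h : c ≫ d = z) : (a ≫ b ≫ c) ≫ d = a ≫ b ≫ z := by
  rw [← h, Category.assoc, Category.assoc]

omit [Finite G] in
-- Under Frobenius reciprocity the vertex map from `k[G/S]` corresponds to the base map from `k`, so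
-- what is known about the base map applies to vertex maps of `G`.
lemma resSingleBase_comp_vertexMap (S : PSub p G) :
    resSingleBase S.1 ≫ (resComplex S.1).map (vertexMap φ S) = baseMap φ S := by
  refine singleFunctor_hom_ext ?_
  have h1 : (resSingleBase S.1).f 0 = (singleX (Rep.trivial k S.1 k)).hom ≫
      fixedHom S.1 (permRep k S.1) (permGen_mem S.1) ≫
      (Rep.resFunctor S.1.subtype).map (singleX (permRep k S.1)).inv := by
    rw [resSingleBase, HomologicalComplex.comp_f, single_map_f, resSingle_f]
    exact comp_comp_comp_eq _ _ _ _ _ (Iso.inv_hom_id_assoc _ _)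
  have h4 : (Rep.resFunctor S.1.subtype).map (singleX (permRep k S.1)).inv ≫
      ((resComplex S.1).map (vertexMap φ S)).f 0 =
      (Rep.resFunctor S.1.subtype).map (permHom _ (vertexElt_mem φ S)) := by
    refine ((Rep.resFunctor S.1.subtype).map_comp (singleX (permRep k S.1)).inv
      ((vertexMap φ S).f 0)).symm.trans (congrArg (Rep.resFunctor S.1.subtype).map ?_)
    rw [singlePermHom_f, Iso.inv_hom_id_assoc]
  have h5 : (resSingleBase S.1 ≫ (resComplex S.1).map (vertexMap φ S)).f 0 =
      (singleX (Rep.trivial k S.1 k)).hom ≫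
        fixedHom S.1 _ (hom_mem_invariantsOf (permHom _ (vertexElt_mem φ S)) (permGen_mem S.1)) := by
    rw [HomologicalComplex.comp_f, h1, ← fixedHom_comp]
    exact comp_comp_comp_eq _ _ _ _ _ h4
  have h3 : (baseMap φ S).f 0 = (singleX (Rep.trivial k S.1 k)).hom ≫ _ :=
    HomologicalComplex.mkHomFromSingle_f _ _
  refine h5.trans (Eq.trans (congrArg ((singleX (Rep.trivial k S.1 k)).hom ≫ ·) ?_) h3.symm)
  refine trivial_hom_ext ((fixedHom_one _ _ _).trans ?_)
  refine Eq.trans (permHom_permGen _ (vertexElt_mem φ S)) ?_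
  refine Eq.trans ?_ ((trivialHom_apply _ _ _ (1 : k)).trans (one_smul _ _)).symm
  rfl

omit [Finite G] in
lemma exists_iso_of_natIso {C : Type*} {D : Type*} [Category C] [Category D] {F F' : C ⥤ D}
    (i : F ≅ F') {A X Y : C} (a : A ⟶ X) (b : A ⟶ Y) (e : F.obj X ≅ F.obj Y)
    (h : F.map a ≫ e.hom = F.map b) :
    ∃ e' : F'.obj X ≅ F'.obj Y, F'.map a ≫ e'.hom = F'.map b :=
  ⟨(i.app X).symm ≪≫ e ≪≫ i.app Y, by
    simp only [Iso.trans_hom, Iso.symm_hom, Iso.app_inv, Iso.app_hom]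
    rw [i.inv.naturality_assoc a, reassoc_of% h, i.hom.naturality, Iso.inv_hom_id_app_assoc]⟩

omit [Finite G] in
-- Restricting `e` to `S` and composing with the base point of `k[G/S]` turns the map `k → M` into
-- the base map followed by an isomorphism.
lemma isIso_of_vertexMap (S : PSub p G) {M : Rep.{u} k G} (h : permRep k S.1 ⟶ M)
    (e : (stableLoc S.1).obj (Q.obj (steinbergCochain φ)) ≅
      (stableLoc S.1).obj (Q.obj ((CochainComplex.singleFunctor (Rep.{u} k G) 0).obj M)))
    (he : (stableLoc S.1).map (Q.map (vertexMap φ S)) ≫ e.hom =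
      (stableLoc S.1).map (Q.map ((CochainComplex.singleFunctor (Rep.{u} k G) 0).map h)))
    (hbase : IsIso ((fpdLoc k S.1).map (Q.map (baseMap φ S)))) :
    IsIso ((fpdLoc k S.1).map (Q.map ((CochainComplex.singleFunctor (Rep.{u} k S.1) 0).map
      (fixedHom S.1 M (hom_mem_invariantsOf h (permGen_mem S.1)))))) := by
  obtain ⟨e', he'⟩ := exists_restricted_iso S.1 _ _ e he
  let i : Q ⋙ resDerived S.1 ⋙ fpdLoc k S.1 ≅ resComplex S.1 ⋙ Q ⋙ fpdLoc k S.1 :=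
    Functor.isoWhiskerRight (Rep.resFunctor.{u} (k := k) S.1.subtype).mapDerivedCategoryFactors
      (fpdLoc k S.1)
  obtain ⟨c, hc⟩ := exists_iso_of_natIso i (vertexMap φ S)
    ((CochainComplex.singleFunctor (Rep.{u} k G) 0).map h) e' he'
  let Ψ : CochainComplex (Rep.{u} k S.1) ℤ ⥤ _ := Q ⋙ fpdLoc k S.1
  have e1 := congrArg Ψ.map (resSingleBase_comp_vertexMap φ S)
  have e2 := congrArg Ψ.map (resSingleBase_comp_single S.1 h)
  rw [Functor.map_comp] at e1 e2
  rw [Functor.map_comp] at e2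
  let j := Ψ.mapIso (resSingle S.1 M)
  have hc' : Ψ.map ((resComplex S.1).map (vertexMap φ S)) ≫ c.hom =
    Ψ.map ((resComplex S.1).map ((CochainComplex.singleFunctor (Rep.{u} k G) 0).map h)) := hc
  have e3 : Ψ.map ((CochainComplex.singleFunctor (Rep.{u} k S.1) 0).map
      (fixedHom S.1 M (hom_mem_invariantsOf h (permGen_mem S.1)))) =
      Ψ.map (baseMap φ S) ≫ c.hom ≫ j.inv := by
    have e4 : Ψ.map (baseMap φ S) ≫ c.hom = Ψ.map ((CochainComplex.singleFunctor
        (Rep.{u} k S.1) 0).map (fixedHom S.1 M (hom_mem_invariantsOf h (permGen_mem S.1)))) ≫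
          j.hom := by
      rw [← e1, Category.assoc, hc']
      exact e2
    rw [← Category.assoc, e4, Category.assoc, Iso.hom_inv_id, Category.comp_id]
  have hb' : IsIso (Ψ.map (baseMap φ S)) := hbase
  change IsIso (Ψ.map _)
  rw [e3]
  infer_instance

variable [Fact p.Prime] [CharP k p]

variable {φ} in
/-- A module isomorphic to the twisted Steinberg complex in the singularity category is close to
the trivial module on `S`, and its Tate cohomology is described by `φ`. -/
theorem exists_nearUnit_of_iso (S : PSub p G) (M : Rep.{u} k G) [Module.Finite k M.V]
    (e : moduleSing M ≅ steinbergSing φ) : ∃ m : OrbitCat p G → M.V,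
      (∀ X, m X ∈ invariantsOf M X.sub.1) ∧
      (∀ (X Y : OrbitCat p G) (f : X ⟶ Y) (g : G),
        OrbitCat.toMap f ((1 : G) : G ⧸ X.sub.1) = (g : G ⧸ Y.sub.1) →
          M.ρ g (m Y) - (φ.1 X Y f : k) • m X ∈ LinearMap.range (normMap M X.sub.1)) ∧
      ∃ ε θ, NearUnit (Rep.res S.1.subtype M) (m ⟨S⟩) ε θ := by
  let α := stableIsoOfSing S.1 e
  let L := stableLoc (k := k) S.1
  -- By fullness, the vertex map of `X` followed by the isomorphism to `M` is a module morphism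
  -- `k[G/X] ⟶ M`; the element `m X` is the image of the generator.
  choose h hh using fun X : OrbitCat p G =>
    stableLoc_full S.1 (L.map (Q.map (vertexMap φ X.sub)) ≫ α.inv)
  refine ⟨fun X => (h X).hom (permGen k X.sub.1),
    fun X => hom_mem_invariantsOf _ (permGen_mem X.sub.1), fun X Y f g hg => ?_, ?_⟩
  · let T := permRep k X.sub.1
    have hgY : (permRep k Y.sub.1).ρ g (permGen k Y.sub.1) ∈
        invariantsOf (permRep k Y.sub.1) X.sub.1 :=
      rho_mem_invariantsOf _ (conj_of_toMap f hg) (permGen_mem Y.sub.1)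
    let f' : permRep k X.sub.1 ⟶ permRep k Y.sub.1 := permHom _ hgY
    have hsX : (φ.1 X Y f : k) • permGen k X.sub.1 ∈
        invariantsOf (permRep k X.sub.1) X.sub.1 := Submodule.smul_mem _ _ (permGen_mem X.sub.1)
    let s : permRep k X.sub.1 ⟶ permRep k X.sub.1 := permHom _ hsX
    have hY0 : ((steinbergCochain φ).X 0).ρ g (vertexElt φ Y.sub) ∈
        invariantsOf ((steinbergCochain φ).X 0) X.sub.1 :=
      rho_mem_invariantsOf _ (conj_of_toMap f hg) (vertexElt_mem φ Y.sub)
    have hX0 : (φ.1 X Y f : k) • vertexElt φ X.sub ∈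
        invariantsOf ((steinbergCochain φ).X 0) X.sub.1 :=
      Submodule.smul_mem _ _ (vertexElt_mem φ X.sub)
    obtain ⟨y, hy, hyd⟩ := exists_edge φ f hg
    have e1 := single_map_singlePermHom (steinbergCochain φ) (vertexElt_mem φ Y.sub) f' hY0 (by
      rw [permHom_permGen, Rep.hom_comm_apply, permHom_permGen])
    have e2 := single_map_singlePermHom (steinbergCochain φ) (vertexElt_mem φ X.sub) s hX0 (by
      rw [permHom_permGen, map_smul, permHom_permGen])
    -- Here `f'` sends the generator to its translate by `g`, and `s` multiplies by `φ f`. The edge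
    -- shows that, followed by the vertex maps, they agree in the derived category.
    have e3 := Q_map_singlePermHom_eq (steinbergCochain φ) hY0 hX0 y hy hyd
    rw [← e1, ← e2] at e3
    have key : ∀ (Z : OrbitCat p G) (t : permRep k X.sub.1 ⟶ permRep k Z.sub.1),
        L.map (Q.map ((CochainComplex.singleFunctor (Rep.{u} k G) 0).map (t ≫ h Z))) =
          L.map (Q.map ((CochainComplex.singleFunctor (Rep.{u} k G) 0).map t ≫
            vertexMap φ Z.sub)) ≫ α.inv := by
      intro Z t
      have h1 : (CochainComplex.singleFunctor (Rep.{u} k G) 0 ⋙ Q ⋙ L).map (t ≫ h Z) =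
          (CochainComplex.singleFunctor (Rep.{u} k G) 0 ⋙ Q ⋙ L).map t ≫
            (CochainComplex.singleFunctor (Rep.{u} k G) 0 ⋙ Q ⋙ L).map (h Z) :=
        CategoryTheory.Functor.map_comp _ _ _
      have h2 : (Q ⋙ L).map ((CochainComplex.singleFunctor (Rep.{u} k G) 0).map t ≫
          vertexMap φ Z.sub) = (Q ⋙ L).map ((CochainComplex.singleFunctor (Rep.{u} k G) 0).map t) ≫
            (Q ⋙ L).map (vertexMap φ Z.sub) := CategoryTheory.Functor.map_comp _ _ _
      refine h1.trans (Eq.trans (congrArg (_ ≫ ·) (hh Z).symm) ?_)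
      refine Eq.trans ?_ (congrArg (· ≫ α.inv) h2.symm)
      exact (Category.assoc _ _ _).symm
    have e4 : L.map (Q.map ((CochainComplex.singleFunctor (Rep.{u} k G) 0).map (f' ≫ h Y))) =
        L.map (Q.map ((CochainComplex.singleFunctor (Rep.{u} k G) 0).map (s ≫ h X))) :=
      (key Y f').trans ((congrArg (fun t => L.map t ≫ α.inv) e3).trans (key X s).symm)
    let _ := Fintype.ofFinite G
    -- The difference `f' ≫ h Y - s ≫ h X` factors through a projective, so it is a trace, and its
    -- value at an `X`-invariant element is an `X`-norm.
    obtain ⟨θ, hθ⟩ := (stableLoc_faithful S.1 e4).exists_trace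
    have e5 := sum_mem_range_normMap (N := M) θ X.sub.1 (permGen_mem (k := k) X.sub.1)
    rw [← hθ] at e5
    have e6 : (f' ≫ h Y - s ≫ h X).hom (permGen k X.sub.1) =
        M.ρ g ((h Y).hom (permGen k Y.sub.1)) -
          (φ.1 X Y f : k) • (h X).hom (permGen k X.sub.1) := by
      change (h Y).hom (f'.hom (permGen k X.sub.1)) - (h X).hom (s.hom (permGen k X.sub.1)) = _
      rw [permHom_permGen, permHom_permGen, Rep.hom_comm_apply, map_smul]
    rwa [e6] at e5
  · let w := fixedHom S.1 M (hom_mem_invariantsOf (h ⟨S⟩) (permGen_mem S.1))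
    have hbase : IsIso ((fpdLoc k S.1).map (Q.map (baseMap φ S))) :=
      Localization.inverts (fpdLoc k S.1) (finProjDim (Rep.{u} k S.1)).trW _ (trW_baseMap φ S)
    have hw := isIso_of_vertexMap φ S (h ⟨S⟩) α.symm (by
      have h1 := hh ⟨S⟩
      exact h1) hbase
    obtain ⟨ε, θ, hθ⟩ := exists_nearUnit_of_isIso (card_cast_eq_zero S) w hw
    exact ⟨ε.hom.toLinearMap, θ, by
      have h1 := fixedHom_one S.1 M (hom_mem_invariantsOf (h ⟨S⟩) (permGen_mem S.1))
      rw [h1] at hθ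
      exact hθ⟩

end Recognition

/-! ### Isomorphisms in the singularity category from perfect cones. -/

section SingularityIso

open DerivedCategory

variable {k G : Type u} [Field k] [Group G]

/-- A morphism of complexes with perfect cone is an isomorphism in the singularity category. -/
lemma nonempty_toSing_iso {K L : CochainComplex (Rep.{u} k G) ℤ} (hK : IsBoundedFG K)
    (hL : IsBoundedFG L) (f : K ⟶ L) (hf : (isPerfect k G).trW (Q.map f)) :
    Nonempty (toSing K hK ≅ toSing L hL) := by
  let f' : (⟨Q.obj K, K, hK, ⟨Iso.refl _⟩⟩ : (isDb k G).FullSubcategory) ⟶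
      ⟨Q.obj L, L, hL, ⟨Iso.refl _⟩⟩ := ObjectProperty.homMk (Q.map f)
  have hf' : perfectCone k G f' := hf
  have : IsIso ((perfectCone k G).Q.map f') :=
    Localization.inverts (perfectCone k G).Q (perfectCone k G) f' hf'
  let i := asIso ((perfectCone k G).Q.map f')
  exact ⟨i⟩

open scoped ZeroObject in
lemma isPerfect_of_isZero {X : DerivedCategory (Rep.{u} k G)} (hX : IsZero X) :
    isPerfect k G X := by
  let Z : CochainComplex (Rep.{u} k G) ℤ := HomologicalComplex.zero
  have h0 : IsZero Z := HomologicalComplex.isZero_zero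
  have h1 : ∀ i, IsZero (Z.X i) := fun i => isZero_zero _
  exact ⟨Z, ⟨⟨0, 0, (CochainComplex.isStrictlyGE_iff _ _).2 fun i _ => h1 i,
    (CochainComplex.isStrictlyLE_iff _ _).2 fun i _ => h1 i⟩, fun i => finite_of_isZero (h1 i)⟩,
    fun i => (h1 i).projective, ⟨hX.iso (Q.map_isZero h0)⟩⟩

lemma nonempty_toSing_iso_of_isIso {K L : CochainComplex (Rep.{u} k G) ℤ} (hK : IsBoundedFG K)
    (hL : IsBoundedFG L) (f : K ⟶ L) [IsIso (Q.map f)] :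
    Nonempty (toSing K hK ≅ toSing L hL) := by
  obtain ⟨Z, g, h, hT⟩ := Pretriangulated.distinguished_cocone_triangle (Q.map f)
  have hZ := (Pretriangulated.Triangle.isZero₃_iff_isIso₁ _ hT).2
    (inferInstanceAs (IsIso (Q.map f)))
  exact nonempty_toSing_iso hK hL f (ObjectProperty.trW.mk _ hT (isPerfect_of_isZero hZ))

lemma nonempty_toSing_iso_of_iso {K L : CochainComplex (Rep.{u} k G) ℤ} (hK : IsBoundedFG K)
    (hL : IsBoundedFG L) (e : K ≅ L) : Nonempty (toSing K hK ≅ toSing L hL) :=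
  nonempty_toSing_iso_of_isIso hK hL e.hom

/-- The kernel of an epimorphism onto a perfect complex is isomorphic to the source in the
singularity category. -/
lemma nonempty_toSing_kernel_iso {L P : CochainComplex (Rep.{u} k G) ℤ} (f : L ⟶ P) [Epi f]
    (hL : IsBoundedFG L) (hK : IsBoundedFG (kernel f)) (hP : IsBoundedFG P)
    (hP' : ∀ i, Projective (P.X i)) : Nonempty (toSing (kernel f) hK ≅ toSing L hL) := by
  let S : ShortComplex (CochainComplex (Rep.{u} k G) ℤ) :=
    ShortComplex.mk (kernel.ι f) f (kernel.condition f)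
  have hS : S.ShortExact := { exact := ShortComplex.exact_kernel _ }
  exact nonempty_toSing_iso hK hL (kernel.ι f) (ObjectProperty.trW.mk _
    (triangleOfSES_distinguished hS) ⟨P, hP, hP', ⟨Iso.refl _⟩⟩)

end SingularityIso

/-! ### Replacing a bounded complex by a module. -/

section Existence

open DerivedCategory HomologicalComplex

variable {k G : Type u} [Field k] [Group G]

lemma finite_of_surjective {M N : Rep.{u} k G} (f : M ⟶ N) (hf : Function.Surjective f.hom)
    [Module.Finite k M.V] : Module.Finite k N.V :=
  Module.Finite.of_surjective f.hom.toLinearMap hf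

lemma finite_of_injective {M N : Rep.{u} k G} (f : M ⟶ N) (hf : Function.Injective f.hom)
    [Module.Finite k N.V] : Module.Finite k M.V :=
  Module.Finite.of_injective f.hom.toLinearMap hf

lemma finite_biprod (M N : Rep.{u} k G) [Module.Finite k M.V] [Module.Finite k N.V] :
    Module.Finite k (M ⊞ N).V := by
  refine Module.Finite.of_injective ((biprod.fst : M ⊞ N ⟶ M).hom.toLinearMap.prod
    (biprod.snd : M ⊞ N ⟶ N).hom.toLinearMap) (fun x y hxy => ?_)
  have h : ∀ z : (M ⊞ N).V, z = (biprod.inl : M ⟶ M ⊞ N).hom ((biprod.fst : M ⊞ N ⟶ M).hom z) +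
      (biprod.inr : N ⟶ M ⊞ N).hom ((biprod.snd : M ⊞ N ⟶ N).hom z) := fun z => by
    have h1 : (biprod.fst ≫ biprod.inl + biprod.snd ≫ biprod.inr : M ⊞ N ⟶ M ⊞ N).hom z =
        (𝟙 (M ⊞ N) : M ⊞ N ⟶ M ⊞ N).hom z := by rw [biprod.total]
    exact h1.symm
  rw [h x, h y]
  exact congrArg₂ (fun a b => (biprod.inl : M ⟶ M ⊞ N).hom a + (biprod.inr : N ⟶ M ⊞ N).hom b)
    (congrArg Prod.fst hxy) (congrArg Prod.snd hxy)

lemma finite_double {A : Rep.{u} k G} [Module.Finite k A.V] {a b : ℤ}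
    (h : (ComplexShape.up ℤ).Rel a b) (i : ℤ) : Module.Finite k ((double (𝟙 A) h).X i).V := by
  have hab : a ≠ b := by have h' : a + 1 = b := h; omega
  by_cases h0 : i = a
  · subst h0
    exact finite_of_iso (doubleXIso₀ (𝟙 A) h)
  · by_cases h1 : i = b
    · subst h1
      exact finite_of_iso (doubleXIso₁ (𝟙 A) h hab)
    · exact finite_of_isZero (isZero_double_X (𝟙 A) h i h0 h1)

/-- The functoriality of `double (𝟙 A)`. -/
def doubleMap {A B : Rep.{u} k G} (f : A ⟶ B) {a b : ℤ} (h : (ComplexShape.up ℤ).Rel a b)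
    (hab : a ≠ b) : double (𝟙 A) h ⟶ double (𝟙 B) h :=
  mkHomFromDouble h hab (f ≫ (doubleXIso₀ (𝟙 B) h).inv) (f ≫ (doubleXIso₁ (𝟙 B) h hab).inv)
    (by rw [double_d _ _ hab]; simp)
    (fun l hl => by rw [double_d_eq_zero₀ _ _ _ _ hab.symm, comp_zero])

lemma mono_doubleMap {A B : Rep.{u} k G} (f : A ⟶ B) [Mono f] {a b : ℤ}
    (h : (ComplexShape.up ℤ).Rel a b) (hab : a ≠ b) : Mono (doubleMap f h hab) := by
  have hi : ∀ i, Mono ((doubleMap f h hab).f i) := by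
    intro i
    by_cases h0 : i = a
    · subst h0
      rw [doubleMap, mkHomFromDouble_f₀]
      infer_instance
    · by_cases h1 : i = b
      · subst h1
        rw [doubleMap, mkHomFromDouble_f₁]
        infer_instance
      · exact ⟨fun _ _ _ => (isZero_double_X (𝟙 A) h i h0 h1).eq_of_tgt _ _⟩
  exact HomologicalComplex.mono_of_mono_f _ hi

/-- The morphism from `double (𝟙 (K.X a))` given by the differential of `K`. -/
def fromDouble (K : CochainComplex (Rep.{u} k G) ℤ) {a b : ℤ} (h : (ComplexShape.up ℤ).Rel a b)
    (hab : a ≠ b) : double (𝟙 (K.X a)) h ⟶ K :=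
  mkHomFromDouble h hab (𝟙 _) (K.d a b) (by simp) (fun l _ => K.d_comp_d a b l)

variable [Finite G]

/-- The embedding of a module in the coinduced module. -/
def toFunRep (M : Rep.{u} k G) : M ⟶ Rep.of (funRep M) :=
  Rep.ofHom ⟨LinearMap.pi fun _ => LinearMap.id, fun g => by
    refine LinearMap.ext fun m => funext fun x => rfl⟩

instance (M : Rep.{u} k G) : Mono (toFunRep M) := by
  rw [Rep.mono_iff_injective]
  intro x y h
  exact congrFun (show (fun _ : G => x) = fun _ => y from h) 1

/-- The projection onto the coordinate at `1` has as its conjugates the projections onto the other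
coordinates, so its trace is the identity. -/
instance projective_funRep (M : Rep.{u} k G) : Projective (Rep.of (funRep M)) := by
  classical
  let _ := Fintype.ofFinite G
  refine projective_of_trace _ (LinearMap.single k (fun _ : G => M.V) 1 ∘ₗ
    (LinearMap.proj 1 : (G → M.V) →ₗ[k] M.V)) (fun (m : G → M.V) => ?_)
  rw [traceEnd_apply]
  refine funext fun x => ?_
  have h : ∀ g : G, (funRep M g (Pi.single 1 (funRep M g⁻¹ m 1) : G → M.V)) x =
      if x = g then m x else 0 := fun g => by
    by_cases hx : x = g
    · subst hx
      simp [funRep, ← Module.End.mul_apply, ← map_mul]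
    · have hx' : g⁻¹ * x ≠ 1 := fun h => hx (inv_mul_eq_one.1 h).symm
      simp [funRep, hx, hx']
  refine (Finset.sum_apply x _ _).trans ?_
  refine (Finset.sum_congr rfl fun g _ => h g).trans ?_
  rw [Finset.sum_ite_eq]
  simp

instance (M : Rep.{u} k G) [Module.Finite k M.V] : Module.Finite k (Rep.of (funRep M)).V :=
  inferInstanceAs (Module.Finite k (G → M.V))

/-- A bounded complex of finitely generated modules in degrees `[a, b]`, `a < b`, is isomorphic in
the singularity category to one in degrees `[a + 1, b]`. -/
lemma exists_toSing_iso_isStrictlyGE {K : CochainComplex (Rep.{u} k G) ℤ} (hK : IsBoundedFG K)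
    {a b : ℤ} (hab : a < b) [K.IsStrictlyGE a] [K.IsStrictlyLE b] :
    ∃ (L : CochainComplex (Rep.{u} k G) ℤ) (hL : IsBoundedFG L), L.IsStrictlyGE (a + 1) ∧
      L.IsStrictlyLE b ∧ Nonempty (toSing L hL ≅ toSing K hK) := by
  have hr : (ComplexShape.up ℤ).Rel a (a + 1) := rfl
  have hne : a ≠ a + 1 := by omega
  have := hK.finite
  let B := double (𝟙 (Rep.of (funRep (K.X a)))) hr
  let κ : double (𝟙 (K.X a)) hr ⟶ K := fromDouble K hr hne
  let g : double (𝟙 (K.X a)) hr ⟶ B := doubleMap (toFunRep (K.X a)) hr hne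
  have : Mono g := mono_doubleMap _ hr hne
  -- Pushing out along a monomorphism between acyclic two-term complexes does not change the derived
  -- object, but replaces the lowest term by a coinduced module.
  let L : CochainComplex (Rep.{u} k G) ℤ := pushout κ g
  let s : K ⊞ B ⟶ L := biprod.desc (pushout.inl κ g) (pushout.inr κ g)
  have hs : Epi s := by
    refine ⟨fun x y hxy => pushout.hom_ext ?_ ?_⟩
    · simpa [s] using congrArg (fun t => biprod.inl ≫ t) hxy
    · simpa [s] using congrArg (fun t => biprod.inr ≫ t) hxy
  have hXiso : ∀ i, Nonempty ((K ⊞ B).X i ≅ K.X i ⊞ B.X i) := fun i =>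
    ⟨(HomologicalComplex.eval (Rep.{u} k G) (ComplexShape.up ℤ) i).mapBiprod K B⟩
  have hLz : ∀ i, IsZero (K.X i) → IsZero (B.X i) → IsZero (L.X i) := fun i h1 h2 => by
    obtain ⟨e⟩ := hXiso i
    have h3 : IsZero (K.X i ⊞ B.X i) := by
      rw [biprod_isZero_iff]; exact ⟨h1, h2⟩
    have := (Rep.isZero_iff k G _).1 (h3.of_iso e)
    exact (Rep.isZero_iff k G _).2 (rep_eval_surjective s i).subsingleton
  have hGE : L.IsStrictlyGE a := (CochainComplex.isStrictlyGE_iff _ _).2 fun i hi =>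
    hLz i (K.isZero_of_isStrictlyGE a i hi) (isZero_double_X _ hr i (by omega) (by omega))
  have hLE : L.IsStrictlyLE b := (CochainComplex.isStrictlyLE_iff _ _).2 fun i hi =>
    hLz i (K.isZero_of_isStrictlyLE b i hi) (isZero_double_X _ hr i (by omega) (by omega))
  have hL : IsBoundedFG L := ⟨⟨a, b, hGE, hLE⟩, fun i => by
    obtain ⟨e⟩ := hXiso i
    have : Module.Finite k (B.X i).V := finite_double hr i
    have : Module.Finite k (K.X i ⊞ B.X i).V := finite_biprod _ _
    have : Module.Finite k ((K ⊞ B).X i).V := finite_of_iso e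
    exact finite_of_surjective (s.f i) (rep_eval_surjective s i)⟩
  have hQ : IsIso (Q.map (pushout.inl κ g)) := isIso_Q_map_inl_pushout κ g
    (isZero_Q_of_acyclic (acyclic_double_id _ hr)) (isZero_Q_of_acyclic (acyclic_double_id _ hr))
  obtain ⟨e1⟩ := nonempty_toSing_iso_of_isIso hK hL (pushout.inl κ g)
  -- In degree `a` the map `κ` is an isomorphism, so the pushout there is the coinduced module.
  have hLa : Projective (L.X a) := by
    have h1 := (IsPushout.of_hasPushout κ g).map
      (HomologicalComplex.eval (Rep.{u} k G) (ComplexShape.up ℤ) a)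
    have h2 : IsIso (κ.f a) := by
      have : κ.f a = (doubleXIso₀ (𝟙 (K.X a)) hr).hom ≫ 𝟙 _ := mkHomFromDouble_f₀ _ _ _ _ _ _
      rw [this]
      infer_instance
    have h3 : IsIso ((pushout.inr κ g).f a) :=
      MorphismProperty.of_isPushout (P := MorphismProperty.isomorphisms (Rep.{u} k G)) h1.flip h2
    exact Projective.of_iso ((doubleXIso₀ _ hr).symm ≪≫ asIso ((pushout.inr κ g).f a))
      (projective_funRep (K.X a))
  let P : CochainComplex (Rep.{u} k G) ℤ := (single (Rep.{u} k G) (ComplexShape.up ℤ) a).obj (L.X a)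
  -- Projection onto the lowest term is a chain map because nothing maps into it. The target is
  -- perfect, and the kernel consists of the terms in degrees above `a`.
  let π : L ⟶ P := mkHomToSingle (𝟙 _) (fun i (hi : i + 1 = a) =>
    (L.isZero_of_isStrictlyGE a i (by omega)).eq_of_src _ _)
  have hπa : IsIso (π.f a) := by
    have : π.f a = 𝟙 _ ≫ (singleObjXSelf (ComplexShape.up ℤ) a (L.X a)).inv := mkHomToSingle_f _ _
    rw [this]
    infer_instance
  have hPz : ∀ i, i ≠ a → IsZero (P.X i) := fun i hi =>
    isZero_single_obj_X (ComplexShape.up ℤ) a _ i hi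
  have hπ : Epi π := by
    have : ∀ i, Epi (π.f i) := fun i => by
      by_cases hi : i = a
      · subst hi; infer_instance
      · exact ⟨fun _ _ _ => (hPz i hi).eq_of_src _ _⟩
    exact HomologicalComplex.epi_of_epi_f _ this
  have hP : IsBoundedFG P := ⟨⟨a, a, (CochainComplex.isStrictlyGE_iff _ _).2 fun i hi =>
    hPz i (by omega), (CochainComplex.isStrictlyLE_iff _ _).2 fun i hi => hPz i (by omega)⟩,
    fun i => have := hL.finite i; finite_of_surjective (π.f i) (rep_eval_surjective π i)⟩
  have hP' : ∀ i, Projective (P.X i) := fun i => by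
    by_cases hi : i = a
    · subst hi
      exact Projective.of_iso (singleObjXSelf (ComplexShape.up ℤ) i (L.X i)).symm hLa
    · exact (hPz i hi).projective
  let N : CochainComplex (Rep.{u} k G) ℤ := kernel π
  have hKz : ∀ i, IsZero (L.X i) → IsZero (N.X i) := fun i hi => by
    have := (Rep.isZero_iff k G _).1 hi
    exact (Rep.isZero_iff k G _).2 (rep_eval_injective (kernel.ι π) i).subsingleton
  have hGE' : N.IsStrictlyGE (a + 1) := (CochainComplex.isStrictlyGE_iff _ _).2
    fun i hi => by
    rcases (show i < a ∨ i = a by omega) with h | rfl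
    · exact hKz i (L.isZero_of_isStrictlyGE a i h)
    · have h1 : (kernel.ι π).f i ≫ π.f i = 0 := by
        rw [← comp_f, kernel.condition]; rfl
      have h2 : (kernel.ι π).f i = 0 := by
        rw [← cancel_mono (π.f i), h1, zero_comp]
      exact IsZero.of_mono_eq_zero _ h2
  have hLE' : N.IsStrictlyLE b := (CochainComplex.isStrictlyLE_iff _ _).2 fun i hi =>
    hKz i (L.isZero_of_isStrictlyLE b i hi)
  have hK' : IsBoundedFG N := ⟨⟨a + 1, b, hGE', hLE'⟩, fun i =>
    have := hL.finite i; finite_of_injective _ (rep_eval_injective (kernel.ι π) i)⟩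
  obtain ⟨e2⟩ := nonempty_toSing_kernel_iso π hL hK' hP hP'
  exact ⟨N, hK', hGE', hLE', ⟨e2 ≪≫ e1.symm⟩⟩

/-- A bounded complex of finitely generated modules in degrees `≤ 0` is isomorphic to a module in
the singularity category. -/
theorem exists_moduleSing_iso (n : ℕ) : ∀ {K : CochainComplex (Rep.{u} k G) ℤ}
    (hK : IsBoundedFG K), K.IsStrictlyGE (-(n : ℤ)) → K.IsStrictlyLE 0 →
    ∃ (M : Rep.{u} k G) (_ : Module.Finite k M.V), Nonempty (moduleSing M ≅ toSing K hK) := by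
  induction n with
  | zero =>
    intro K hK h1 h2
    have h1' : K.IsStrictlyGE 0 := by simpa using h1
    obtain ⟨M, ⟨e⟩⟩ := CochainComplex.exists_iso_single K 0
    have : Module.Finite k M.V := by
      have : Module.Finite k ((HomologicalComplex.eval (Rep.{u} k G) (ComplexShape.up ℤ) 0).obj
        K).V := hK.finite 0
      exact finite_of_iso ((singleX M).symm ≪≫
        (HomologicalComplex.eval (Rep.{u} k G) (ComplexShape.up ℤ) 0).mapIso e.symm)
    obtain ⟨e'⟩ := nonempty_toSing_iso_of_iso (isBoundedFG_single M) hK e.symm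
    exact ⟨M, this, ⟨e'⟩⟩
  | succ n ih =>
    intro K hK h1 h2
    obtain ⟨L, hL, h3, h4, ⟨e⟩⟩ := exists_toSing_iso_isStrictlyGE hK
      (a := -((n + 1 : ℕ) : ℤ)) (b := 0) (by omega)
    have h5 : L.IsStrictlyGE (-(n : ℤ)) := by
      have : -((n + 1 : ℕ) : ℤ) + 1 = -(n : ℤ) := by push_cast; ring
      rwa [this] at h3
    obtain ⟨M, hM, ⟨e'⟩⟩ := ih hL h5 h4
    exact ⟨M, hM, ⟨e' ≪≫ e⟩⟩

theorem exists_moduleSing_iso_steinbergSing {p : ℕ} (φ : Z1 (OrbitCat p G) kˣ) :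
    ∃ (M : Rep.{u} k G) (_ : Module.Finite k M.V), Nonempty (moduleSing M ≅ steinbergSing φ) := by
  obtain ⟨a, b, ha, hb⟩ := (isBoundedFG_steinberg φ).bounded
  have h : (steinbergCochain φ).IsStrictlyGE (-((a.natAbs : ℕ) : ℤ)) :=
    (CochainComplex.isStrictlyGE_iff _ _).2 fun i hi =>
      (steinbergCochain φ).isZero_of_isStrictlyGE a i (by omega)
  exact exists_moduleSing_iso a.natAbs (isBoundedFG_steinberg φ) h inferInstance

end Existence

/-! ### From stable isomorphisms to the singularity category. -/

section StableIsomorphism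

open DerivedCategory

variable {k G : Type u} [Field k] [Group G]

lemma nonempty_moduleSing_iso_of_iso {M N : Rep.{u} k G} [Module.Finite k M.V]
    [Module.Finite k N.V] (e : M ≅ N) : Nonempty (moduleSing M ≅ moduleSing N) :=
  nonempty_toSing_iso_of_iso _ _ ((CochainComplex.singleFunctor (Rep.{u} k G) 0).mapIso e)

lemma nonempty_moduleSing_biprod_iso (M P : Rep.{u} k G) [Module.Finite k M.V]
    [Module.Finite k P.V] [Module.Finite k (M ⊞ P).V] (hP : Projective P) :
    Nonempty (moduleSing M ≅ moduleSing (M ⊞ P)) := by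
  let S : ShortComplex (Rep.{u} k G) :=
    ShortComplex.mk (biprod.inl : M ⟶ M ⊞ P) biprod.snd biprod.inl_snd
  have hS : S.ShortExact :=
    { exact := (ShortComplex.Splitting.ofHasBinaryBiproduct M P).exact
      mono_f := inferInstanceAs (Mono biprod.inl)
      epi_g := inferInstanceAs (Epi biprod.snd) }
  refine nonempty_toSing_iso _ _ ((CochainComplex.singleFunctor (Rep.{u} k G) 0).map biprod.inl)
    (ObjectProperty.trW.mk _ hS.singleTriangle_distinguished
      ⟨_, isBoundedFG_single P, fun i => ?_, ⟨Iso.refl _⟩⟩)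
  by_cases hi : i = 0
  · subst hi
    exact Projective.of_iso (singleX P).symm hP
  · exact (HomologicalComplex.isZero_single_obj_X (ComplexShape.up ℤ) 0 P i hi).projective

variable [Finite G]

/-- Stably isomorphic finitely generated modules are isomorphic in the singularity category. -/
theorem StableIso.nonempty_moduleSing_iso {M N : Rep.{u} k G} [Module.Finite k M.V]
    [Module.Finite k N.V] (h : StableIso M N) : Nonempty (moduleSing M ≅ moduleSing N) := by
  obtain ⟨P, Q, hP, hQ, ⟨e⟩⟩ := h
  let f : M ⟶ N := biprod.inl ≫ e.hom ≫ biprod.fst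
  let f' : N ⟶ M := biprod.inl ≫ e.inv ≫ biprod.fst
  let a : M ⟶ Q := biprod.inl ≫ e.hom ≫ biprod.snd
  have : Injective Q := injective_of_projective Q hQ
  have h1 : f ≫ f' + a ≫ biprod.inr ≫ e.inv ≫ biprod.fst = 𝟙 M := by
    have : biprod.inl ≫ e.hom ≫ (biprod.fst ≫ biprod.inl + biprod.snd ≫ biprod.inr) ≫ e.inv ≫
        biprod.fst = 𝟙 M := by
      rw [biprod.total, Category.id_comp, e.hom_inv_id_assoc, biprod.inl_fst]
    simpa only [f, f', a, Category.assoc, Preadditive.comp_add, Preadditive.add_comp] using this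
  have h2 : f' ≫ f + (biprod.inl ≫ e.inv ≫ biprod.snd) ≫ biprod.inr ≫ e.hom ≫ biprod.fst =
      𝟙 N := by
    have : biprod.inl ≫ e.inv ≫ (biprod.fst ≫ biprod.inl + biprod.snd ≫ biprod.inr) ≫ e.hom ≫
        biprod.fst = 𝟙 N := by
      rw [biprod.total, Category.id_comp, e.inv_hom_id_assoc, biprod.inl_fst]
    simpa only [f, f', Category.assoc, Preadditive.comp_add, Preadditive.add_comp] using this
  -- The projectives `P` and `Q` may be infinite-dimensional. Since `Q` is injective, the map `M ⟶
  -- Q` factors through the finite-dimensional coinduced module of `M`, which replaces it; the new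
  -- complement `K` is then finite-dimensional too.
  obtain ⟨K, hK, ⟨e'⟩⟩ := exists_iso_biprod f f' (toFunRep M)
    (Injective.factorThru a (toFunRep M) ≫ biprod.inr ≫ e.inv ≫ biprod.fst)
    (by rw [← Category.assoc (toFunRep M), Injective.comp_factorThru]; exact h1)
    (by
      rw [← h2, add_sub_cancel_left]
      exact FactorsThroughProjective.of_projective _ _)
  have i1 : Module.Finite k (N ⊞ Rep.of (funRep M)).V := finite_biprod _ _
  have i2 : Module.Finite k (M ⊞ K).V := finite_of_iso e'.symm
  have i3 : Module.Finite k K.V := finite_of_surjective (biprod.snd : M ⊞ K ⟶ K)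
    ((Rep.epi_iff_surjective _).1 inferInstance)
  obtain ⟨e1⟩ := nonempty_moduleSing_biprod_iso N (Rep.of (funRep M)) inferInstance
  obtain ⟨e2⟩ := nonempty_moduleSing_iso_of_iso e'
  obtain ⟨e3⟩ := nonempty_moduleSing_biprod_iso M K hK
  exact ⟨e3 ≪≫ e2.symm ≪≫ e1.symm⟩

end StableIsomorphism

/-! ### Tate cohomology of Sylow-trivial modules. -/

section TateLines

variable {p : ℕ} {k G : Type u} [Field k] [Group G] [Finite G]

lemma normMap_apply (M : Rep.{u} k G) (P : Subgroup G) [Fintype P] (m : M.V) :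
    normMap M P m = ∑ x : P, M.ρ x m := by
  rw [normMap, Subsingleton.elim (Fintype.ofFinite P) ‹_›, LinearMap.sum_apply]

lemma hom_normMap {M N : Rep.{u} k G} (f : M ⟶ N) (P : Subgroup G) (m : M.V) :
    f.hom (normMap M P m) = normMap N P (f.hom m) := by
  let _ := Fintype.ofFinite P
  rw [normMap_apply, normMap_apply]
  exact (map_sum f.hom _ _).trans (Finset.sum_congr rfl fun x _ => Rep.hom_comm_apply f x.1 m)

lemma hom_mem_range_normMap {M N : Rep.{u} k G} (f : M ⟶ N) {P : Subgroup G} {m : M.V}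
    (hm : m ∈ LinearMap.range (normMap M P)) : f.hom m ∈ LinearMap.range (normMap N P) := by
  obtain ⟨y, rfl⟩ := hm
  exact ⟨f.hom y, (hom_normMap f P y).symm⟩

lemma tate_mk_eq_zero {M : Rep.{u} k G} {P : Subgroup G} {m : M.V} (hm : m ∈ invariantsOf M P) :
    (Submodule.Quotient.mk ⟨m, hm⟩ : Tate0 M P) = 0 ↔ m ∈ LinearMap.range (normMap M P) :=
  Submodule.Quotient.mk_eq_zero _

lemma tate_mk_eq {M : Rep.{u} k G} {P : Subgroup G} {m n : M.V} (hm : m ∈ invariantsOf M P)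
    (hn : n ∈ invariantsOf M P) :
    (Submodule.Quotient.mk ⟨m, hm⟩ : Tate0 M P) = Submodule.Quotient.mk ⟨n, hn⟩ ↔
      m - n ∈ LinearMap.range (normMap M P) :=
  Submodule.Quotient.eq _

lemma exists_hom_sylow [Fact p.Prime] (S : Sylow p G) (hS : (S : Subgroup G) ≠ ⊥)
    (X : OrbitCat p G) : ∃ (f : X ⟶ ⟨⟨S, S.isPGroup', hS⟩⟩) (g : G),
      OrbitCat.toMap f ((1 : G) : G ⧸ X.sub.1) = (g : G ⧸ (S : Subgroup G)) := by
  obtain ⟨Q, hQ⟩ := X.sub.2.1.exists_le_sylow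
  obtain ⟨g, hg⟩ := MulAction.exists_smul_eq G Q S
  have h : SylowTriv.conjSub g X.sub ≤ ⟨S, S.isPGroup', hS⟩ := by
    rintro x ⟨y, hy, rfl⟩
    change _ ∈ (S : Subgroup G)
    rw [← hg]
    exact Subgroup.smul_mem_pointwise_smul y (MulAut.conj g) _ (hQ hy)
  exact ⟨orbitMap g X.sub _ h, 1 * g⁻¹, toMap_orbitMap g X.sub _ h 1⟩

section NearUnits

variable {S : Subgroup G} {M : Rep.{u} k G} {w : M.V} {ε : M.V →ₗ[k] k} {θ : M.V →ₗ[k] M.V}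

/-- The functional `ε ∘ g⁻¹` is `P`-invariant, so on a `P`-norm it takes a multiple of `|P|`, which
is zero in `k`. -/
lemma NearUnit.apply_normMap (h : NearUnit (Rep.res S.subtype M) w ε θ) {P : Subgroup G} {g : G}
    (hg : ∀ x ∈ P, g⁻¹ * x * g ∈ S) (hP : (Nat.card P : k) = 0) (y : M.V) :
    ε (M.ρ g⁻¹ (normMap M P y)) = 0 := by
  let _ := Fintype.ofFinite P
  rw [normMap_apply, map_sum, map_sum]
  have h1 : ∀ x : P, ε (M.ρ g⁻¹ (M.ρ x y)) = ε (M.ρ g⁻¹ y) := fun x => by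
    have h2 := h.ε_inv ⟨_, hg x x.2⟩ (M.ρ g⁻¹ y)
    refine Eq.trans (congrArg ε ?_) h2
    change _ = M.ρ (g⁻¹ * x * g) (M.ρ g⁻¹ y)
    simp [← Module.End.mul_apply, ← map_mul]
  rw [Finset.sum_congr rfl fun x _ => h1 x, Finset.sum_const, Finset.card_univ,
    ← Nat.card_eq_fintype_card, nsmul_eq_mul, hP, zero_mul]

/-- The element is the translate by `g` of the `S`-trace of `θ` at `g⁻¹ m`. Grouping the sum over
`S` by cosets of `g⁻¹Pg`, which fixes `g⁻¹ m`, exhibits a `P`-norm. -/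
lemma NearUnit.sub_mem_range_normMap (h : NearUnit (Rep.res S.subtype M) w ε θ) {P : Subgroup G}
    {g : G} (hg : ∀ x ∈ P, g⁻¹ * x * g ∈ S) {m : M.V} (hm : m ∈ invariantsOf M P) :
    m - ε (M.ρ g⁻¹ m) • M.ρ g w ∈ LinearMap.range (normMap M P) := by
  classical
  let _ := Fintype.ofFinite P
  let _ := Fintype.ofFinite S
  let R : Subgroup S := (P.map (MulAut.conj g⁻¹).toMonoidHom).subgroupOf S
  let _ := Fintype.ofFinite R
  let _ := Fintype.ofFinite (S ⧸ R)
  let e : R ≃ P :=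
    { toFun := fun r => ⟨g * r.1.1 * g⁻¹, by
        obtain ⟨y, hy, hy'⟩ := (Subgroup.mem_subgroupOf.1 r.2)
        rw [← hy']; simpa [mul_assoc] using hy⟩
      invFun := fun x => ⟨⟨g⁻¹ * x.1 * g, hg _ x.2⟩, Subgroup.mem_subgroupOf.2
        ⟨x.1, x.2, by simp⟩⟩
      left_inv := fun r => by ext; simp [mul_assoc]
      right_inv := fun r => by ext; simp [mul_assoc] }
  have h1 : m - ε (M.ρ g⁻¹ m) • M.ρ g w = M.ρ g (traceEnd (Rep.res S.subtype M) θ (M.ρ g⁻¹ m)) := by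
    rw [h.tr]
    refine Eq.trans ?_ (map_sub (M.ρ g) _ _).symm
    rw [map_smul, Representation.self_inv_apply]
  have h2 : traceEnd (Rep.res S.subtype M) θ (M.ρ g⁻¹ m) =
      ∑ s : S, M.ρ s.1⁻¹ (θ (M.ρ s.1 (M.ρ g⁻¹ m))) := by
    rw [traceEnd_apply]
    exact (Fintype.sum_equiv (Equiv.inv S) _ _ (fun x => by simp)).symm
  refine ⟨M.ρ g (∑ q : S ⧸ R, M.ρ q.out.1⁻¹ (θ (M.ρ q.out.1 (M.ρ g⁻¹ m)))), ?_⟩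
  rw [h1, h2, sum_eq_sum_quotient R (fun s : S => M.ρ s.1⁻¹ (θ (M.ρ s.1 (M.ρ g⁻¹ m)))),
    Finset.sum_comm, normMap_apply]
  refine Eq.symm ((map_sum (M.ρ g) _ _).trans
    (Fintype.sum_equiv ((Equiv.inv R).trans e) _ _ (fun r => ?_)))
  rw [map_sum, map_sum, map_sum]
  refine Finset.sum_congr rfl (fun q _ => ?_)
  have h3 : M.ρ (q.out * r.1 : S).1 (M.ρ g⁻¹ m) = M.ρ q.out.1 (M.ρ g⁻¹ m) := by
    have h4 : M.ρ (e r).1 m = m := mem_invariantsOf.1 hm _ (e r).2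
    conv_rhs => rw [← h4]
    simp [← Module.End.mul_apply, ← map_mul, e, mul_assoc]
  rw [h3]
  generalize θ (M.ρ q.out.1 (M.ρ g⁻¹ m)) = z
  simp [← Module.End.mul_apply, ← map_mul, e, mul_assoc]

lemma NearUnit.w_mem (h : NearUnit (Rep.res S.subtype M) w ε θ) : w ∈ invariantsOf M S :=
  mem_invariantsOf.2 fun x hx => h.w_inv ⟨x, hx⟩

/-- The class of a translate of `w` generates the Tate cohomology. -/
lemma NearUnit.tate_generator (h : NearUnit (Rep.res S.subtype M) w ε θ) {P : Subgroup G} {g : G}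
    (hg : ∀ x ∈ P, g⁻¹ * x * g ∈ S) (hP : (Nat.card P : k) = 0) :
    (Submodule.Quotient.mk ⟨M.ρ g w, rho_mem_invariantsOf M hg h.w_mem⟩ : Tate0 M P) ≠ 0 ∧
      ∀ z : Tate0 M P, ∃ c : k, c • (Submodule.Quotient.mk
        ⟨M.ρ g w, rho_mem_invariantsOf M hg h.w_mem⟩ : Tate0 M P) = z := by
  refine ⟨fun h0 => ?_, fun z => ?_⟩
  · obtain ⟨y, hy⟩ := (tate_mk_eq_zero _).1 h0
    have h1 := h.apply_normMap hg hP y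
    rw [hy, Representation.inv_self_apply] at h1
    exact one_ne_zero (h.ε_w.symm.trans h1)
  · obtain ⟨⟨m, hm⟩, rfl⟩ := Submodule.Quotient.mk_surjective _ z
    exact ⟨ε (M.ρ g⁻¹ m), ((tate_mk_eq hm (Submodule.smul_mem _ _
      (rho_mem_invariantsOf M hg h.w_mem))).2 (h.sub_mem_range_normMap hg hm)).symm⟩

/-- Modulo norms an invariant element `m` equals `ε m • w`, and `ε` kills norms; so `ε` detects
non-zero classes. -/
lemma NearUnit.notMem_iff (h : NearUnit (Rep.res S.subtype M) w ε θ) (hS : (Nat.card S : k) = 0)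
    {m : M.V} (hm : m ∈ invariantsOf M S) :
    m ∉ LinearMap.range (normMap M S) ↔ ε m ≠ 0 := by
  have h1 : ∀ x ∈ S, (1 : G)⁻¹ * x * 1 ∈ S := fun x hx => by simpa using hx
  have h2 := h.sub_mem_range_normMap h1 hm
  simp only [inv_one, map_one, Module.End.one_apply] at h2
  rw [not_iff_not]
  constructor
  · rintro ⟨y, rfl⟩
    simpa using h.apply_normMap h1 hS y
  · intro h0
    rw [h0, zero_smul, sub_zero] at h2
    exact h2

end NearUnits

section Generators

variable [Fact p.Prime] [CharP k p] {S : Sylow p G} (hS : (S : Subgroup G) ≠ ⊥) {M : Rep.{u} k G}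

include hS in
lemma IsSylowTrivial.finrank_tate (hM : IsSylowTrivial S M) (X : OrbitCat p G) :
    Module.finrank k (Tate0 M X.sub.1) = 1 := by
  obtain ⟨w, ε, θ, h⟩ := hM.exists_nearUnit
  obtain ⟨f, g, hg⟩ := exists_hom_sylow S hS X
  obtain ⟨h1, h2⟩ := h.tate_generator (conj_of_toMap f hg) (card_cast_eq_zero X.sub)
  exact finrank_eq_one _ h1 h2

include hS in
-- Both lines are generated by translates of `w`, and the induced map carries the translate by `g'`
-- to the one by `g * g'`.
lemma IsSylowTrivial.bijective_tateMap (hM : IsSylowTrivial S M) {X Y : OrbitCat p G}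
    (f : X ⟶ Y) : Function.Bijective (tateMap M f) := by
  obtain ⟨w, ε, θ, h⟩ := hM.exists_nearUnit
  obtain ⟨f', g', hg'⟩ := exists_hom_sylow S hS Y
  obtain ⟨g, hg⟩ := QuotientGroup.mk_surjective (OrbitCat.toMap f ((1 : G) : G ⧸ X.sub.1))
  have hc : OrbitCat.toMap (f ≫ f') ((1 : G) : G ⧸ X.sub.1) =
      ((g * g' : G) : G ⧸ (S : Subgroup G)) := by
    rw [OrbitCat.toMap_comp, ← hg, OrbitCat.toMap_mk, hg']; rfl
  obtain ⟨-, h2⟩ := h.tate_generator (conj_of_toMap f' hg') (card_cast_eq_zero Y.sub)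
  obtain ⟨h3, h4⟩ := h.tate_generator (conj_of_toMap (f ≫ f') hc) (card_cast_eq_zero X.sub)
  have h5 : tateMap M f (Submodule.Quotient.mk
      ⟨M.ρ g' w, rho_mem_invariantsOf M (conj_of_toMap f' hg') h.w_mem⟩) =
      Submodule.Quotient.mk
        ⟨M.ρ (g * g') w, rho_mem_invariantsOf M (conj_of_toMap (f ≫ f') hc) h.w_mem⟩ := by
    rw [tateMap_eq M f g hg.symm, tateMul_mk]
    congr 2
    rw [map_mul]; rfl
  refine ⟨(injective_iff_map_eq_zero _).2 fun z hz => ?_, fun z => ?_⟩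
  · obtain ⟨c, rfl⟩ := h2 z
    rw [map_smul, h5] at hz
    rw [(smul_eq_zero.1 hz).resolve_right h3, zero_smul]
  · obtain ⟨c, rfl⟩ := h4 z
    exact ⟨_, (map_smul _ c _).trans (congrArg (c • ·) h5)⟩

end Generators

end TateLines

/-! ### Cocycles and compatible systems of Tate generators. -/

section Systems

variable {p : ℕ} {k G : Type u} [Field k] [Group G] [Finite G]

lemma exists_isTateCocycle (M : Rep.{u} k G)
    (hM : ∀ {X Y : OrbitCat p G} (f : X ⟶ Y), Function.Bijective (tateMap M f))
    (b : ∀ X : OrbitCat p G, k ≃ₗ[k] (tateFunctor p M).obj (op X)) :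
    ∃ φ : Z1 (OrbitCat p G) kˣ, IsTateCocycle M b φ := by
  let b' : ∀ X : OrbitCat p G, k ≃ₗ[k] Tate0 M X.sub.1 := b
  let s : ∀ {X Y : OrbitCat p G} (f : X ⟶ Y), k := fun {X Y} f =>
    (b' X).symm (tateMap M f (b' Y 1))
  have hs : ∀ {X Y : OrbitCat p G} (f : X ⟶ Y), tateMap M f (b' Y 1) = s f • b' X 1 :=
    fun {X Y} f => by
      rw [← map_smul, smul_eq_mul, mul_one]
      exact ((b' X).apply_symm_apply _).symm
  have hb : ∀ X, b' X 1 ≠ 0 := fun X => (map_ne_zero_iff _ (b' X).injective).2 one_ne_zero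
  have hs0 : ∀ {X Y : OrbitCat p G} (f : X ⟶ Y), s f ≠ 0 := fun {X Y} f h0 => by
    have h1 := hs f
    rw [h0, zero_smul] at h1
    exact hb Y ((map_eq_zero_iff _ (hM f).1).1 h1)
  have hcomp : ∀ {X Y Z : OrbitCat p G} (f : X ⟶ Y) (g : Y ⟶ Z), s (f ≫ g) = s g * s f :=
    fun {X Y Z} f g => by
      have h1 := hs (f ≫ g)
      rw [tateMap_comp, LinearMap.comp_apply, hs g, map_smul, hs f, smul_smul] at h1
      exact (smul_left_injective k (hb X) h1).symm
  refine ⟨⟨fun X Y f => Units.mk0 (s f) (hs0 f), ?_⟩, fun X Y f => hs f⟩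
  rw [MonoidHom.mem_ker]
  funext X Y Z f g
  change Units.mk0 (s g) (hs0 g) / Units.mk0 (s (f ≫ g)) (hs0 _) * Units.mk0 (s f) (hs0 f) = 1
  rw [div_mul_eq_mul_div, div_eq_one]
  exact Units.ext (hcomp f g).symm

/-- A system of invariant elements of `M` which represents generators of the lines `Ĥ⁰(P; M)` and
transforms according to the cocycle `φ`. -/
structure IsTateSystem (S : PSub p G) (M : Rep.{u} k G) (φ : Z1 (OrbitCat p G) kˣ)
    (m : OrbitCat p G → M.V) : Prop where
  mem : ∀ X, m X ∈ invariantsOf M X.sub.1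
  compat : ∀ (X Y : OrbitCat p G) (f : X ⟶ Y) (g : G),
    OrbitCat.toMap f ((1 : G) : G ⧸ X.sub.1) = (g : G ⧸ Y.sub.1) →
      M.ρ g (m Y) - (φ.1 X Y f : k) • m X ∈ LinearMap.range (normMap M X.sub.1)
  notMem : m ⟨S⟩ ∉ LinearMap.range (normMap M S.1)

lemma IsTateCocycle.exists_isTateSystem {M : Rep.{u} k G}
    {b : ∀ X : OrbitCat p G, k ≃ₗ[k] (tateFunctor p M).obj (op X)} {φ : Z1 (OrbitCat p G) kˣ}
    (h : IsTateCocycle M b φ) (S : PSub p G) : ∃ m, IsTateSystem S M φ m := by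
  let b' : ∀ X : OrbitCat p G, k ≃ₗ[k] Tate0 M X.sub.1 := b
  choose m hm using fun X => Submodule.Quotient.mk_surjective _ (b' X 1)
  refine ⟨fun X => (m X).1, fun X => (m X).2, fun X Y f g hg => ?_, fun h0 => ?_⟩
  · have h1 : tateMap M f (b' Y 1) = (φ.1 X Y f : k) • b' X 1 := h X Y f
    rw [tateMap_eq M f g hg, ← hm X, ← hm Y, tateMul_mk] at h1
    exact (tate_mk_eq _ (Submodule.smul_mem _ _ (m X).2)).1 h1
  · have h1 : b' ⟨S⟩ 1 = 0 := (hm ⟨S⟩).symm.trans ((tate_mk_eq_zero (m ⟨S⟩).2).2 h0)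
    exact one_ne_zero ((map_eq_zero_iff _ (b' ⟨S⟩).injective).1 h1)

variable {S : PSub p G}

/-- Equivariant maps preserve norms. For non-vanishing, `f ≫ f' - 1` changes the invariant element
at `S` by a norm only, so if its image under `f` were a norm, so would be the element. -/
lemma IsTateSystem.hom {M N : Rep.{u} k G} {φ : Z1 (OrbitCat p G) kˣ} {m : OrbitCat p G → M.V}
    (h : IsTateSystem S M φ m) (f : M ⟶ N) (f' : N ⟶ M)
    (hf : FactorsThroughProjective (f ≫ f' - 𝟙 M)) :
    IsTateSystem S N φ (fun X => f.hom (m X)) where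
  mem X := hom_mem_invariantsOf f (h.mem X)
  compat X Y a g hg := by
    have h1 := hom_mem_range_normMap f (h.compat X Y a g hg)
    rwa [map_sub, map_smul, Rep.hom_comm_apply] at h1
  notMem h0 := by
    let _ := Fintype.ofFinite G
    obtain ⟨θ, hθ⟩ := hf.exists_trace
    have h1 := sum_mem_range_normMap (N := M) θ S.1 (h.mem ⟨S⟩)
    rw [← hθ] at h1
    have h2 := Submodule.sub_mem _ (hom_mem_range_normMap f' h0) h1
    refine h.notMem ?_
    have h3 : (f ≫ f' - 𝟙 M).hom (m ⟨S⟩) = f'.hom (f.hom (m ⟨S⟩)) - m ⟨S⟩ := rfl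
    rwa [h3, sub_sub_cancel] at h2

lemma IsTateSystem.stableIso {M N : Rep.{u} k G} {φ : Z1 (OrbitCat p G) kˣ}
    {m : OrbitCat p G → M.V} (h : IsTateSystem S M φ m) (e : StableIso M N) :
    ∃ n, IsTateSystem S N φ n := by
  obtain ⟨P, Q, hP, hQ, ⟨e⟩⟩ := e
  refine ⟨_, h.hom (biprod.inl ≫ e.hom ≫ biprod.fst) (biprod.inl ≫ e.inv ≫ biprod.fst) ?_⟩
  have h1 : (biprod.inl ≫ e.hom ≫ biprod.fst) ≫ biprod.inl ≫ e.inv ≫ biprod.fst +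
      (biprod.inl ≫ e.hom ≫ biprod.snd) ≫ biprod.inr ≫ e.inv ≫ biprod.fst = 𝟙 M := by
    have : biprod.inl ≫ e.hom ≫ (biprod.fst ≫ biprod.inl + biprod.snd ≫ biprod.inr) ≫ e.inv ≫
        biprod.fst = 𝟙 M := by
      rw [biprod.total, Category.id_comp, e.hom_inv_id_assoc, biprod.inl_fst]
    simpa only [Category.assoc, Preadditive.comp_add, Preadditive.add_comp] using this
  rw [← h1, sub_add_cancel_left, ← Preadditive.neg_comp]
  exact FactorsThroughProjective.of_projective _ _

open scoped TensorProduct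

/-- For invariant `n`, the norm of `y ⊗ n` is the norm of `y` tensored with `n`. -/
lemma tmul_mem_range_normMap_left {M N : Rep.{u} k G} {P : Subgroup G} {m : M.V} {n : N.V}
    (hm : m ∈ LinearMap.range (normMap M P)) (hn : n ∈ invariantsOf N P) :
    (m ⊗ₜ[k] n : M.V ⊗[k] N.V) ∈ LinearMap.range (normMap (M ⊗ N) P) := by
  let _ := Fintype.ofFinite P
  obtain ⟨y, rfl⟩ := hm
  refine ⟨(y ⊗ₜ[k] n : M.V ⊗[k] N.V), ?_⟩
  rw [normMap_apply, normMap_apply, TensorProduct.sum_tmul]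
  refine Finset.sum_congr rfl fun x _ => ?_
  exact congrArg (fun t => (M.ρ x.1 y ⊗ₜ[k] t : M.V ⊗[k] N.V)) (mem_invariantsOf.1 hn x.1 x.2)

lemma tmul_mem_range_normMap_right {M N : Rep.{u} k G} {P : Subgroup G} {m : M.V} {n : N.V}
    (hm : m ∈ invariantsOf M P) (hn : n ∈ LinearMap.range (normMap N P)) :
    (m ⊗ₜ[k] n : M.V ⊗[k] N.V) ∈ LinearMap.range (normMap (M ⊗ N) P) := by
  let _ := Fintype.ofFinite P
  obtain ⟨y, rfl⟩ := hn
  refine ⟨(m ⊗ₜ[k] y : M.V ⊗[k] N.V), ?_⟩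
  rw [normMap_apply, normMap_apply, TensorProduct.tmul_sum]
  refine Finset.sum_congr rfl fun x _ => ?_
  exact congrArg (fun t => (t ⊗ₜ[k] N.ρ x.1 y : M.V ⊗[k] N.V)) (mem_invariantsOf.1 hm x.1 x.2)

/-- The error `gm ⊗ gn - φψ (m ⊗ n)` splits as `(gm - φm) ⊗ gn + φm ⊗ (gn - ψn)`, a sum of norms.
The class at `S` is non-zero because the functional of the tensor product takes the product of two
non-zero values. -/
lemma IsTateSystem.tensor {M N : Rep.{u} k G} {φ ψ : Z1 (OrbitCat p G) kˣ}
    {m : OrbitCat p G → M.V} {n : OrbitCat p G → N.V} (hM : IsTateSystem S M φ m)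
    (hN : IsTateSystem S N ψ n) (h0 : (Nat.card S.1 : k) = 0) {w : M.V} {ε : M.V →ₗ[k] k}
    {θ : M.V →ₗ[k] M.V} (h : NearUnit (Rep.res S.1.subtype M) w ε θ) {w' : N.V}
    {ε' : N.V →ₗ[k] k} {θ' : N.V →ₗ[k] N.V} (h' : NearUnit (Rep.res S.1.subtype N) w' ε' θ') :
    IsTateSystem S (M ⊗ N) (φ * ψ) (fun X => (m X ⊗ₜ[k] n X : M.V ⊗[k] N.V)) where
  mem X := by
    rw [mem_invariantsOf]
    intro x hx
    exact congrArg₂ (fun a b => (a ⊗ₜ[k] b : M.V ⊗[k] N.V))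
      (mem_invariantsOf.1 (hM.mem X) x hx) (mem_invariantsOf.1 (hN.mem X) x hx)
  compat X Y f g hg := by
    have h1 := tmul_mem_range_normMap_left (hM.compat X Y f g hg)
      (rho_mem_invariantsOf N (conj_of_toMap f hg) (hN.mem Y))
    have h2 := tmul_mem_range_normMap_right (Submodule.smul_mem _ (φ.1 X Y f : k) (hM.mem X))
      (hN.compat X Y f g hg)
    have h3 := Submodule.add_mem _ h1 h2
    refine (congrArg (· ∈ LinearMap.range (normMap (M ⊗ N) X.sub.1)) ?_).mpr h3
    change (M.ρ g (m Y) ⊗ₜ[k] N.ρ g (n Y) : M.V ⊗[k] N.V) -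
      ((φ.1 X Y f * ψ.1 X Y f : kˣ) : k) • (m X ⊗ₜ[k] n X : M.V ⊗[k] N.V) =
      ((M.ρ g (m Y) - (φ.1 X Y f : k) • m X) ⊗ₜ[k] N.ρ g (n Y) : M.V ⊗[k] N.V) +
      (((φ.1 X Y f : k) • m X) ⊗ₜ[k] (N.ρ g (n Y) - (ψ.1 X Y f : k) • n X) : M.V ⊗[k] N.V)
    rw [TensorProduct.sub_tmul, TensorProduct.tmul_sub, TensorProduct.smul_tmul_smul,
      Units.val_mul]
    abel
  notMem := by
    have h3 : NearUnit (Rep.res S.1.subtype (M ⊗ N)) (w ⊗ₜ[k] w' : M.V ⊗[k] N.V)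
      (LinearMap.mul' k k ∘ₗ TensorProduct.map ε ε') _ := h.tensor h'
    refine (h3.notMem_iff h0 ?_).2 ?_
    · rw [mem_invariantsOf]
      intro x hx
      exact congrArg₂ (fun a b => (a ⊗ₜ[k] b : M.V ⊗[k] N.V))
        (mem_invariantsOf.1 (hM.mem ⟨S⟩) x hx) (mem_invariantsOf.1 (hN.mem ⟨S⟩) x hx)
    · exact mul_ne_zero ((h.notMem_iff h0 (hM.mem ⟨S⟩)).1 hM.notMem)
        ((h'.notMem_iff h0 (hN.mem ⟨S⟩)).1 hN.notMem)

end Systems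

/-! ### The cohomology class and its multiplicativity. -/

section Classes

variable {p : ℕ} {k G : Type u} [Field k] [Group G] [Finite G] [Fact p.Prime] [CharP k p]
  {S : Sylow p G} (hS : (S : Subgroup G) ≠ ⊥)

/-- The Sylow subgroup as a non-trivial `p`-subgroup. -/
abbrev sylowPSub : PSub p G := ⟨S, S.isPGroup', hS⟩

/-- Two systems generate the same lines, so they differ by a non-zero scalar `c X` for each object,
and the two cocycles differ by the coboundary of `c⁻¹`. -/
lemma IsSylowTrivial.class_eq {M : Rep.{u} k G} (hM : IsSylowTrivial S M)
    {φ ψ : Z1 (OrbitCat p G) kˣ} {m n : OrbitCat p G → M.V}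
    (hm : IsTateSystem (sylowPSub hS) M φ m) (hn : IsTateSystem (sylowPSub hS) M ψ n) :
    (φ : H1 (OrbitCat p G) kˣ) = (ψ : H1 (OrbitCat p G) kˣ) := by
  let v : ∀ {φ : Z1 (OrbitCat p G) kˣ} {m : OrbitCat p G → M.V},
      IsTateSystem (sylowPSub hS) M φ m → ∀ X : OrbitCat p G, Tate0 M X.sub.1 := fun {_ m} h X =>
    Submodule.Quotient.mk ⟨m X, h.mem X⟩
  have hv : ∀ {φ : Z1 (OrbitCat p G) kˣ} {m : OrbitCat p G → M.V}
      (h : IsTateSystem (sylowPSub hS) M φ m) {X Y : OrbitCat p G} (f : X ⟶ Y),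
      tateMap M f (v h Y) = (φ.1 X Y f : k) • v h X := fun {φ m} h X Y f => by
    obtain ⟨g, hg⟩ := QuotientGroup.mk_surjective (OrbitCat.toMap f ((1 : G) : G ⧸ X.sub.1))
    rw [tateMap_eq M f g hg.symm]
    exact (tate_mk_eq _ (Submodule.smul_mem _ _ (h.mem X))).2 (h.compat X Y f g hg.symm)
  -- Non-vanishing at `S` suffices: a morphism `G/X → G/S` induces an injection from the line at `S`
  -- that sends the generator to a multiple of the element at `X`.
  have hv0 : ∀ {φ : Z1 (OrbitCat p G) kˣ} {m : OrbitCat p G → M.V}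
      (h : IsTateSystem (sylowPSub hS) M φ m) (X : OrbitCat p G), v h X ≠ 0 := fun {φ m} h X h0 => by
    obtain ⟨f, -⟩ := exists_hom_sylow S hS X
    have h1 := hv h f
    rw [h0, smul_zero] at h1
    exact h.notMem ((tate_mk_eq_zero _).1
      ((map_eq_zero_iff _ (hM.bijective_tateMap hS f).1).1 h1))
  choose c hc using fun X => exists_smul_eq_of_finrank_eq_one (hM.finrank_tate hS X) (hv0 hn X)
    (v hm X)
  have hc0 : ∀ X, c X ≠ 0 := fun X h0 => hv0 hm X (by rw [← hc X, h0, zero_smul])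
  have h1 : ∀ (X Y : OrbitCat p G) (f : X ⟶ Y),
      (φ.1 X Y f : k) * c X = c Y * (ψ.1 X Y f : k) := fun X Y f => by
    have h2 := hv hm f
    rw [← hc X, ← hc Y, map_smul, hv hn f, smul_smul, smul_smul] at h2
    exact (smul_left_injective k (hv0 hn X) h2).symm
  refine QuotientGroup.eq.2 (Subgroup.mem_subgroupOf.2 ⟨fun X => (Units.mk0 (c X) (hc0 X))⁻¹, ?_⟩)
  funext X Y f
  change (Units.mk0 (c Y) (hc0 Y))⁻¹ / (Units.mk0 (c X) (hc0 X))⁻¹ = (φ.1 X Y f)⁻¹ * ψ.1 X Y f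
  rw [inv_div_inv, div_eq_iff_eq_mul, mul_assoc, eq_inv_mul_iff_mul_eq]
  refine Units.ext ?_
  rw [Units.val_mul, Units.val_mul, Units.val_mk0, Units.val_mk0, h1, mul_comm]

include hS in
lemma IsSylowTrivial.exists_isTateSystem {M : Rep.{u} k G} (hM : IsSylowTrivial S M) :
    ∃ φ m, IsTateSystem (sylowPSub hS) M φ m := by
  have b : ∀ X : OrbitCat p G, k ≃ₗ[k] (tateFunctor p M).obj (op X) := fun X =>
    have h1 := hM.finrank_tate hS X
    have : Nontrivial (Tate0 M X.sub.1) := Module.nontrivial_of_finrank_eq_succ h1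
    let v := (exists_ne (0 : Tate0 M X.sub.1)).choose
    have hv : v ≠ 0 := (exists_ne (0 : Tate0 M X.sub.1)).choose_spec
    LinearEquiv.ofBijective (LinearMap.toSpanSingleton k (Tate0 M X.sub.1) v)
      ⟨smul_left_injective k hv, exists_smul_eq_of_finrank_eq_one h1 hv⟩
  obtain ⟨φ, hφ⟩ := exists_isTateCocycle M (hM.bijective_tateMap hS) b
  exact ⟨φ, hφ.exists_isTateSystem _⟩

/-- The cohomology class of a Sylow-trivial module. -/
def tateClass {M : Rep.{u} k G} (hM : IsSylowTrivial S M) : H1 (OrbitCat p G) kˣ :=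
  ((hM.exists_isTateSystem hS).choose : Z1 (OrbitCat p G) kˣ)

lemma IsTateSystem.tateClass_eq {M : Rep.{u} k G} (hM : IsSylowTrivial S M)
    {φ : Z1 (OrbitCat p G) kˣ} {m : OrbitCat p G → M.V}
    (hm : IsTateSystem (sylowPSub hS) M φ m) : tateClass hS hM = φ :=
  hM.class_eq hS (hM.exists_isTateSystem hS).choose_spec.choose_spec hm

/-- The homomorphism from the group of Sylow-trivial modules to `H¹`. -/
def tateClassHom : SylowTrivialGroup k S →* H1 (OrbitCat p G) kˣ :=
  MonoidHom.mk' (Quotient.lift (fun M => tateClass hS M.2) (by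
    rintro ⟨M, hM⟩ ⟨N, hN⟩ e
    obtain ⟨φ, m, hm⟩ := hM.exists_isTateSystem hS
    obtain ⟨n, hn⟩ := hm.stableIso e
    exact (hm.tateClass_eq hS hM).trans (hn.tateClass_eq hS hN).symm)) (by
    intro a b
    induction a using Quotient.inductionOn with | h M => ?_
    induction b using Quotient.inductionOn with | h N => ?_
    obtain ⟨M, hM⟩ := M
    obtain ⟨N, hN⟩ := N
    obtain ⟨φ, m, hm⟩ := hM.exists_isTateSystem hS
    obtain ⟨ψ, n, hn⟩ := hN.exists_isTateSystem hS
    obtain ⟨w, ε, θ, h⟩ := hM.exists_nearUnit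
    obtain ⟨w', ε', θ', h'⟩ := hN.exists_nearUnit
    have h1 := hm.tensor hn (card_cast_eq_zero (sylowPSub hS)) h h'
    exact (h1.tateClass_eq hS (hM.tensor hN)).trans (congrArg₂ (· * ·)
      (hm.tateClass_eq hS hM).symm (hn.tateClass_eq hS hN).symm))

lemma tateClassHom_mk {M : Rep.{u} k G} (hM : IsSylowTrivial S M) {φ : Z1 (OrbitCat p G) kˣ}
    {m : OrbitCat p G → M.V} (hm : IsTateSystem (sylowPSub hS) M φ m) :
    tateClassHom hS (SylowTrivialGroup.mk M hM) = φ :=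
  hm.tateClass_eq hS hM

end Classes

/-! ### Injectivity of the class map. -/

section Injectivity

variable {p : ℕ} {k G : Type u} [Field k] [Group G] [Finite G]

/-- The correction of `θ` has trace `(ε' - ε)(m - ε m • w) • w`, which is `(ε' m - ε m) • w` because
both functionals are `1` at `w`. -/
lemma NearUnit.change {M : Rep.{u} k G} {w : M.V} {ε ε' : M.V →ₗ[k] k} {θ : M.V →ₗ[k] M.V}
    (h : NearUnit M w ε θ) (hε : ∀ g m, ε' (M.ρ g m) = ε' m) (hw : ε' w = 1) :
    NearUnit M w ε' (θ - ((ε' - ε) ∘ₗ θ).smulRight w) where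
  w_inv := h.w_inv
  ε_inv := hε
  ε_w := hw
  tr m := by
    let _ := Fintype.ofFinite G
    have h1 := h.tr m
    rw [traceEnd_apply] at h1 ⊢
    have h2 : ∀ g : G, M.ρ g ((θ - ((ε' - ε) ∘ₗ θ).smulRight w) (M.ρ g⁻¹ m)) =
        M.ρ g (θ (M.ρ g⁻¹ m)) - (ε' - ε) (M.ρ g (θ (M.ρ g⁻¹ m))) • w := fun g => by
      simp [hε, h.ε_inv, h.w_inv, sub_smul]
    rw [Finset.sum_congr rfl fun g _ => h2 g, Finset.sum_sub_distrib, ← Finset.sum_smul,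
      ← map_sum, h1]
    simp [hw, h.ε_w, sub_smul]

/-- The sum of a function which is invariant under a `p`-group and vanishes at the fixed points is
zero in characteristic `p`. -/
lemma sum_eq_zero_of_fixedPoints {α : Type*} [Fintype α] [Fact p.Prime] [CharP k p] {H : Type*}
    [Group H] [Finite H] (hH : IsPGroup p H) [MulAction H α] (F : α → k)
    (hF : ∀ (h : H) x, F (h • x) = F x) (h0 : ∀ x ∈ MulAction.fixedPoints H α, F x = 0) :
    ∑ x, F x = 0 := by
  classical
  rw [← Finset.sum_fiberwise_of_maps_to (t := Finset.univ.image F)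
    (fun x _ => Finset.mem_image_of_mem F (Finset.mem_univ x))]
  refine Finset.sum_eq_zero fun c _ => ?_
  rw [Finset.sum_congr rfl (fun x hx => (Finset.mem_filter.1 hx).2), Finset.sum_const, nsmul_eq_mul]
  by_cases hc : c = 0
  · rw [hc, mul_zero]
  -- The fibre of `F` over a non-zero value is `H`-stable without fixed points, so its cardinality
  -- is divisible by `p`.
  let T : SubMulAction H α := ⟨{x | F x = c}, fun h {x} hx => (hF h x).trans hx⟩
  have h1 : IsEmpty (MulAction.fixedPoints H T) := ⟨fun x => hc (by
    have h2 : F x.1.1 = c := x.1.2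
    rw [← h2]
    exact h0 _ fun h => congrArg Subtype.val (x.2 h))⟩
  have h2 := hH.card_modEq_card_fixedPoints T
  rw [Nat.card_of_isEmpty (α := MulAction.fixedPoints H T)] at h2
  have h3 : Nat.card T = (Finset.univ.filter fun x => F x = c).card := by
    rw [Nat.card_eq_fintype_card]
    exact Fintype.card_subtype (fun x => F x = c)
  rw [← h3, (CharP.cast_eq_zero_iff k p _).2 ((Nat.modEq_zero_iff_dvd).1 h2), zero_mul]

variable [Fact p.Prime] [CharP k p] {S : Sylow p G}

/-- A Sylow-trivial module is stably trivial if the normalizer of `S` acts trivially on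
`Ĥ⁰(S; M)`. -/
lemma stableIso_unit_of_normalizer {M : Rep.{u} k G} {w : M.V} {ε : M.V →ₗ[k] k}
    {θ : M.V →ₗ[k] M.V} (hS : (S : Subgroup G) ≠ ⊥)
    (h : NearUnit (Rep.res (S : Subgroup G).subtype M) w ε θ)
    (hN : ∀ g : G, (∀ x ∈ (S : Subgroup G), g⁻¹ * x * g ∈ (S : Subgroup G)) →
      M.ρ g w - w ∈ LinearMap.range (normMap M (S : Subgroup G))) :
    StableIso M (𝟙_ (Rep.{u} k G)) := by
  classical
  let _ := Fintype.ofFinite G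
  let _ := Fintype.ofFinite (G ⧸ (S : Subgroup G))
  have hcard : (Nat.card (S : Subgroup G) : k) = 0 := card_cast_eq_zero (sylowPSub hS)
  let n : k := ((S : Subgroup G).index : k)
  have hn : n ≠ 0 := fun h0 => S.not_dvd_index ((CharP.cast_eq_zero_iff k p _).1 h0)
  have hn' : (Fintype.card (G ⧸ (S : Subgroup G)) : k) = n := by
    simp only [n, Subgroup.index, Nat.card_eq_fintype_card]
  have hinv : ∀ s ∈ (S : Subgroup G), ∀ m, ε (M.ρ s m) = ε m := fun s hs m => h.ε_inv ⟨s, hs⟩ m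
  have hout : ∀ (a b : G) (m : M.V), (a : G ⧸ (S : Subgroup G)) = b →
      ε (M.ρ a⁻¹ m) = ε (M.ρ b⁻¹ m) := fun a b m hab => by
    rw [← hinv _ (QuotientGroup.eq.1 hab.symm) (M.ρ a⁻¹ m)]
    simp [← Module.End.mul_apply, ← map_mul]
  -- As `ε` is `S`-invariant, `ε ∘ g⁻¹` depends only on the coset `gS`; the average over cosets is
  -- therefore `G`-invariant.
  let E : M.V →ₗ[k] k := n⁻¹ • ∑ q : G ⧸ (S : Subgroup G), ε ∘ₗ M.ρ q.out⁻¹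
  have hE : ∀ m, E m = n⁻¹ * ∑ q : G ⧸ (S : Subgroup G), ε (M.ρ q.out⁻¹ m) := fun m => by
    simp [E]
  have hEinv : ∀ g m, E (M.ρ g m) = E m := fun g m => by
    rw [hE, hE]
    congr 1
    refine Fintype.sum_equiv (MulAction.toPerm g⁻¹) _ _ fun q => ?_
    have h1 : ((g⁻¹ * q.out : G) : G ⧸ (S : Subgroup G)) =
        (((MulAction.toPerm g⁻¹ q : G ⧸ (S : Subgroup G)).out : G) : G ⧸ (S : Subgroup G)) := by
      rw [QuotientGroup.out_eq']
      conv_rhs => rw [← QuotientGroup.out_eq' q]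
      rfl
    rw [← hout _ _ m h1]
    simp [← Module.End.mul_apply, ← map_mul]
  have hEw : E w = 1 := by
    -- The summand is an `S`-invariant function on `G/S`. At a coset fixed by `S` the representative
    -- `g` satisfies `g⁻¹Sg ≤ S`, so `g w - w` is a norm by `hN`, and applying `ε ∘ g⁻¹` gives `ε
    -- (g⁻¹ w) = 1`.
    have h1 : ∑ q : G ⧸ (S : Subgroup G), (ε (M.ρ q.out⁻¹ w) - 1) = 0 := by
      refine sum_eq_zero_of_fixedPoints (p := p) (H := (S : Subgroup G)) S.isPGroup' _ ?_ ?_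
      · intro s q
        have h2 : ((s.1 * q.out : G) : G ⧸ (S : Subgroup G)) = (((s • q).out : G) :
            G ⧸ (S : Subgroup G)) := by
          rw [QuotientGroup.out_eq']
          conv_rhs => rw [← QuotientGroup.out_eq' q]
          rfl
        have h3 : M.ρ s.1⁻¹ w = w := h.w_inv s⁻¹
        rw [← hout _ _ w h2, mul_inv_rev, map_mul, Module.End.mul_apply, h3]
      · intro q hq
        have hg : ∀ x ∈ (S : Subgroup G), q.out⁻¹ * x * q.out ∈ (S : Subgroup G) := fun x hx => by
          have h2 : ((q.out : G) : G ⧸ (S : Subgroup G)) = ((x * q.out : G) :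
              G ⧸ (S : Subgroup G)) := by
            have h3 := hq ⟨x, hx⟩
            rw [QuotientGroup.out_eq']
            conv_lhs => rw [← h3, ← QuotientGroup.out_eq' q]
            rfl
          simpa [mul_assoc] using QuotientGroup.eq.1 h2
        obtain ⟨y, hy⟩ := hN _ hg
        have h4 := h.apply_normMap hg hcard y
        rw [hy, map_sub, Representation.inv_self_apply, map_sub, h.ε_w] at h4
        rw [← neg_sub, h4, neg_zero]
    rw [Finset.sum_sub_distrib, sub_eq_zero] at h1
    rw [hE, h1, Finset.sum_const, Finset.card_univ, nsmul_eq_mul, mul_one, hn',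
      inv_mul_cancel₀ hn]
  obtain ⟨P, hP, ⟨e⟩⟩ := exists_iso_of_sylow (S := S) M hEinv
    (h.change (fun g m => hEinv g.1 m) hEw)
  exact stableIso_of_iso_biprod e

/-- A coboundary takes the value `c / c = 1` on endomorphisms of `G/S`. So the normalizer of `S`
fixes the generator of `Ĥ⁰(S; M)`, and `stableIso_unit_of_normalizer` applies. -/
lemma tateClassHom_injective (hS : (S : Subgroup G) ≠ ⊥) :
    Function.Injective (tateClassHom (k := k) hS) := by
  rw [injective_iff_map_eq_one]
  intro a ha
  induction a using Quotient.inductionOn with | h M => ?_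
  obtain ⟨M, hM⟩ := M
  obtain ⟨φ, m, hm⟩ := hM.exists_isTateSystem hS
  have h1 : (φ : H1 (OrbitCat p G) kˣ) = 1 := (tateClassHom_mk hS hM hm).symm.trans ha
  obtain ⟨c, hc⟩ := Subgroup.mem_subgroupOf.1 ((QuotientGroup.eq_one_iff φ).1 h1)
  obtain ⟨w, ε, θ, h⟩ := hM.exists_nearUnit
  let X : OrbitCat p G := ⟨sylowPSub hS⟩
  have hφ : ∀ f : X ⟶ X, φ.1 X X f = 1 := fun f =>
    (congrFun (congrFun (congrFun hc X) X) f).symm.trans (div_self' (c X))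
  have hcard : (Nat.card (S : Subgroup G) : k) = 0 := card_cast_eq_zero (sylowPSub hS)
  have hε0 : ε (m X) ≠ 0 := (h.notMem_iff hcard (hm.mem X)).1 hm.notMem
  -- Modulo norms `w` is a multiple of the system's element at `S`, so the invariance of the latter
  -- under the normalizer passes to `w`.
  have hw : w - (ε (m X))⁻¹ • m X ∈ LinearMap.range (normMap M (S : Subgroup G)) := by
    have h2 := h.sub_mem_range_normMap (P := (S : Subgroup G)) (g := 1)
      (fun x hx => by simpa using hx) (hm.mem X)
    simp only [inv_one, map_one, Module.End.one_apply] at h2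
    have h3 := Submodule.smul_mem _ (-(ε (m X))⁻¹) h2
    rwa [smul_sub, smul_smul, neg_mul, inv_mul_cancel₀ hε0, neg_smul, neg_smul, one_smul,
      sub_neg_eq_add, neg_add_eq_sub] at h3
  refine Quotient.sound (stableIso_unit_of_normalizer hS h fun g hg => ?_)
  have hg' : SylowTriv.conjSub g⁻¹ X.sub ≤ X.sub := fun x hx => by
    rw [mem_conjSub_iff] at hx
    have h4 : (S : Subgroup G).map (MulAut.conj g⁻¹).toMonoidHom = (S : Subgroup G) := by
      refine Subgroup.eq_of_le_of_card_ge ?_ ?_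
      · rintro _ ⟨y, hy, rfl⟩
        simpa using hg y hy
      · rw [Subgroup.card_map_of_injective (MulAut.conj g⁻¹).injective]
    have h5 : x ∈ (S : Subgroup G).map (MulAut.conj g⁻¹).toMonoidHom :=
      ⟨_, hx, by simp [mul_assoc]⟩
    rwa [h4] at h5
  have h6 := hm.compat X X (orbitMap g⁻¹ X.sub X.sub hg') g (by
    refine (toMap_orbitMap g⁻¹ X.sub X.sub hg' 1).trans ?_
    rw [inv_inv, one_mul])
  rw [hφ, Units.val_one, one_smul] at h6
  have h7 := Submodule.smul_mem _ (ε (m X))⁻¹ h6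
  obtain ⟨y, hy⟩ := hw
  have h8 : M.ρ g (w - (ε (m X))⁻¹ • m X) ∈ LinearMap.range (normMap M (S : Subgroup G)) := by
    rw [← hy]
    exact normMap_mem M _ _ g hg y
  have h9 := Submodule.sub_mem _ (Submodule.add_mem _ h8 h7) (hy ▸ LinearMap.mem_range_self _ y)
  refine (congrArg (· ∈ LinearMap.range (normMap M (S : Subgroup G))) ?_).mpr h9
  rw [map_sub, map_smul, smul_sub]
  abel

end Injectivity

/-! ### Surjectivity and the isomorphism. -/

section Main

variable {p : ℕ} {k G : Type u} [Field k] [Group G] [Finite G] [Fact p.Prime] [CharP k p]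
  {S : Sylow p G} (hS : (S : Subgroup G) ≠ ⊥)

/-- A module isomorphic to the twisted Steinberg complex in the singularity category is
Sylow-trivial with class `φ`. -/
lemma exists_isSylowTrivial_of_iso {φ : Z1 (OrbitCat p G) kˣ} (M : Rep.{u} k G)
    [Module.Finite k M.V] (e : moduleSing M ≅ steinbergSing φ) :
    ∃ hM : IsSylowTrivial S M, tateClassHom hS (SylowTrivialGroup.mk M hM) = φ := by
  obtain ⟨m, h1, h2, ε, θ, h⟩ := exists_nearUnit_of_iso (sylowPSub hS) M e
  have hM : IsSylowTrivial S M := h.exists_iso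
  refine ⟨hM, tateClassHom_mk hS hM ⟨h1, h2, ?_⟩⟩
  refine (h.notMem_iff (card_cast_eq_zero (sylowPSub hS)) (h1 ⟨sylowPSub hS⟩)).2 ?_
  rw [h.ε_w]
  exact one_ne_zero

/-- A module representing the twisted complex of `φ` in the singularity category exists, and it is
recognized as Sylow-trivial of class `φ`. -/
lemma tateClassHom_surjective : Function.Surjective (tateClassHom (k := k) hS) := by
  intro x
  obtain ⟨φ, rfl⟩ := QuotientGroup.mk_surjective x
  obtain ⟨M, hM, ⟨e⟩⟩ := exists_moduleSing_iso_steinbergSing φ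
  obtain ⟨hM', h⟩ := exists_isSylowTrivial_of_iso hS M e
  exact ⟨_, h⟩

/-- The isomorphism from the group of Sylow-trivial modules to `H¹`. -/
def tateClassEquiv : SylowTrivialGroup k S ≃* H1 (OrbitCat p G) kˣ :=
  MulEquiv.ofBijective (tateClassHom hS) ⟨tateClassHom_injective hS, tateClassHom_surjective hS⟩

end Main

end

end SylowTriv

theorem theorem1p1 {k G : Type u} [Field k] [Group G] [Finite G] (p : ℕ) [Fact p.Prime]
    [CharP k p] (hp : p ∣ Nat.card G) (S : Sylow p G) :
    ∃ Φ : SylowTrivialGroup k S ≃* H1 (OrbitCat p G) kˣ,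
      (∀ (M : Rep.{u} k G) (hM : IsSylowTrivial S M),
        (∀ X : OrbitCat p G, Module.finrank k ((tateFunctor p M).obj (op X)) = 1) ∧
        (∀ (X Y : OrbitCat p G) (f : X ⟶ Y), IsIso ((tateFunctor p M).map f.op)) ∧
        ∀ b : ∀ X : OrbitCat p G, k ≃ₗ[k] (tateFunctor p M).obj (op X),
          ∃ φ : Z1 (OrbitCat p G) kˣ, IsTateCocycle M b φ ∧
            Φ (SylowTrivialGroup.mk M hM) = (φ : H1 (OrbitCat p G) kˣ)) ∧
      ∀ φ : Z1 (OrbitCat p G) kˣ,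
        (∃ (M : Rep.{u} k G) (_ : Module.Finite k M.V),
          Nonempty (moduleSing M ≅ steinbergSing φ)) ∧
        ∀ (M : Rep.{u} k G) [Module.Finite k M.V],
          Nonempty (moduleSing M ≅ steinbergSing φ) ↔
            ∃ hM : IsSylowTrivial S M,
              Φ.symm (φ : H1 (OrbitCat p G) kˣ) = SylowTrivialGroup.mk M hM := by
  have hS : (S : Subgroup G) ≠ ⊥ := S.ne_bot_of_dvd_card hp
  refine ⟨tateClassEquiv hS, fun M hM => ⟨fun X => hM.finrank_tate hS X, fun X Y f => ?_,
    fun b => ?_⟩, fun φ => ⟨exists_moduleSing_iso_steinbergSing φ, fun M _ => ⟨?_, ?_⟩⟩⟩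
  · rw [ConcreteCategory.isIso_iff_bijective]
    exact hM.bijective_tateMap hS f
  · obtain ⟨φ, hφ⟩ := exists_isTateCocycle M (hM.bijective_tateMap hS) b
    obtain ⟨m, hm⟩ := hφ.exists_isTateSystem (sylowPSub hS)
    exact ⟨φ, hφ, tateClassHom_mk hS hM hm⟩
  · rintro ⟨e⟩
    obtain ⟨hM, h⟩ := exists_isSylowTrivial_of_iso hS M e
    exact ⟨hM, (MulEquiv.symm_apply_eq _).2 h.symm⟩
  · rintro ⟨hM, h⟩
    -- A module `N` realizing the complex also has class `φ`, so by injectivity `M` and `N` are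
    -- stably isomorphic, hence isomorphic in the singularity category.
    obtain ⟨N, hN, ⟨e⟩⟩ := exists_moduleSing_iso_steinbergSing φ
    obtain ⟨hN', h'⟩ := exists_isSylowTrivial_of_iso hS N e
    have h1 : SylowTrivialGroup.mk M hM = SylowTrivialGroup.mk N hN' :=
      h.symm.trans ((MulEquiv.symm_apply_eq _).2 h'.symm)
    obtain ⟨e'⟩ := StableIso.nonempty_moduleSing_iso (Quotient.exact h1)
    exact ⟨e' ≪≫ e⟩
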